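/- Let $n\ge 0$, $h>0$, $\varepsilon\in\mathbb R$, and let $M$ be either $\mathbb R^n$ with its Euclidean metric or a smooth compact Riemannian manifold of dimension $n$ without boundary, with Laplace-Beltrami operator $\Delta$. Let $V_0,W\in C^\infty(M;\mathbb R)$ with $W$ bounded. Put $\alpha=\liminf_{x\to\infty}V_0(x)\in[-\infty,+\infty]$ if $M=\mathbb R^n$, and $\alpha=+\infty$ if $M$ is compact. Let $P_0$ be the Friedrichs extension of $-h^2\Delta+V_0$ from $C_0^\infty(M)$ in $L^2(M)$, the space of complex square integrable functions for the Riemannian volume (it exists whenever $\alpha>-\infty$; for $\alpha=-\infty$ the claim below about the spectrum is void), and let $P_\varepsilon=P_0+i\varepsilon W$, with the same domain as $P_0$. Then $P_\varepsilon$ is a closed operator if $\alpha>-\infty$, and its spectrum in the half-plane $\{z\in\mathbb C:\ \Re z<\alpha\}$ is discrete: every point of the spectrum of $P_\varepsilon$ in this half-plane is an isolated point of the spectrum and an eigenvalue of $P_\varepsilon$ of finite algebraic multiplicity, that is, the Riesz projection $\frac1{2\pi i}\oint(z-P_\varepsilon)^{-1}\,dz$ over a small circle around it has finite rank. -/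

import Mathlib

open Filter Topology MeasureTheory Manifold
open scoped ContDiff ENNReal InnerProductSpace Laplacian

/-! ### Unbounded operators on a complex Hilbert space -/

section Operators

variable {E : Type*} [NormedAddCommGroup E] [InnerProductSpace ℂ E]

/-- `T` is symmetric and bounded from below: `⟪T u, u⟫ ≥ c ‖u‖²` for all `u` in the domain. -/
def IsSemibounded (T : E →ₗ.[ℂ] E) : Prop :=
  T.IsFormalAdjoint T ∧
    ∃ c : ℝ, ∀ u : T.domain, c * ‖(u : E)‖ ^ 2 ≤ (⟪T u, (u : E)⟫_ℂ).re

/-- `u` is in the domain of the closure of the quadratic form `q(v) = ⟪T v, v⟫`, `v ∈ D(T)`: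
there are `v k ∈ D(T)` with `v k → u` and `q(v k - v l) → 0` as `k, l → ∞`. -/
def MemFormDomain (T : E →ₗ.[ℂ] E) (u : E) : Prop :=
  ∃ v : ℕ → T.domain, Tendsto (fun k => (v k : E)) atTop (𝓝 u) ∧
    Tendsto (fun p : ℕ × ℕ => (⟪T (v p.1 - v p.2), ((v p.1 - v p.2 : T.domain) : E)⟫_ℂ).re)
      atTop (𝓝 0)

/-- The parallelogram law for the quadratic form of an operator. -/
theorem quadForm_parallelogram (T : E →ₗ.[ℂ] E) (a b : T.domain) :
    (⟪T (a + b), ((a + b : T.domain) : E)⟫_ℂ).re + (⟪T (a - b), ((a - b : T.domain) : E)⟫_ℂ).re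
      = 2 * (⟪T a, (a : E)⟫_ℂ).re + 2 * (⟪T b, (b : E)⟫_ℂ).re := by
  simp only [LinearPMap.map_add, LinearPMap.map_sub, Submodule.coe_add, AddSubgroupClass.coe_sub,
    inner_add_left, inner_add_right, inner_sub_left, inner_sub_right, Complex.add_re,
    Complex.sub_re]
  ring

theorem MemFormDomain.add {T : E →ₗ.[ℂ] E} (hT : IsSemibounded T) {u u' : E}
    (hu : MemFormDomain T u) (hu' : MemFormDomain T u') : MemFormDomain T (u + u') := by
  obtain ⟨-, c, hc⟩ := hT
  obtain ⟨v, hv, hq⟩ := hu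
  obtain ⟨v', hv', hq'⟩ := hu'
  refine ⟨fun k => v k + v' k, by simpa using hv.add hv', ?_⟩
  have key : ∀ w : ℕ → T.domain, ∀ x : E, Tendsto (fun k => (w k : E)) atTop (𝓝 x) →
      Tendsto (fun p : ℕ × ℕ => c * ‖((w p.1 - w p.2 : T.domain) : E)‖ ^ 2) atTop (𝓝 0) := by
    intro w x hw
    have h1 : Tendsto (fun p : ℕ × ℕ => (w p.1 : E) - (w p.2 : E)) atTop (𝓝 (x - x)) := by
      rw [← prod_atTop_atTop_eq]
      exact (hw.comp tendsto_fst).sub (hw.comp tendsto_snd)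
    simpa using ((h1.norm.pow 2).const_mul c)
  have hs := key (fun k => v k + v' k) (u + u') (by simpa using hv.add hv')
  have hd := key (fun k => v k - v' k) (u - u') (by simpa using hv.sub hv')
  have hup := ((hq.const_mul 2).add (hq'.const_mul 2)).sub hd
  simp only [mul_zero, add_zero, sub_zero] at hup
  refine tendsto_of_tendsto_of_tendsto_of_le_of_le hs hup (fun p => hc _) (fun p => ?_)
  have h1 := quadForm_parallelogram T (v p.1 - v p.2) (v' p.1 - v' p.2)
  have h2 := hc ((v p.1 - v' p.1) - (v p.2 - v' p.2))
  have e1 : (v p.1 - v p.2) + (v' p.1 - v' p.2) = (v p.1 + v' p.1) - (v p.2 + v' p.2) := by abel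
  have e2 : (v p.1 - v p.2) - (v' p.1 - v' p.2) = (v p.1 - v' p.1) - (v p.2 - v' p.2) := by abel
  rw [e1, e2] at h1
  simp only
  linarith

theorem MemFormDomain.smul {T : E →ₗ.[ℂ] E} (a : ℂ) {u : E} (hu : MemFormDomain T u) :
    MemFormDomain T (a • u) := by
  obtain ⟨v, hv, hq⟩ := hu
  refine ⟨fun k => a • v k, by simpa using hv.const_smul a, ?_⟩
  have h := hq.const_mul (‖a‖ ^ 2)
  rw [mul_zero] at h
  refine h.congr fun p => ?_
  simp only [← smul_sub]
  rw [T.map_smul, Submodule.coe_smul, inner_smul_left, inner_smul_right, ← mul_assoc,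
    Complex.conj_mul', ← Complex.ofReal_pow, Complex.re_ofReal_mul]

/-- The form domain of a semibounded operator, as a subspace. -/
def formDomain (T : E →ₗ.[ℂ] E) (hT : IsSemibounded T) : Submodule ℂ E where
  carrier := {u | MemFormDomain T u}
  add_mem' := fun h h' => MemFormDomain.add hT h h'
  zero_mem' := ⟨fun _ => 0, by simp, by simp⟩
  smul_mem' := fun a _ h => MemFormDomain.smul a h

open scoped Classical in
/-- The Friedrichs extension of a densely defined semibounded operator `T`: the restriction of
the adjoint `T†` to those elements of its domain that lie in the form domain of `T`.
(If `T` is not semibounded there is no Friedrichs extension, and the value is `T`.) -/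
noncomputable def friedrichsExtension [CompleteSpace E] (T : E →ₗ.[ℂ] E) : E →ₗ.[ℂ] E :=
  if hT : IsSemibounded T then T.adjoint.domRestrict (formDomain T hT) else T

/-- `R` is the bounded everywhere defined inverse `(P - z)⁻¹`: `R v = u` iff `u ∈ D(P)` and
`P u - z u = v`. -/
def IsResolventAt (P : E →ₗ.[ℂ] E) (z : ℂ) (R : E →L[ℂ] E) : Prop :=
  ∀ v u : E, R v = u ↔ ∃ hu : u ∈ P.domain, P ⟨u, hu⟩ - z • u = v

/-- The resolvent set of an unbounded operator. -/
def opResolventSet (P : E →ₗ.[ℂ] E) : Set ℂ := {z | ∃ R : E →L[ℂ] E, IsResolventAt P z R}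

/-- The spectrum of an unbounded operator. -/
def opSpectrum (P : E →ₗ.[ℂ] E) : Set ℂ := (opResolventSet P)ᶜ

open scoped Classical in
/-- The resolvent `z ↦ (P - z)⁻¹`, extended by `0` to the spectrum. -/
noncomputable def opResolvent (P : E →ₗ.[ℂ] E) (z : ℂ) : E →L[ℂ] E :=
  if h : z ∈ opResolventSet P then h.choose else 0

/-- The Riesz operator `(2πi)⁻¹ ∮ (z - P)⁻¹ dz` over the circle of centre `w` and radius `r`. -/
noncomputable def rieszProjection (P : E →ₗ.[ℂ] E) (w : ℂ) (r : ℝ) : E →L[ℂ] E :=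
  (2 * Real.pi * Complex.I)⁻¹ • ∮ z in C(w, r), -opResolvent P z

/-- `w` is an isolated point of the spectrum, an eigenvalue, and has finite algebraic
multiplicity, that is, its Riesz projection has finite rank. -/
def IsDiscreteEigenvalue (P : E →ₗ.[ℂ] E) (w : ℂ) : Prop :=
  (∃ u : P.domain, u ≠ 0 ∧ P u = w • (u : E)) ∧
    ∃ r : ℝ, 0 < r ∧ (∀ z ∈ Metric.closedBall w r, z ≠ w → z ∉ opSpectrum P) ∧
      FiniteDimensional ℂ (rieszProjection P w r).range

/-- The spectrum of `P` in the half-plane `Re z < α` is discrete: it consists of isolated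
eigenvalues of finite algebraic multiplicity. -/
def HasDiscreteSpectrumBelow (P : E →ₗ.[ℂ] E) (α : EReal) : Prop :=
  ∀ z ∈ opSpectrum P, (z.re : EReal) < α → IsDiscreteEigenvalue P z

end Operators

/-! ### Operators on `L²` -/

section L2

variable {X : Type*} [MeasurableSpace X]

/-- The operator in `L²(μ)` with domain (the classes of) the functions in `D`, acting by
`u ↦ A u`, for a vector space `D` of square integrable functions and a linear map `A` from `D` to
square integrable functions. It is given by its graph; under these assumptions the set of pairs
below is already a subspace, so that taking the span changes nothing. -/
noncomputable def operatorOn (μ : Measure X) (D : Set (X → ℂ)) (A : (X → ℂ) → X → ℂ) :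
    Lp ℂ 2 μ →ₗ.[ℂ] Lp ℂ 2 μ :=
  (Submodule.span ℂ {p : Lp ℂ 2 μ × Lp ℂ 2 μ |
    ∃ u ∈ D, (p.1 : X → ℂ) =ᵐ[μ] u ∧ (p.2 : X → ℂ) =ᵐ[μ] A u}).toLinearPMap

/-- Multiplication by an (essentially) bounded function on `L²(μ)`. -/
noncomputable def mulOperator (μ : Measure X) (a : X → ℂ) (ha : MemLp a ∞ μ) :
    Lp ℂ 2 μ →L[ℂ] Lp ℂ 2 μ :=
  (ContinuousLinearMap.mul ℂ ℂ).holderL μ ∞ 2 2 (ha.toLp a)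

/-- The function `iεW` is in `L^∞` if `W` is continuous and bounded. -/
theorem memLp_perturbation [TopologicalSpace X] [OpensMeasurableSpace X] (μ : Measure X)
    {W : X → ℝ} (hW : Continuous W) (hb : ∃ C : ℝ, ∀ x, |W x| ≤ C) (ε : ℝ) :
    MemLp (fun x => Complex.I * ε * W x : X → ℂ) ∞ μ := by
  obtain ⟨C, hC⟩ := hb
  have hm : Measurable (fun x => Complex.I * ε * W x : X → ℂ) :=
    (Complex.measurable_ofReal.comp hW.measurable).const_mul _
  refine memLp_top_of_bound hm.aestronglyMeasurable (|ε| * C) (ae_of_all _ fun x => ?_)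
  simpa using mul_le_mul_of_nonneg_left (hC x) (abs_nonneg ε)

/-- `P + iεW` for an operator `P` in `L²(μ)` and a bounded continuous function `W`,
with the same domain as `P`. -/
noncomputable def perturbedOperator [TopologicalSpace X] [OpensMeasurableSpace X] (μ : Measure X)
    (P : Lp ℂ 2 μ →ₗ.[ℂ] Lp ℂ 2 μ) {W : X → ℝ} (hW : Continuous W)
    (hb : ∃ C : ℝ, ∀ x, |W x| ≤ C) (ε : ℝ) : Lp ℂ 2 μ →ₗ.[ℂ] Lp ℂ 2 μ :=
  (mulOperator μ _ (memLp_perturbation μ hW hb ε)).toLinearMap +ᵥ P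

end L2

/-! ### Schrödinger operators on `ℝⁿ` -/

/-- `P₀`: the Friedrichs extension of `-h²Δ + V` from `C₀^∞(ℝⁿ)`. -/
noncomputable def euclideanSchrodinger (n : ℕ) (h : ℝ) (V : EuclideanSpace ℝ (Fin n) → ℝ) :
    Lp ℂ 2 (volume : Measure (EuclideanSpace ℝ (Fin n))) →ₗ.[ℂ]
      Lp ℂ 2 (volume : Measure (EuclideanSpace ℝ (Fin n))) :=
  friedrichsExtension (operatorOn volume {u | ContDiff ℝ ∞ u ∧ HasCompactSupport u}
    fun u x => -(h : ℂ) ^ 2 * Δ u x + V x * u x)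

/-! ### Schrödinger operators on Riemannian manifolds -/

section Riemannian

variable {n : ℕ} {M : Type*} [TopologicalSpace M] [ChartedSpace (EuclideanSpace ℝ (Fin n)) M]
  [IsManifold (𝓡 n) ∞ M]

/-- A smooth Riemannian metric on `M`. -/
abbrev SmoothMetric (n : ℕ) (M : Type*) [TopologicalSpace M]
    [ChartedSpace (EuclideanSpace ℝ (Fin n)) M] [IsManifold (𝓡 n) ∞ M] :=
  Bundle.ContMDiffRiemannianMetric (𝓡 n) ∞ (EuclideanSpace ℝ (Fin n))
    (fun x : M => TangentSpace (𝓡 n) x)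

/-- The `i`-th coordinate vector field of the chart at `x₀`, at the point with coordinates `y`. -/
noncomputable def coordVector (x₀ : M) (i : Fin n) (y : EuclideanSpace ℝ (Fin n)) :
    TangentSpace (𝓡 n) ((extChartAt (𝓡 n) x₀).symm y) :=
  mfderiv 𝓘(ℝ, EuclideanSpace ℝ (Fin n)) (𝓡 n) (extChartAt (𝓡 n) x₀).symm y
    (EuclideanSpace.single i (1 : ℝ) : EuclideanSpace ℝ (Fin n))

/-- The matrix `(g_ij)` of the metric in the chart at `x₀`, at the point with coordinates `y`. -/
noncomputable def metricMatrix (g : SmoothMetric n M) (x₀ : M) (y : EuclideanSpace ℝ (Fin n)) :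
    Matrix (Fin n) (Fin n) ℝ :=
  Matrix.of fun i j =>
    g.inner ((extChartAt (𝓡 n) x₀).symm y) (coordVector x₀ i y) (coordVector x₀ j y)

/-- The volume density `√(det g)` in the chart at `x₀`. -/
noncomputable def volumeDensity (g : SmoothMetric n M) (x₀ : M) (y : EuclideanSpace ℝ (Fin n)) :
    ℝ :=
  √(metricMatrix g x₀ y).det

/-- The Riemannian volume in the chart at `x₀`: the measure `√(det g) dy` on the range of the
chart, transported to `M`. It is carried by the domain of the chart. -/
noncomputable def chartVolume [MeasurableSpace M] (g : SmoothMetric n M) (x₀ : M) : Measure M :=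
  (((volume.restrict (extChartAt (𝓡 n) x₀).target).withDensity
    fun y => ENNReal.ofReal (volumeDensity g x₀ y))).map (extChartAt (𝓡 n) x₀).symm

/-- The Riemannian volume measure of `(M, g)`. The measures `chartVolume g x₀` agree on the
overlaps of the charts, and so their supremum is the measure that restricts to each of them on the
domain of the corresponding chart. -/
noncomputable def riemannianVolume [MeasurableSpace M] (g : SmoothMetric n M) : Measure M :=
  ⨆ x₀ : M, chartVolume g x₀

/-- The partial derivative `∂f/∂y_i`. -/
noncomputable def partialDeriv (i : Fin n) (f : EuclideanSpace ℝ (Fin n) → ℂ)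
    (y : EuclideanSpace ℝ (Fin n)) : ℂ :=
  fderiv ℝ f y (EuclideanSpace.single i 1)

/-- The Laplace-Beltrami operator: in local coordinates around `x`,
`Δu = (det g)^(-1/2) ∑_{i,j} ∂_i ((det g)^(1/2) g^{ij} ∂_j u)`. -/
noncomputable def laplaceBeltrami (g : SmoothMetric n M) (u : M → ℂ) (x : M) : ℂ :=
  ((volumeDensity g x (extChartAt (𝓡 n) x x))⁻¹ : ℝ) *
    ∑ i, partialDeriv i
      (fun y => (volumeDensity g x y : ℂ) *
        ∑ j, ((metricMatrix g x y)⁻¹ i j : ℂ) *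
          partialDeriv j (u ∘ (extChartAt (𝓡 n) x).symm) y)
      (extChartAt (𝓡 n) x x)

/-- `P₀`: the Friedrichs extension of `-h²Δ + V` from `C₀^∞(M)`. -/
noncomputable def riemannianSchrodinger [MeasurableSpace M] (g : SmoothMetric n M) (h : ℝ)
    (V : M → ℝ) : Lp ℂ 2 (riemannianVolume g) →ₗ.[ℂ] Lp ℂ 2 (riemannianVolume g) :=
  friedrichsExtension (operatorOn (riemannianVolume g)
    {u | ContMDiff (𝓡 n) 𝓘(ℝ, ℂ) ∞ u ∧ HasCompactSupport u}
    fun u x => -(h : ℂ) ^ 2 * laplaceBeltrami g u x + V x * u x)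

end Riemannian

/-!
Fix a real `β < α`. The potential `V` can lie below `β` only on a compact set, so that adding a
bounded potential `k`, compactly supported in the case of `ℝⁿ`, gives `V + k ≥ β`. Let `K` be
multiplication by `k`, let `S` be multiplication by `iεW`, and let `P = P₀ + S`. Since `Re ⟪S u, u⟫
= 0`, the operator `P + K - z` is coercive for `Re z < β`, and the Lax-Milgram argument on the
completion of the form domain (`exists_inverse_friedrichsExtension_add`) gives a holomorphic
inverse `Q z` with `‖Q z‖ ≤ (β - Re z)⁻¹`. It satisfies `P - z = (1 - K Q z) (P + K - z)`.

The family `K Q z` is holomorphic. It is compact: `Q z` maps bounded sets to sets that are bounded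
in the form norm, hence in `H¹` of the support of `k`, and Rellich's theorem
(`exists_finite_coloring_h1Ball`) applies. It has norm less than `1` far to the left. By the
analytic Fredholm theorem (`exists_local_fredholm_inverse`), `1 - K Q z` is invertible off a
discrete set, where it has a nonzero kernel, and its inverse is locally the sum of a holomorphic
family and of `d(z)⁻¹ L(z) M(z)`, with `d`, `L`, `M` holomorphic and `L(z) M(z)` factoring through
some `ℂᵏ`. The holomorphic part does not contribute to the Riesz projection, and the contour
integral of the other part has finite rank (`finiteDimensional_range_circleIntegral`). This is
`isClosed_and_hasDiscreteSpectrumBelow` for an abstract symmetric operator, and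
`isClosed_and_hasDiscreteSpectrumBelow_perturbedOperator` for an operator `-h² Lap + V` in `L²`,
where `Lap` satisfies Green's formula. The operator `P` is closed because it has a bounded
resolvent.

It remains to supply Green's formula and Rellich's theorem. In `ℝⁿ` both are direct, with `k` a
multiple of a bump function. On a closed manifold `k` is a constant. There the volumes in two
charts agree on the overlap, so that the Riemannian volume restricts to `√(det g) dy` in each chart
(`restrict_riemannianVolume`). Green's formula in a chart, tested against functions supported in
the intersection of two charts, shows that the Laplace-Beltrami operator does not depend on the
chart (`laplaceBeltrami_eq_chartLaplacian`); a partition of unity then globalizes Green's formula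
(`integral_laplaceBeltrami_mul`) and Rellich's theorem (`isFormCompactMultiplier_const`).
-/

/-! ### The form space and the Friedrichs extension -/

section FriedrichsExtension

variable {E : Type*} [NormedAddCommGroup E] [InnerProductSpace ℂ E]

/-- The domain of a symmetric operator `T` with `⟪T u, u⟫ + C ‖u‖² ≥ ‖u‖²`, as a type of its own
that carries the form inner product `⟪T a, b⟫ + C ⟪a, b⟫`. -/
def FormSpace (T : E →ₗ.[ℂ] E) (C : ℝ) (_hT : T.IsFormalAdjoint T)
    (_hC : ∀ u : T.domain, ‖(u : E)‖ ^ 2 ≤ (⟪T u, (u : E)⟫_ℂ).re + C * ‖(u : E)‖ ^ 2) : Type _ :=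
  T.domain

namespace FormSpace

variable {T : E →ₗ.[ℂ] E} {C : ℝ} {hT : T.IsFormalAdjoint T}
  {hC : ∀ u : T.domain, ‖(u : E)‖ ^ 2 ≤ (⟪T u, (u : E)⟫_ℂ).re + C * ‖(u : E)‖ ^ 2}

noncomputable instance : AddCommGroup (FormSpace T C hT hC) :=
  inferInstanceAs (AddCommGroup T.domain)

noncomputable instance : Module ℂ (FormSpace T C hT hC) := inferInstanceAs (Module ℂ T.domain)

/-- The identification of the domain with the form space. -/
def of : T.domain ≃ₗ[ℂ] FormSpace T C hT hC := LinearEquiv.refl ℂ T.domain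

/-- The form inner product `⟪T a, b⟫ + C ⟪a, b⟫`. -/
noncomputable abbrev core : InnerProductSpace.Core ℂ (FormSpace T C hT hC) where
  inner a b := ⟪T (of.symm a), (of.symm b : E)⟫_ℂ + C * ⟪(of.symm a : E), (of.symm b : E)⟫_ℂ
  conj_inner_symm a b := by
    simp only [map_add, map_mul, inner_conj_symm, Complex.conj_ofReal]
    rw [hT]
  re_inner_nonneg a := by
    have h := hC (of.symm a)
    have h2 : (⟪(of.symm a : E), (of.symm a : E)⟫_ℂ) = ((‖(of.symm a : E)‖ ^ 2 : ℝ) : ℂ) := by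
      rw [inner_self_eq_norm_sq_to_K]; push_cast; rfl
    simp only [map_add, h2, ← Complex.ofReal_mul, RCLike.re_to_complex, Complex.ofReal_re]
    exact (sq_nonneg _).trans h
  add_left a b c := by
    simp only [map_add, LinearPMap.map_add, Submodule.coe_add, inner_add_left]; ring
  smul_left a b r := by
    simp only [map_smul, LinearPMap.map_smul, Submodule.coe_smul, inner_smul_left]; ring
  definite a h := by
    have h1 := hC (of.symm a)
    have h2 : (⟪(of.symm a : E), (of.symm a : E)⟫_ℂ) = ((‖(of.symm a : E)‖ ^ 2 : ℝ) : ℂ) := by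
      rw [inner_self_eq_norm_sq_to_K]; push_cast; rfl
    have h3 := congrArg Complex.re h
    simp only [Complex.add_re, h2, ← Complex.ofReal_mul, Complex.ofReal_re, Complex.zero_re] at h3
    have h4 : ‖(of.symm a : E)‖ ^ 2 = 0 := le_antisymm (h1.trans h3.le) (sq_nonneg _)
    have h5 : (of.symm a : E) = 0 := by simpa using h4
    have h6 : of.symm a = 0 := by ext; simpa using h5
    simpa using h6

noncomputable instance : NormedAddCommGroup (FormSpace T C hT hC) :=
  core.toNormedAddCommGroup

noncomputable instance : InnerProductSpace ℂ (FormSpace T C hT hC) :=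
  InnerProductSpace.ofCore core.toCore

theorem inner_of (a b : T.domain) :
    ⟪(of a : FormSpace T C hT hC), of b⟫_ℂ
      = ⟪T a, (b : E)⟫_ℂ + C * ⟪(a : E), (b : E)⟫_ℂ := rfl

theorem norm_sq_of (a : T.domain) :
    ‖(of a : FormSpace T C hT hC)‖ ^ 2 = (⟪T a, (a : E)⟫_ℂ).re + C * ‖(a : E)‖ ^ 2 := by
  rw [← inner_self_eq_norm_sq (𝕜 := ℂ), inner_of]
  have h2 : (⟪(a : E), (a : E)⟫_ℂ) = ((‖(a : E)‖ ^ 2 : ℝ) : ℂ) := by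
    rw [inner_self_eq_norm_sq_to_K]; push_cast; rfl
  rw [h2, ← Complex.ofReal_mul, map_add]
  simp only [RCLike.re_to_complex, Complex.ofReal_re]

theorem norm_le_norm_of (a : T.domain) : ‖(a : E)‖ ≤ ‖(of a : FormSpace T C hT hC)‖ := by
  refine le_of_sq_le_sq ?_ (norm_nonneg _)
  rw [norm_sq_of]
  exact hC a

/-- The inclusion of the form space in the Hilbert space. -/
noncomputable def incl : FormSpace T C hT hC →L[ℂ] E :=
  LinearMap.mkContinuous (T.domain.subtype ∘ₗ of.symm.toLinearMap) 1 fun a => by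
    obtain ⟨a, rfl⟩ := of.surjective a
    simpa using norm_le_norm_of a

theorem incl_of (a : T.domain) : incl (of a : FormSpace T C hT hC) = a := rfl

/-- The map from the completed form space to the Hilbert space. -/
noncomputable def toHilbert [CompleteSpace E] :
    UniformSpace.Completion (FormSpace T C hT hC) →L[ℂ] E :=
  incl.extend UniformSpace.Completion.toComplL

theorem toHilbert_coe [CompleteSpace E] (a : FormSpace T C hT hC) :
    toHilbert (a : UniformSpace.Completion (FormSpace T C hT hC)) = incl a :=
  ContinuousLinearMap.extend_eq _ UniformSpace.Completion.denseRange_coe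
    (UniformSpace.Completion.isUniformInducing_coe _) a

theorem inner_coe_of [CompleteSpace E] (u : UniformSpace.Completion (FormSpace T C hT hC))
    (x : T.domain) :
    ⟪u, ((of x : FormSpace T C hT hC) : UniformSpace.Completion (FormSpace T C hT hC))⟫_ℂ
      = ⟪toHilbert u, T x⟫_ℂ + C * ⟪toHilbert u, (x : E)⟫_ℂ := by
  refine UniformSpace.Completion.induction_on u ?_ fun a => ?_
  · exact isClosed_eq (by fun_prop) (by fun_prop)
  · obtain ⟨a, rfl⟩ := of.surjective a
    rw [UniformSpace.Completion.inner_coe, inner_of, toHilbert_coe, incl_of, hT]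

theorem exists_seq_of [CompleteSpace E] (u : UniformSpace.Completion (FormSpace T C hT hC)) :
    ∃ v : ℕ → T.domain, Tendsto (fun k => ((of (v k) : FormSpace T C hT hC) :
      UniformSpace.Completion (FormSpace T C hT hC))) atTop (𝓝 u) := by
  have h := (UniformSpace.Completion.denseRange_coe (α := FormSpace T C hT hC)) u
  obtain ⟨x, hx, hxu⟩ := mem_closure_iff_seq_limit.1 h
  choose y hy using hx
  refine ⟨fun k => of.symm (y k), ?_⟩
  simpa [hy] using hxu

theorem tendsto_toHilbert [CompleteSpace E] {u : UniformSpace.Completion (FormSpace T C hT hC)}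
    {v : ℕ → T.domain} (h : Tendsto (fun k => ((of (v k) : FormSpace T C hT hC) :
      UniformSpace.Completion (FormSpace T C hT hC))) atTop (𝓝 u)) :
    Tendsto (fun k => (v k : E)) atTop (𝓝 (toHilbert u)) := by
  have := (toHilbert.continuous.tendsto u).comp h
  simpa [Function.comp_def, toHilbert_coe, incl_of] using this

/-- Elements of the completed form space map into the form domain. -/
theorem memFormDomain_toHilbert [CompleteSpace E]
    (u : UniformSpace.Completion (FormSpace T C hT hC)) : MemFormDomain T (toHilbert u) := by
  obtain ⟨v, hv⟩ := exists_seq_of u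
  refine ⟨v, tendsto_toHilbert hv, ?_⟩
  have h1 : Tendsto (fun p : ℕ × ℕ => ((of (v p.1) : FormSpace T C hT hC) :
      UniformSpace.Completion (FormSpace T C hT hC)) - ((of (v p.2) : FormSpace T C hT hC) :
      UniformSpace.Completion (FormSpace T C hT hC))) atTop (𝓝 (u - u)) := by
    rw [← prod_atTop_atTop_eq]
    exact (hv.comp tendsto_fst).sub (hv.comp tendsto_snd)
  rw [sub_self] at h1
  have h2 : Tendsto (fun p : ℕ × ℕ => ((v p.1 : E) - (v p.2 : E))) atTop (𝓝 0) := by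
    have := (toHilbert.continuous.tendsto _).comp h1
    simpa [Function.comp_def, toHilbert_coe, incl_of] using this
  have h3 := (h1.norm.pow 2).sub ((h2.norm.pow 2).const_mul C)
  simp only [norm_zero, ne_eq, OfNat.ofNat_ne_zero, not_false_eq_true, zero_pow, mul_zero,
    sub_zero] at h3
  refine h3.congr fun p => ?_
  rw [← UniformSpace.Completion.coe_sub, ← map_sub, UniformSpace.Completion.norm_coe, norm_sq_of]
  simp

/-- Every element of the form domain comes from the completed form space. -/
theorem exists_toHilbert_eq_of_memFormDomain [CompleteSpace E] {u : E} (hu : MemFormDomain T u) :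
    ∃ w : UniformSpace.Completion (FormSpace T C hT hC), toHilbert w = u := by
  obtain ⟨v, hv, hq⟩ := hu
  have h1 : Tendsto (fun p : ℕ × ℕ => (v p.1 : E) - (v p.2 : E)) atTop (𝓝 (u - u)) := by
    rw [← prod_atTop_atTop_eq]
    exact (hv.comp tendsto_fst).sub (hv.comp tendsto_snd)
  have h2 := hq.add ((h1.norm.pow 2).const_mul C)
  simp only [sub_self, norm_zero, ne_eq, OfNat.ofNat_ne_zero, not_false_eq_true, zero_pow,
    mul_zero, add_zero] at h2
  have h3 : Tendsto (fun p : ℕ × ℕ => ‖(of (v p.1 - v p.2) : FormSpace T C hT hC)‖ ^ 2)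
      atTop (𝓝 0) := by
    refine h2.congr fun p => ?_
    rw [norm_sq_of]; simp
  have h4 : Tendsto (fun p : ℕ × ℕ => ‖(of (v p.1 - v p.2) : FormSpace T C hT hC)‖)
      atTop (𝓝 0) := by
    have := h3.sqrt
    simpa using this
  have h5 : CauchySeq fun k => ((of (v k) : FormSpace T C hT hC) :
      UniformSpace.Completion (FormSpace T C hT hC)) := by
    rw [cauchySeq_iff_tendsto_dist_atTop_0]
    refine h4.congr fun p => ?_
    rw [dist_eq_norm, ← UniformSpace.Completion.coe_sub, UniformSpace.Completion.norm_coe, map_sub]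
  obtain ⟨w, hw⟩ := cauchySeq_tendsto_of_complete h5
  exact ⟨w, tendsto_nhds_unique (tendsto_toHilbert hw) hv⟩

end FormSpace

variable [CompleteSpace E]

/-- The Friedrichs extension sends `u` to `f` iff `u` is in the form domain and `f = T† u`. -/
theorem mem_friedrichsExtension_graph {T : E →ₗ.[ℂ] E} (hd : Dense (T.domain : Set E))
    (hT : IsSemibounded T) (u f : E) :
    (∃ hu : u ∈ (friedrichsExtension T).domain, friedrichsExtension T ⟨u, hu⟩ = f) ↔
      MemFormDomain T u ∧ ∀ x : T.domain, ⟪f, (x : E)⟫_ℂ = ⟪u, T x⟫_ℂ := by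
  have hF : friedrichsExtension T = T.adjoint.domRestrict (formDomain T hT) := by
    simp [friedrichsExtension, hT]
  rw [hF]
  constructor
  · rintro ⟨hu, rfl⟩
    refine ⟨hu.1, fun x => ?_⟩
    have h := LinearPMap.domRestrict_apply (f := T.adjoint)
      (x := ⟨u, hu⟩) (y := ⟨u, hu.2⟩) rfl
    exact (congrArg (fun y => ⟪y, (x : E)⟫_ℂ) h).trans
      (LinearPMap.adjoint_isFormalAdjoint hd ⟨u, hu.2⟩ x)
  · rintro ⟨h1, h2⟩
    have h3 : u ∈ T.adjoint.domain := LinearPMap.mem_adjoint_domain_of_exists _ ⟨f, h2⟩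
    refine ⟨⟨h1, h3⟩, ?_⟩
    exact (LinearPMap.domRestrict_apply (f := T.adjoint)
      (x := ⟨u, ⟨h1, h3⟩⟩) (y := ⟨u, h3⟩) rfl).trans (LinearPMap.adjoint_apply_eq hd _ h2)

/-- Elements of the domain of the Friedrichs extension are approximated by elements of the
domain of `T` in such a way that the values of the quadratic form converge as well. -/
theorem exists_seq_tendsto_quadForm {T : E →ₗ.[ℂ] E} (hd : Dense (T.domain : Set E))
    (hT : IsSemibounded T) (u : (friedrichsExtension T).domain) :
    ∃ v : ℕ → T.domain, Tendsto (fun k => (v k : E)) atTop (𝓝 (u : E)) ∧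
      Tendsto (fun k => (⟪T (v k), (v k : E)⟫_ℂ).re) atTop
        (𝓝 (⟪friedrichsExtension T u, (u : E)⟫_ℂ).re) := by
  obtain ⟨c, hc⟩ := hT.2
  obtain ⟨hu, hf⟩ := (mem_friedrichsExtension_graph hd hT u (friedrichsExtension T u)).1 ⟨u.2, rfl⟩
  have hC : ∀ u : T.domain, ‖(u : E)‖ ^ 2
      ≤ (⟪T u, (u : E)⟫_ℂ).re + (1 - c) * ‖(u : E)‖ ^ 2 := fun u => by linarith [hc u]
  obtain ⟨w, hw⟩ := FormSpace.exists_toHilbert_eq_of_memFormDomain (hT := hT.1) (hC := hC) hu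
  obtain ⟨v, hv⟩ := FormSpace.exists_seq_of w
  have hvu := FormSpace.tendsto_toHilbert hv
  rw [hw] at hvu
  refine ⟨v, hvu, ?_⟩
  -- both sides are limits of the form inner product of `w` with `v k`
  have h1 : Tendsto (fun k => ⟪w, ((FormSpace.of (v k) : FormSpace T (1 - c) hT.1 hC) :
      UniformSpace.Completion (FormSpace T (1 - c) hT.1 hC))⟫_ℂ) atTop (𝓝 ⟪w, w⟫_ℂ) :=
    Tendsto.inner tendsto_const_nhds hv
  have h2 : Tendsto (fun k => ⟪w, ((FormSpace.of (v k) : FormSpace T (1 - c) hT.1 hC) :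
      UniformSpace.Completion (FormSpace T (1 - c) hT.1 hC))⟫_ℂ) atTop
      (𝓝 (⟪friedrichsExtension T u, (u : E)⟫_ℂ + ((1 - c : ℝ) : ℂ) * ⟪(u : E), (u : E)⟫_ℂ)) := by
    simp only [FormSpace.inner_coe_of, hw, ← hf]
    exact (Tendsto.inner tendsto_const_nhds hvu).add
      ((Tendsto.inner tendsto_const_nhds hvu).const_mul _)
  have h3 := congrArg Complex.re (tendsto_nhds_unique h1 h2)
  have h4 := (hv.norm.pow 2).sub ((hvu.norm.pow 2).const_mul (1 - c))
  have e1 : (⟪w, w⟫_ℂ).re = ‖w‖ ^ 2 := inner_self_eq_norm_sq (𝕜 := ℂ) w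
  have e2 : (⟪(u : E), (u : E)⟫_ℂ) = ((‖(u : E)‖ ^ 2 : ℝ) : ℂ) := by
    rw [inner_self_eq_norm_sq_to_K]; push_cast; rfl
  rw [e1, e2, Complex.add_re, ← Complex.ofReal_mul, Complex.ofReal_re] at h3
  rw [h3, add_sub_cancel_right] at h4
  refine h4.congr fun k => ?_
  rw [UniformSpace.Completion.norm_coe, FormSpace.norm_sq_of]
  ring

/-- Lax-Milgram for the Friedrichs extension: if `T + B` is coercive on the domain of `T`, for a
bounded operator `B`, then `friedrichsExtension T + B` has a bounded inverse. -/
theorem exists_inverse_friedrichsExtension_add {T : E →ₗ.[ℂ] E} (hd : Dense (T.domain : Set E))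
    (hT : IsSemibounded T) (B : E →L[ℂ] E) {δ : ℝ} (hδ : 0 < δ)
    (hB : ∀ u : T.domain, δ * ‖(u : E)‖ ^ 2 ≤ (⟪T u + B u, (u : E)⟫_ℂ).re) :
    ∃ R : E →L[ℂ] E, (∀ v u : E, R v = u ↔ ∃ hu : u ∈ (friedrichsExtension T).domain,
      friedrichsExtension T ⟨u, hu⟩ + B u = v) ∧ ∀ v, δ * ‖R v‖ ≤ ‖v‖ := by
  have hBle : ∀ u : E, |(⟪B u, u⟫_ℂ).re| ≤ ‖B‖ * ‖u‖ ^ 2 := fun u => by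
    calc |(⟪B u, u⟫_ℂ).re| ≤ ‖⟪B u, u⟫_ℂ‖ := Complex.abs_re_le_norm _
      _ ≤ ‖B u‖ * ‖u‖ := norm_inner_le_norm _ _
      _ ≤ (‖B‖ * ‖u‖) * ‖u‖ := by gcongr; exact B.le_opNorm u
      _ = ‖B‖ * ‖u‖ ^ 2 := by ring
  set C : ℝ := ‖B‖ + 1 with hCdef
  have hC : ∀ u : T.domain, ‖(u : E)‖ ^ 2 ≤ (⟪T u, (u : E)⟫_ℂ).re + C * ‖(u : E)‖ ^ 2 := by
    intro u
    have h1 := hB u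
    have h2 := (abs_le.1 (hBle u)).2
    rw [inner_add_left, Complex.add_re] at h1
    have h3 : 0 ≤ δ * ‖(u : E)‖ ^ 2 := by positivity
    rw [hCdef]; linarith
  let H := UniformSpace.Completion (FormSpace T C hT.1 hC)
  let J : H →L[ℂ] E := FormSpace.toHilbert
  -- the operator of the sesquilinear form of `T + B` with respect to the form inner product
  let A : H →L[ℂ] H := 1 + J.adjoint ∘L (B - (C : ℂ) • 1) ∘L J
  have hA : ∀ a b : H, ⟪A a, b⟫_ℂ = ⟪a, b⟫_ℂ + ⟪B (J a), J b⟫_ℂ - C * ⟪J a, J b⟫_ℂ := by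
    intro a b
    have e : A a = a + J.adjoint (B (J a) - (C : ℂ) • J a) := rfl
    rw [e, inner_add_left, ContinuousLinearMap.adjoint_inner_left, inner_sub_left,
      inner_smul_left, Complex.conj_ofReal]
    ring
  set t : ℝ := δ / (δ + (C + ‖B‖)) with ht
  have hden : 0 < δ + (C + ‖B‖) := by positivity
  have htpos : 0 < t := by positivity
  have hcoer : ∀ a : H, t * ‖a‖ ^ 2 ≤ (⟪A a, a⟫_ℂ).re := by
    intro a
    refine UniformSpace.Completion.induction_on a ?_ fun a => ?_
    · exact isClosed_le (by fun_prop) (by fun_prop)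
    · obtain ⟨a, rfl⟩ := FormSpace.of.surjective a
      rw [hA]
      have e1 : J ((FormSpace.of a : FormSpace T C hT.1 hC) : H) = a := by
        simp only [J]; rw [FormSpace.toHilbert_coe, FormSpace.incl_of]
      have e2 : (⟪(a : E), (a : E)⟫_ℂ) = ((‖(a : E)‖ ^ 2 : ℝ) : ℂ) := by
        rw [inner_self_eq_norm_sq_to_K]; push_cast; rfl
      rw [e1, UniformSpace.Completion.inner_coe, FormSpace.inner_of, e2,
        UniformSpace.Completion.norm_coe, FormSpace.norm_sq_of]
      have h1 := hB a
      rw [inner_add_left, Complex.add_re] at h1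
      have h2 := (abs_le.1 (hBle a)).1
      simp only [← Complex.ofReal_mul, Complex.add_re, Complex.sub_re, Complex.ofReal_re]
      have ht1 : t * (δ + (C + ‖B‖)) = δ := div_mul_cancel₀ _ hden.ne'
      have ht2 : 0 ≤ 1 - t := by
        rw [sub_nonneg, ht, div_le_one hden]
        have : 0 ≤ C + ‖B‖ := by positivity
        linarith
      -- interpolate between coercivity on `E` and the trivial lower bound
      have h3 := mul_le_mul_of_nonneg_left h1 ht2
      have h4 := mul_le_mul_of_nonneg_left h2 htpos.le
      have h5 : t * (C * ‖(a : E)‖ ^ 2 + ‖B‖ * ‖(a : E)‖ ^ 2)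
          = (1 - t) * (δ * ‖(a : E)‖ ^ 2) := by
        linear_combination (‖(a : E)‖ ^ 2) * ht1
      linarith
  have hunit : IsUnit A := by
    refine ContinuousLinearMap.isUnit_of_forall_le_norm_inner_map A
      (c := ⟨t, htpos.le⟩) htpos fun a => ?_
    calc ‖a‖ ^ 2 * t = t * ‖a‖ ^ 2 := mul_comm _ _
      _ ≤ (⟪A a, a⟫_ℂ).re := hcoer a
      _ ≤ ‖⟪A a, a⟫_ℂ‖ := Complex.re_le_norm _
  obtain ⟨A', hA'1, hA'2⟩ : ∃ A' : H →L[ℂ] H, (∀ x, A (A' x) = x) ∧ ∀ x, A' (A x) = x := by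
    obtain ⟨U, hU⟩ := hunit
    rw [← hU]
    exact ⟨↑U⁻¹, fun x => DFunLike.congr_fun U.mul_inv x, fun x => DFunLike.congr_fun U.inv_mul x⟩
  have hchar : ∀ v u : E, (J ∘L A' ∘L J.adjoint) v = u ↔
      ∃ hu : u ∈ (friedrichsExtension T).domain, friedrichsExtension T ⟨u, hu⟩ + B u = v := by
    intro v u
    have hgraph := mem_friedrichsExtension_graph hd hT u (v - B u)
    have hiff : (∃ hu : u ∈ (friedrichsExtension T).domain,
        friedrichsExtension T ⟨u, hu⟩ + B u = v) ↔
        MemFormDomain T u ∧ ∀ x : T.domain, ⟪v - B u, (x : E)⟫_ℂ = ⟪u, T x⟫_ℂ := by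
      rw [← hgraph]
      simp only [eq_sub_iff_add_eq]
    rw [hiff]
    constructor
    · rintro rfl
      set a : H := A' (J.adjoint v) with ha
      have haA : A a = J.adjoint v := hA'1 _
      refine ⟨FormSpace.memFormDomain_toHilbert a, fun x => ?_⟩
      have h1 : ⟪A a, ((FormSpace.of x : FormSpace T C hT.1 hC) : H)⟫_ℂ = ⟪v, (x : E)⟫_ℂ := by
        rw [haA, ContinuousLinearMap.adjoint_inner_left]
        simp only [J]; rw [FormSpace.toHilbert_coe, FormSpace.incl_of]
      rw [hA, FormSpace.inner_coe_of] at h1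
      have e1 : J ((FormSpace.of x : FormSpace T C hT.1 hC) : H) = x := by
        simp only [J]; rw [FormSpace.toHilbert_coe, FormSpace.incl_of]
      rw [e1] at h1
      change ⟪v - B (J a), (x : E)⟫_ℂ = ⟪J a, T x⟫_ℂ
      rw [inner_sub_left]
      linear_combination -h1
    · rintro ⟨hu, hf⟩
      obtain ⟨w, hw⟩ := FormSpace.exists_toHilbert_eq_of_memFormDomain (hT := hT.1) (hC := hC) hu
      have hw' : J w = u := hw
      have h1 : A w = J.adjoint v := by
        refine (UniformSpace.Completion.denseRange_coe
          (α := FormSpace T C hT.1 hC)).eq_of_inner_left ℂ fun y => ?_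
        obtain ⟨x, rfl⟩ := FormSpace.of.surjective y
        have e1 : J ((FormSpace.of x : FormSpace T C hT.1 hC) : H) = x := by
          simp only [J]; rw [FormSpace.toHilbert_coe, FormSpace.incl_of]
        rw [hA, ContinuousLinearMap.adjoint_inner_left, e1, FormSpace.inner_coe_of, hw]
        have := hf x
        rw [inner_sub_left] at this
        linear_combination -this
      change J (A' (J.adjoint v)) = u
      rw [← h1, hA'2, hw']
  refine ⟨_, hchar, fun v => ?_⟩
  -- the numerical range bound extends from `T + B` to the Friedrichs extension
  obtain ⟨hu, hv⟩ := (hchar v _).1 rfl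
  set u := (J ∘L A' ∘L J.adjoint) v
  obtain ⟨w, hw1, hw2⟩ := exists_seq_tendsto_quadForm hd hT ⟨u, hu⟩
  have h1 : δ * ‖u‖ ^ 2 ≤ (⟪friedrichsExtension T ⟨u, hu⟩, u⟫_ℂ).re + (⟪B u, u⟫_ℂ).re := by
    refine le_of_tendsto_of_tendsto' ((hw1.norm.pow 2).const_mul δ) (hw2.add
      ((Complex.continuous_re.tendsto _).comp
        (Tendsto.inner ((B.continuous.tendsto u).comp hw1) hw1))) fun k => ?_
    have := hB (w k)
    rwa [inner_add_left, Complex.add_re] at this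
  rw [← Complex.add_re, ← inner_add_left, hv] at h1
  have h2 : δ * ‖u‖ ^ 2 ≤ ‖v‖ * ‖u‖ :=
    h1.trans ((Complex.re_le_norm _).trans (norm_inner_le_norm _ _))
  rcases (norm_nonneg u).eq_or_lt with h0 | h0
  · rw [← h0]; simp
  · refine le_of_mul_le_mul_right ?_ h0
    linarith

omit [CompleteSpace E] in
/-- An operator with nonempty resolvent set is closed. -/
theorem isClosed_of_isResolventAt {P : E →ₗ.[ℂ] E} {z : ℂ} {R : E →L[ℂ] E}
    (h : IsResolventAt P z R) : P.IsClosed := by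
  have : (P.graph : Set (E × E)) = {p | R (p.2 - z • p.1) = p.1} := by
    ext ⟨u, f⟩
    simp only [SetLike.mem_coe, LinearPMap.mem_graph_iff, Subtype.exists, exists_and_left,
      exists_eq_left, Set.mem_ofPred_eq, h _ _, sub_left_inj]
  rw [LinearPMap.IsClosed, this]
  exact isClosed_eq (by fun_prop) (by fun_prop)

end FriedrichsExtension

/-! ### Analytic Fredholm theory -/

section AnalyticFredholm

/-- The adjugate and the determinant of a holomorphic family of operators on `ℂᵏ`. -/
theorem exists_adjugate_family {k : ℕ} {U : Set ℂ}
    {D : ℂ → (Fin k → ℂ) →L[ℂ] (Fin k → ℂ)} (hD : DifferentiableOn ℂ D U) :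
    ∃ (D' : ℂ → (Fin k → ℂ) →L[ℂ] (Fin k → ℂ)) (d : ℂ → ℂ),
      DifferentiableOn ℂ D' U ∧ DifferentiableOn ℂ d U ∧
      ∀ z, (∀ x, D z (D' z x) = d z • x) ∧ (∀ x, D' z (D z x) = d z • x) ∧
        (d z = 0 → ∃ x, x ≠ 0 ∧ D z x = 0) := by
  let m : ℂ → Matrix (Fin k) (Fin k) ℂ := fun z => LinearMap.toMatrix' (D z).toLinearMap
  have hm : ∀ i j, DifferentiableOn ℂ (fun z => m z i j) U := by
    intro i j
    have h : (fun z => m z i j) = fun z => D z (Pi.single j 1) i := by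
      ext z; simp [m, LinearMap.toMatrix'_apply]
    rw [h]
    exact (differentiableOn_pi.1 (hD.clm_apply (differentiableOn_const _))) i
  have hdet : ∀ M : ℂ → Matrix (Fin k) (Fin k) ℂ,
      (∀ i j, DifferentiableOn ℂ (fun z => M z i j) U) →
      DifferentiableOn ℂ (fun z => (M z).det) U := by
    intro M hM
    simp only [Matrix.det_apply]
    refine DifferentiableOn.fun_sum fun σ _ => ?_
    exact (DifferentiableOn.fun_finsetProd fun i _ => hM _ _).const_smul _
  have hadj : ∀ i j, DifferentiableOn ℂ (fun z => (m z).adjugate i j) U := by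
    intro i j
    simp only [Matrix.adjugate_apply]
    refine hdet _ fun a b => ?_
    by_cases h : a = j
    · subst h
      simp
    · simpa [Matrix.updateRow_ne h] using hm a b
  let Φ : (Fin k → Fin k → ℂ) →ₗ[ℂ] ((Fin k → ℂ) →L[ℂ] (Fin k → ℂ)) :=
    (LinearMap.toContinuousLinearMap.toLinearMap) ∘ₗ
      (Matrix.toLin' (R := ℂ) (m := Fin k) (n := Fin k)).toLinearMap ∘ₗ
      (Matrix.ofLinearEquiv ℂ).toLinearMap
  have hΦ : ∀ (M : Matrix (Fin k) (Fin k) ℂ) x, Φ (fun i j => M i j) x = M.mulVec x :=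
    fun M x => rfl
  have hDm : ∀ z x, D z x = (m z).mulVec x := by
    intro z x
    have := Matrix.toLin'_toMatrix' (D z).toLinearMap
    rw [← Matrix.toLin'_apply, this]; rfl
  refine ⟨fun z => Φ fun i j => (m z).adjugate i j, fun z => (m z).det, ?_, hdet m hm,
    fun z => ⟨fun x => ?_, fun x => ?_, fun h => ?_⟩⟩
  · have h1 : DifferentiableOn ℂ (fun z => (fun i j => (m z).adjugate i j : Fin k → Fin k → ℂ)) U :=
      differentiableOn_pi.2 fun i => differentiableOn_pi.2 fun j => hadj i j
    exact (LinearMap.toContinuousLinearMap Φ).differentiable.comp_differentiableOn h1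
  · rw [hΦ, hDm, Matrix.mulVec_mulVec, Matrix.mul_adjugate, Matrix.smul_mulVec, Matrix.one_mulVec]
  · rw [hΦ, hDm, Matrix.mulVec_mulVec, Matrix.adjugate_mul, Matrix.smul_mulVec, Matrix.one_mulVec]
  · obtain ⟨x, hx, hx0⟩ := Matrix.exists_mulVec_eq_zero_iff.2 h
    exact ⟨x, hx, by rw [hDm, hx0]⟩

variable {E : Type*} [NormedAddCommGroup E] [InnerProductSpace ℂ E]

/-- An operator that maps the unit ball to a totally bounded set is a norm limit of operators that
factor through some `ℂᵏ`. -/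
theorem exists_finiteRank_approx {A : E →L[ℂ] E}
    (hA : TotallyBounded (A '' Metric.closedBall 0 1)) {ε : ℝ} (hε : 0 < ε) :
    ∃ (k : ℕ) (J : (Fin k → ℂ) →L[ℂ] E) (Q : E →L[ℂ] (Fin k → ℂ)), ‖A - J ∘L Q‖ ≤ ε := by
  obtain ⟨t, ht, htA⟩ := Metric.totallyBounded_iff.1 hA ε hε
  let U : Submodule ℂ E := Submodule.span ℂ t
  have : FiniteDimensional ℂ U := FiniteDimensional.span_of_finite ℂ ht
  let e : U ≃L[ℂ] (Fin (Module.finrank ℂ U) → ℂ) := (Module.finBasis ℂ U).equivFunL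
  refine ⟨_, U.subtypeL ∘L e.symm.toContinuousLinearMap,
    e.toContinuousLinearMap ∘L U.orthogonalProjectionOnto ∘L A, ?_⟩
  refine ContinuousLinearMap.opNorm_le_of_unit_norm hε.le fun x hx => ?_
  have h1 : A x ∈ A '' Metric.closedBall 0 1 := ⟨x, by simp [hx], rfl⟩
  obtain ⟨y, hy, hyx⟩ := Set.mem_iUnion₂.1 (htA h1)
  have h2 : (A - (U.subtypeL ∘L e.symm.toContinuousLinearMap) ∘L
      (e.toContinuousLinearMap ∘L U.orthogonalProjectionOnto ∘L A)) x
      = A x - U.starProjection (A x) := by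
    simp
  rw [h2, Submodule.starProjection_minimal]
  refine (ciInf_le ⟨0, ?_⟩ (⟨y, Submodule.subset_span hy⟩ : U)).trans ?_
  · rintro _ ⟨x, rfl⟩; exact norm_nonneg _
  · rw [← dist_eq_norm]; exact (Metric.mem_ball.1 hyx).le

variable [CompleteSpace E]

/-- The analytic Fredholm theorem, locally: near a point where the holomorphic family `A` is
compact, invertibility of `1 - A z` is governed by a holomorphic determinant `d`, and the inverse
is the sum of a holomorphic family and of `d⁻¹` times one that factors through `ℂᵏ`. -/
theorem exists_local_fredholm_inverse {A : ℂ → E →L[ℂ] E} {Z : Set ℂ} (hZ : IsOpen Z)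
    (hA : DifferentiableOn ℂ A Z) {w : ℂ} (hw : w ∈ Z)
    (hc : TotallyBounded (A w '' Metric.closedBall 0 1)) :
    ∃ r > 0, Metric.ball w r ⊆ Z ∧ ∃ (k : ℕ) (G : ℂ → E →L[ℂ] E)
      (L : ℂ → (Fin k → ℂ) →L[ℂ] E) (M : ℂ → E →L[ℂ] (Fin k → ℂ)) (d : ℂ → ℂ),
      DifferentiableOn ℂ G (Metric.ball w r) ∧ DifferentiableOn ℂ L (Metric.ball w r) ∧
      DifferentiableOn ℂ M (Metric.ball w r) ∧ DifferentiableOn ℂ d (Metric.ball w r) ∧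
      ∀ z ∈ Metric.ball w r, (d z = 0 → ∃ y, y ≠ 0 ∧ A z y = y) ∧
        (d z ≠ 0 → (1 - A z) * (G z + (d z)⁻¹ • (L z ∘L M z)) = 1 ∧
          (G z + (d z)⁻¹ • (L z ∘L M z)) * (1 - A z) = 1) := by
  obtain ⟨k, J, Q, hJ⟩ := exists_finiteRank_approx hc (show (0 : ℝ) < 1 / 4 by norm_num)
  have hcont : ContinuousAt A w := (hA.differentiableAt (hZ.mem_nhds hw)).continuousAt
  obtain ⟨r, hr, hrA⟩ : ∃ r > 0, Metric.ball w r ⊆ Z ∩ {z | dist (A z) (A w) < 1 / 4} := by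
    refine Metric.mem_nhds_iff.1 (inter_mem (hZ.mem_nhds hw) ?_)
    exact hcont (Metric.ball_mem_nhds _ (by norm_num))
  set b := Metric.ball w r
  have hAb : DifferentiableOn ℂ A b := hA.mono fun z hz => (hrA hz).1
  have hunit : ∀ z ∈ b, IsUnit (1 - (A z - J ∘L Q)) := by
    intro z hz
    refine isUnit_one_sub_of_norm_lt_one ?_
    have h1 : dist (A z) (A w) < 1 / 4 := (hrA hz).2
    rw [dist_eq_norm] at h1
    calc ‖A z - J ∘L Q‖ = ‖(A z - A w) + (A w - J ∘L Q)‖ := by congr 1; abel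
      _ ≤ ‖A z - A w‖ + ‖A w - J ∘L Q‖ := norm_add_le _ _
      _ < 1 := by linarith
  let G : ℂ → E →L[ℂ] E := fun z => Ring.inverse (1 - (A z - J ∘L Q))
  have hG : DifferentiableOn ℂ G b := by
    intro z hz
    refine DifferentiableAt.comp_differentiableWithinAt z
      (f := fun z => 1 - (A z - J ∘L Q)) (g := Ring.inverse)
      (differentiableAt_inverse (𝕜 := ℂ) (hunit z hz)) ?_
    exact (differentiableWithinAt_const _).sub ((hAb z hz).sub_const _)
  have hG1 : ∀ z ∈ b, ∀ x, G z x - A z (G z x) + J (Q (G z x)) = x := fun z hz x => by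
    have := DFunLike.congr_fun (Ring.mul_inverse_cancel _ (hunit z hz)) x
    have h2 : G z x - (A z (G z x) - J (Q (G z x))) = x := this
    exact (sub_add _ _ _).trans h2
  have hG2 : ∀ z ∈ b, ∀ x, G z x - G z (A z x) + G z (J (Q x)) = x := fun z hz x => by
    have := DFunLike.congr_fun (Ring.inverse_mul_cancel _ (hunit z hz)) x
    have h2 : G z (x - (A z x - J (Q x))) = x := this
    rw [map_sub, map_sub] at h2
    exact (sub_add _ _ _).trans h2
  let D : ℂ → (Fin k → ℂ) →L[ℂ] (Fin k → ℂ) := fun z => 1 - Q ∘L G z ∘L J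
  have hD : DifferentiableOn ℂ D b :=
    (differentiableOn_const _).sub
      ((differentiableOn_const _).clm_comp (hG.clm_comp (differentiableOn_const _)))
  obtain ⟨D', d, hD', hd, hDD⟩ := exists_adjugate_family hD
  have hDx : ∀ z x, D z x = x - Q (G z (J x)) := fun z x => rfl
  refine ⟨r, hr, fun z hz => (hrA hz).1, k, G, fun z => G z ∘L J, fun z => D' z ∘L Q ∘L G z, d,
    hG, hG.clm_comp (differentiableOn_const _),
    hD'.clm_comp ((differentiableOn_const _).clm_comp hG), hd, fun z hz => ⟨fun h0 => ?_,
    fun h0 => ⟨?_, ?_⟩⟩⟩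
  · obtain ⟨x, hx, hx0⟩ := (hDD z).2.2 h0
    rw [hDx, sub_eq_zero] at hx0
    refine ⟨G z (J x), fun h => hx ?_, ?_⟩
    · rw [hx0, h, map_zero]
    · have := hG1 z hz (J x)
      rw [← hx0] at this
      exact (sub_eq_zero.1 (add_eq_right.1 this)).symm
  · ext x
    have h1 := hG1 z hz x
    have h2 := hG1 z hz (J (D' z (Q (G z x))))
    have h3 := (hDD z).1 (Q (G z x))
    rw [hDx] at h3
    set y := D' z (Q (G z x))
    have h4 : J y - J (Q (G z (J y))) = d z • J (Q (G z x)) := by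
      rw [← map_sub, h3, map_smul]
    change (G z x + (d z)⁻¹ • G z (J y)) - A z (G z x + (d z)⁻¹ • G z (J y)) = x
    rw [map_add, map_smul]
    have h5 : G z x - A z (G z x) = x - J (Q (G z x)) := eq_sub_of_add_eq h1
    have h6 : G z (J y) - A z (G z (J y)) = d z • J (Q (G z x)) := by
      rw [← h4]; exact eq_sub_of_add_eq h2
    calc G z x + (d z)⁻¹ • G z (J y) - (A z (G z x) + (d z)⁻¹ • A z (G z (J y)))
        = (G z x - A z (G z x)) + (d z)⁻¹ • (G z (J y) - A z (G z (J y))) := by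
          rw [smul_sub]; abel
      _ = x := by rw [h5, h6, smul_smul, inv_mul_cancel₀ h0, one_smul, sub_add_cancel]
  · ext x
    have h1 := hG2 z hz x
    have h3 := (hDD z).2.1 (Q x)
    rw [hDx, map_sub] at h3
    have h5 : G z x - G z (A z x) = x - G z (J (Q x)) := eq_sub_of_add_eq h1
    change G z (x - A z x) + (d z)⁻¹ • G z (J (D' z (Q (G z (x - A z x))))) = x
    rw [map_sub, h5]
    have h6 : D' z (Q (x - G z (J (Q x)))) = d z • Q x := by rw [map_sub, map_sub, h3]
    rw [h6, map_smul, map_smul, smul_smul, inv_mul_cancel₀ h0, one_smul, sub_add_cancel]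

omit [CompleteSpace E] in
/-- The contour integral of a meromorphic family `L z ∘ N z` of operators, with `L` holomorphic and
`N` having a pole of order at most `m`, has finite rank if it factors through a finite dimensional
space: Taylor expansion of `L` at the pole up to order `m`. -/
theorem finiteDimensional_range_circleIntegral {V : Type*} [NormedAddCommGroup V] [NormedSpace ℂ V]
    [FiniteDimensional ℂ V] [CompleteSpace E] {w : ℂ} {r ρ : ℝ} (hρ : 0 < ρ) (hρr : ρ < r) (m : ℕ) :
    ∀ (L : ℂ → V →L[ℂ] E) (N N' : ℂ → E →L[ℂ] V), DifferentiableOn ℂ L (Metric.ball w r) →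
      DifferentiableOn ℂ N' (Metric.ball w r) →
      (∀ z ∈ Metric.ball w r, z ≠ w → (z - w) ^ m • N z = N' z) →
      FiniteDimensional ℂ (∮ z in C(w, ρ), L z ∘L N z).range := by
  have hsph : ∀ z ∈ Metric.sphere w ρ, z ∈ Metric.ball w r ∧ z ≠ w := fun z hz =>
    ⟨Metric.sphere_subset_closedBall.trans (Metric.closedBall_subset_ball hρr) hz,
      Metric.ne_of_mem_sphere hz hρ.ne'⟩
  have hcb : Metric.closedBall w ρ ⊆ Metric.ball w r := Metric.closedBall_subset_ball hρr
  induction m with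
  | zero =>
    intro L N N' hL hN' hNN
    have h0 : (∮ z in C(w, ρ), L z ∘L N z) = 0 := by
      rw [circleIntegral.integral_congr (g := fun z => L z ∘L N' z) hρ.le fun z hz => by
        have := hNN z (hsph z hz).1 (hsph z hz).2
        rw [pow_zero, one_smul] at this
        simp only [this]]
      refine DiffContOnCl.circleIntegral_eq_zero hρ.le (DifferentiableOn.diffContOnCl ?_)
      rw [closure_ball _ hρ.ne']
      exact (hL.clm_comp hN').mono hcb
    rw [h0]
    have : (0 : E →L[ℂ] E).range = ⊥ := LinearMap.range_zero
    rw [this]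
    infer_instance
  | succ m ih =>
    intro L N N' hL hN' hNN
    have hwb : Metric.ball w r ∈ 𝓝 w := Metric.ball_mem_nhds _ (hρ.trans hρr)
    have hdL : DifferentiableOn ℂ (dslope L w) (Metric.ball w r) :=
      (Complex.differentiableOn_dslope hwb).2 hL
    have h1 := ih (dslope L w) (fun z => (z - w) • N z) N' hdL hN' fun z hz hzw => by
      rw [smul_smul, ← pow_succ]; exact hNN z hz hzw
    have hN : ContinuousOn N (Metric.sphere w ρ) := by
      have : ContinuousOn (fun z => ((z - w) ^ (m + 1))⁻¹ • N' z) (Metric.sphere w ρ) := by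
        refine ContinuousOn.smul (ContinuousOn.inv₀ (f := fun z => (z - w) ^ (m + 1))
          (by fun_prop) fun z hz => ?_)
          (hN'.continuousOn.mono fun z hz => (hsph z hz).1)
        exact pow_ne_zero _ (sub_ne_zero.2 (hsph z hz).2)
      refine this.congr fun z hz => ?_
      simp only
      rw [← hNN z (hsph z hz).1 (hsph z hz).2, smul_smul, inv_mul_cancel₀, one_smul]
      exact pow_ne_zero _ (sub_ne_zero.2 (hsph z hz).2)
    have hi1 : CircleIntegrable (fun z => L w ∘L N z) w ρ :=
      (continuousOn_const.clm_comp hN).circleIntegrable hρ.le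
    have hi2 : CircleIntegrable (fun z => dslope L w z ∘L ((z - w) • N z)) w ρ := by
      refine ContinuousOn.circleIntegrable hρ.le
        ((hdL.continuousOn.mono fun z hz => (hsph z hz).1).clm_comp ?_)
      exact ContinuousOn.smul (f := fun z => z - w) (by fun_prop) hN
    have h2 : (∮ z in C(w, ρ), L z ∘L N z) = L w ∘L (∮ z in C(w, ρ), N z)
        + ∮ z in C(w, ρ), dslope L w z ∘L ((z - w) • N z) := by
      have e1 : L w ∘L (∮ z in C(w, ρ), N z) = ∮ z in C(w, ρ), L w ∘L N z := by
        have hii := (hN.circleIntegrable hρ.le).out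
        have := ContinuousLinearMap.intervalIntegral_comp_comm
          (ContinuousLinearMap.compL ℂ E V E (L w)) hii
        simp only [circleIntegral]
        rw [← ContinuousLinearMap.compL_apply, ← this]
        refine intervalIntegral.integral_congr fun θ _ => ?_
        simp
      rw [e1, ← circleIntegral.integral_add hi1 hi2]
      refine circleIntegral.integral_congr hρ.le fun z hz => ?_
      have hzw := (hsph z hz).2
      rw [dslope_of_ne _ hzw, ContinuousLinearMap.comp_smul, ← ContinuousLinearMap.smul_comp,
        sub_smul_slope, ← ContinuousLinearMap.add_comp, vsub_eq_sub, add_sub_cancel]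
    have h3 : (∮ z in C(w, ρ), L z ∘L N z).range ≤
        (L w).range ⊔ (∮ z in C(w, ρ), dslope L w z ∘L ((z - w) • N z)).range := by
      rintro _ ⟨x, rfl⟩
      rw [h2]
      exact Submodule.add_mem_sup ⟨_, rfl⟩ ⟨_, rfl⟩
    have := h1
    have : FiniteDimensional ℂ (L w).range := inferInstance
    exact Submodule.finiteDimensional_of_le h3

end AnalyticFredholm

/-! ### Discrete spectrum of relatively compact perturbations -/

section DiscreteSpectrum

variable {E : Type*} [NormedAddCommGroup E] [InnerProductSpace ℂ E] [CompleteSpace E]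

omit [CompleteSpace E] in
theorem IsResolventAt.unique {P : E →ₗ.[ℂ] E} {z : ℂ} {R R' : E →L[ℂ] E}
    (h : IsResolventAt P z R) (h' : IsResolventAt P z R') : R = R' := by
  ext v
  exact (h v (R' v)).2 ((h' v (R' v)).1 rfl)

omit [CompleteSpace E] in
theorem IsResolventAt.opResolvent_eq {P : E →ₗ.[ℂ] E} {z : ℂ} {R : E →L[ℂ] E}
    (h : IsResolventAt P z R) : opResolvent P z = R := by
  have hz : z ∈ opResolventSet P := ⟨R, h⟩
  rw [opResolvent, dif_pos hz]
  exact hz.choose_spec.unique h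

/-- A family of operators subject to the resolvent identity is holomorphic. -/
theorem differentiableAt_of_resolvent_identity {R : ℂ → E →L[ℂ] E} {Z : Set ℂ} (hZ : IsOpen Z)
    (hR : ∀ z ∈ Z, ∀ w ∈ Z, R z * (1 - (z - w) • R w) = R w) {w : ℂ} (hw : w ∈ Z) :
    DifferentiableAt ℂ R w := by
  have hc : ContinuousAt (fun z : ℂ => ‖(z - w) • R w‖) w := by fun_prop
  have hsmall : ∀ᶠ z in 𝓝 w, ‖(z - w) • R w‖ < 1 := by
    refine hc.eventually_lt continuousAt_const ?_
    simp
  have heq : R =ᶠ[𝓝 w] fun z => R w * Ring.inverse (1 - (z - w) • R w) := by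
    filter_upwards [hsmall, hZ.mem_nhds hw] with z hz hzZ
    nth_rewrite 1 [← hR z hzZ w hw]
    rw [mul_assoc, Ring.mul_inverse_cancel _ (isUnit_one_sub_of_norm_lt_one hz), mul_one]
  refine DifferentiableAt.congr_of_eventuallyEq ?_ heq
  refine (differentiableAt_const _).mul ?_
  refine DifferentiableAt.comp (f := fun z : ℂ => 1 - (z - w) • R w) (g := Ring.inverse) w
    (differentiableAt_inverse (𝕜 := ℂ) ?_) (by fun_prop)
  simp

/-- Let `Q z = (P + K - z)⁻¹` be holomorphic in a connected open set `Z`, and suppose that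
`K ∘ Q z` is compact everywhere and small somewhere. Then the spectrum of `P` in `Z` is discrete,
because `P - z = (1 - K ∘ Q z) (P + K - z)`. -/
theorem isDiscreteEigenvalue_of_compact {P : E →ₗ.[ℂ] E} {Z : Set ℂ} (hZ : IsOpen Z)
    (hZc : IsPreconnected Z) {K : E →L[ℂ] E} {Q : ℂ → E →L[ℂ] E}
    (hQ : ∀ z ∈ Z, ∀ v u : E, Q z v = u ↔ ∃ hu : u ∈ P.domain, P ⟨u, hu⟩ - z • u + K u = v)
    (hQd : DifferentiableOn ℂ Q Z)
    (hK : ∀ z ∈ Z, TotallyBounded ((K ∘L Q z) '' Metric.closedBall 0 1))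
    (hsmall : ∃ z ∈ Z, ‖K ∘L Q z‖ < 1) {w : ℂ} (hw : w ∈ Z) (hwP : w ∈ opSpectrum P) :
    IsDiscreteEigenvalue P w := by
  set A : ℂ → E →L[ℂ] E := fun z => K ∘L Q z with hAdef
  have hA : DifferentiableOn ℂ A Z := (differentiableOn_const _).clm_comp hQd
  have hres : ∀ z ∈ Z, ∀ S : E →L[ℂ] E, (1 - A z) * S = 1 → S * (1 - A z) = 1 →
      IsResolventAt P z (Q z ∘L S) := by
    intro z hz S h1 h2 v u
    have h3 : (∃ hu : u ∈ P.domain, P ⟨u, hu⟩ - z • u = v) ↔ Q z (v + K u) = u := by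
      rw [hQ z hz]; simp only [add_left_inj]
    rw [h3]
    have e1 : ∀ x, S x - K (Q z (S x)) = x := fun x => DFunLike.congr_fun h1 x
    have e2 : ∀ x, S (x - K (Q z x)) = x := fun x => DFunLike.congr_fun h2 x
    constructor
    · rintro rfl
      change Q z (v + K (Q z (S v))) = Q z (S v)
      congr 1
      exact (sub_eq_iff_eq_add.1 (e1 v)).symm
    · intro h
      have h4 := e2 (v + K u)
      rw [h, add_sub_cancel_right] at h4
      change Q z (S v) = u
      rw [h4, h]
  have hker : ∀ z ∈ Z, ∀ y : E, y ≠ 0 → A z y = y → ∃ u : P.domain, u ≠ 0 ∧ P u = z • (u : E) := by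
    intro z hz y hy hAy
    obtain ⟨hu, h⟩ := (hQ z hz y (Q z y)).1 rfl
    have h5 : K (Q z y) = y := hAy
    refine ⟨⟨Q z y, hu⟩, fun h0 => hy ?_, ?_⟩
    · have : Q z y = 0 := congrArg Subtype.val h0
      rw [← h5, this, map_zero]
    · rw [h5, add_eq_right, sub_eq_zero] at h
      exact h
  -- the determinant does not vanish identically near any point of `Z`
  have hloc := fun z (hz : z ∈ Z) => exists_local_fredholm_inverse hZ hA hz (hK z hz)
  let B : Set ℂ := {z | ∀ᶠ z' in 𝓝 z, ∃ y, y ≠ 0 ∧ A z' y = y}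
  have hunit_not : ∀ z, (∃ S : E →L[ℂ] E, S * (1 - A z) = 1) → ¬ ∃ y, y ≠ 0 ∧ A z y = y := by
    rintro z ⟨S, hS⟩ ⟨y, hy, hAy⟩
    have : S (y - A z y) = y := DFunLike.congr_fun hS y
    rw [hAy, sub_self, map_zero] at this
    exact hy this.symm
  have hdich : ∀ z ∈ Z, z ∉ B → ∀ᶠ z' in 𝓝[≠] z, z' ∉ B := by
    intro z hz hzB
    obtain ⟨r, hr, -, k, G, L, M, d, -, -, -, hd, hall⟩ := hloc z hz
    have hda : AnalyticAt ℂ d z := hd.analyticAt (Metric.ball_mem_nhds _ hr)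
    rcases hda.eventually_eq_zero_or_eventually_ne_zero with h | h
    · exact absurd (by
        filter_upwards [h, Metric.ball_mem_nhds z hr] with z' h1 h2
        exact (hall z' h2).1 h1) hzB
    · filter_upwards [h, mem_nhdsWithin_of_mem_nhds (Metric.ball_mem_nhds z hr)] with z' h1 h2 h3
      exact hunit_not z' ⟨_, ((hall z' h2).2 h1).2⟩ h3.self_of_nhds
  have hBo : IsOpen B := isOpen_iff_mem_nhds.2 fun z hz => eventually_eventually_nhds.2 hz
  have hBc : IsOpen (Z \ B) := by
    rw [isOpen_iff_mem_nhds]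
    rintro z ⟨hz, hzB⟩
    have := hdich z hz hzB
    rw [eventually_nhdsWithin_iff] at this
    filter_upwards [this, hZ.mem_nhds hz] with z' h1 h2
    refine ⟨h2, ?_⟩
    by_cases h : z' = z
    · rwa [h]
    · exact h1 h
  have hB : ∀ z ∈ Z, z ∉ B := by
    obtain ⟨z₀, hz₀, hz₀A⟩ := hsmall
    have h0 : z₀ ∉ B := fun h =>
      hunit_not z₀ ⟨_, Ring.inverse_mul_cancel _ (isUnit_one_sub_of_norm_lt_one hz₀A)⟩
        h.self_of_nhds
    have := hZc.subset_left_of_subset_union hBc hBo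
      (Set.disjoint_left.2 fun z h1 h2 => h1.2 h2)
      (fun z hz => by by_cases h : z ∈ B; exacts [Or.inr h, Or.inl ⟨hz, h⟩]) ⟨z₀, hz₀, hz₀, h0⟩
    exact fun z hz => (this hz).2
  obtain ⟨r, hr, hrZ, k, G, L, M, d, hG, hL, hM, hd, hall⟩ := hloc w hw
  have hda : AnalyticAt ℂ d w := hd.analyticAt (Metric.ball_mem_nhds _ hr)
  have hd0 : ¬ ∀ᶠ z in 𝓝 w, d z = 0 := fun h => hB w hw (by
    filter_upwards [h, Metric.ball_mem_nhds w hr] with z' h1 h2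
    exact (hall z' h2).1 h1)
  have hresz : ∀ z ∈ Metric.ball w r, d z ≠ 0 →
      IsResolventAt P z (Q z ∘L (G z + (d z)⁻¹ • (L z ∘L M z))) := fun z hz h0 =>
    hres z (hrZ hz) _ ((hall z hz).2 h0).1 ((hall z hz).2 h0).2
  have hdw : d w = 0 := by
    by_contra h
    exact hwP ⟨_, hresz w (Metric.mem_ball_self hr) h⟩
  obtain ⟨y, hy, hAy⟩ := (hall w (Metric.mem_ball_self hr)).1 hdw
  refine ⟨hker w hw y hy hAy, ?_⟩
  obtain ⟨m, e, he, hew, hde⟩ := hda.exists_eventuallyEq_pow_smul_nonzero_iff.2 hd0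
  obtain ⟨r', hr', hrr⟩ : ∃ r' > 0, ∀ z ∈ Metric.ball w r', z ∈ Metric.ball w r ∧
      d z = (z - w) ^ m * e z ∧ e z ≠ 0 ∧ DifferentiableAt ℂ e z := by
    have hball : ∀ᶠ z in 𝓝 w, z ∈ Metric.ball w r := Metric.ball_mem_nhds w hr
    have h1 := he.eventually_analyticAt
    have h2 := he.continuousAt.eventually_ne hew
    obtain ⟨r', hr', h⟩ := Metric.eventually_nhds_iff_ball.1
      ((hball.and hde).and (h1.and h2))
    exact ⟨r', hr', fun z hz => ⟨(h z hz).1.1, (h z hz).1.2, (h z hz).2.2,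
      (h z hz).2.1.differentiableAt⟩⟩
  have hbb : Metric.ball w r' ⊆ Metric.ball w r := fun z hz => (hrr z hz).1
  have hdz : ∀ z ∈ Metric.ball w r', z ≠ w → d z ≠ 0 := fun z hz hzw => by
    rw [(hrr z hz).2.1]
    exact mul_ne_zero (pow_ne_zero _ (sub_ne_zero.2 hzw)) (hrr z hz).2.2.1
  have hρ : 0 < r' / 2 := by positivity
  have hρr : r' / 2 < r' := by linarith
  refine ⟨r' / 2, hρ, fun z hz hzw => ?_, ?_⟩
  · have hz' := Metric.closedBall_subset_ball hρr hz
    exact fun h => h ⟨_, hresz z (hbb hz') (hdz z hz' hzw)⟩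
  have hsph : ∀ z ∈ Metric.sphere w (r' / 2), z ∈ Metric.ball w r' ∧ z ≠ w := fun z hz =>
    ⟨Metric.sphere_subset_closedBall.trans (Metric.closedBall_subset_ball hρr) hz,
      Metric.ne_of_mem_sphere hz hρ.ne'⟩
  have hQb : DifferentiableOn ℂ Q (Metric.ball w r') := hQd.mono (hbb.trans hrZ)
  have hQG : DifferentiableOn ℂ (fun z => Q z ∘L G z) (Metric.ball w r') :=
    hQb.clm_comp (hG.mono hbb)
  have hQL : DifferentiableOn ℂ (fun z => Q z ∘L L z) (Metric.ball w r') :=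
    hQb.clm_comp (hL.mono hbb)
  have hint : (∮ z in C(w, r' / 2), -opResolvent P z)
      = -∮ z in C(w, r' / 2), (Q z ∘L L z) ∘L ((d z)⁻¹ • M z) := by
    have hc : ContinuousOn (fun z => (Q z ∘L L z) ∘L ((d z)⁻¹ • M z))
        (Metric.sphere w (r' / 2)) := by
      refine (hQL.continuousOn.mono fun z hz => (hsph z hz).1).clm_comp ?_
      refine ContinuousOn.smul (ContinuousOn.inv₀ ?_ fun z hz =>
        hdz z (hsph z hz).1 (hsph z hz).2) ?_
      · exact hd.continuousOn.mono fun z hz => hbb (hsph z hz).1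
      · exact hM.continuousOn.mono fun z hz => hbb (hsph z hz).1
    have hc2 : ContinuousOn (fun z => Q z ∘L G z) (Metric.sphere w (r' / 2)) :=
      hQG.continuousOn.mono fun z hz => (hsph z hz).1
    have h0 : (∮ z in C(w, r' / 2), Q z ∘L G z) = 0 := by
      refine DiffContOnCl.circleIntegral_eq_zero hρ.le (DifferentiableOn.diffContOnCl ?_)
      rw [closure_ball _ hρ.ne']
      exact hQG.mono (Metric.closedBall_subset_ball hρr)
    have h1 : (∮ z in C(w, r' / 2), -opResolvent P z) = ∮ z in C(w, r' / 2),
        (-1 : ℂ) • (Q z ∘L G z + (Q z ∘L L z) ∘L ((d z)⁻¹ • M z)) := by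
      refine circleIntegral.integral_congr hρ.le fun z hz => ?_
      rw [(hresz z (hbb (hsph z hz).1) (hdz z (hsph z hz).1 (hsph z hz).2)).opResolvent_eq,
        neg_one_smul, ContinuousLinearMap.comp_add, ContinuousLinearMap.comp_smul,
        ContinuousLinearMap.comp_smul, ContinuousLinearMap.comp_assoc]
    rw [h1, circleIntegral.integral_smul, circleIntegral.integral_add
      (hc2.circleIntegrable hρ.le) (hc.circleIntegrable hρ.le), h0, zero_add, neg_one_smul]
  have hfin := finiteDimensional_range_circleIntegral hρ hρr m (fun z => Q z ∘L L z)
    (fun z => (d z)⁻¹ • M z) (fun z => (e z)⁻¹ • M z) hQL (by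
      refine DifferentiableOn.smul (DifferentiableOn.inv (fun z hz =>
        (hrr z hz).2.2.2.differentiableWithinAt) fun z hz => (hrr z hz).2.2.1) (hM.mono hbb))
    fun z hz hzw => by
      rw [(hrr z hz).2.1, smul_smul, mul_inv, ← mul_assoc, mul_inv_cancel₀, one_mul]
      exact pow_ne_zero _ (sub_ne_zero.2 hzw)
  rw [rieszProjection, hint]
  refine Submodule.finiteDimensional_of_le (S₂ := (∮ z in C(w, r' / 2),
    (Q z ∘L L z) ∘L ((d z)⁻¹ • M z)).range) ?_
  rintro _ ⟨x, rfl⟩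
  exact Submodule.smul_mem _ _ (Submodule.neg_mem _ ⟨x, rfl⟩)

/-- Let `T` be symmetric and densely defined, and let `S` be a bounded operator with
`Re ⟪S u, u⟫ = 0`. If for all real `β < α` some bounded `K` makes `T + K ≥ β` and maps sets that are
bounded in the form norm to totally bounded sets, then the perturbation of the Friedrichs extension
of `T` by `S` is closed and has discrete spectrum in `Re z < α`. -/
theorem isClosed_and_hasDiscreteSpectrumBelow {T : E →ₗ.[ℂ] E} (hd : Dense (T.domain : Set E))
    (hT : T.IsFormalAdjoint T) (S : E →L[ℂ] E) (hS : ∀ u, (⟪S u, u⟫_ℂ).re = 0) (α : EReal)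
    (h : ∀ β : ℝ, (β : EReal) < α → ∃ K : E →L[ℂ] E,
      (∀ u : T.domain, β * ‖(u : E)‖ ^ 2 ≤ (⟪T u + K u, (u : E)⟫_ℂ).re) ∧
      ∀ C : ℝ, TotallyBounded
        {y | ∃ u : T.domain, ‖(u : E)‖ ≤ C ∧ (⟪T u, (u : E)⟫_ℂ).re ≤ C ∧ K u = y}) :
    (⊥ < α → (S.toLinearMap +ᵥ friedrichsExtension T).IsClosed) ∧
      HasDiscreteSpectrumBelow (S.toLinearMap +ᵥ friedrichsExtension T) α := by
  set P := S.toLinearMap +ᵥ friedrichsExtension T with hP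
  have hPapp : ∀ u (hu : u ∈ (friedrichsExtension T).domain),
      P ⟨u, hu⟩ = S u + friedrichsExtension T ⟨u, hu⟩ := fun u hu => LinearPMap.vadd_apply _ _ _
  have hself : ∀ u : E, ⟪u, u⟫_ℂ = ((‖u‖ ^ 2 : ℝ) : ℂ) := fun u => by
    rw [inner_self_eq_norm_sq_to_K]; push_cast; rfl
  have hsemi : ∀ (K : E →L[ℂ] E) (β : ℝ),
      (∀ u : T.domain, β * ‖(u : E)‖ ^ 2 ≤ (⟪T u + K u, (u : E)⟫_ℂ).re) → IsSemibounded T := by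
    refine fun K β hK => ⟨hT, β - ‖K‖, fun u => ?_⟩
    have h1 := hK u
    rw [inner_add_left, Complex.add_re] at h1
    have h2 : (⟪K u, (u : E)⟫_ℂ).re ≤ ‖K‖ * ‖(u : E)‖ ^ 2 := by
      calc (⟪K u, (u : E)⟫_ℂ).re ≤ ‖⟪K u, (u : E)⟫_ℂ‖ := Complex.re_le_norm _
        _ ≤ ‖K u‖ * ‖(u : E)‖ := norm_inner_le_norm _ _
        _ ≤ (‖K‖ * ‖(u : E)‖) * ‖(u : E)‖ := by gcongr; exact K.le_opNorm _
        _ = ‖K‖ * ‖(u : E)‖ ^ 2 := by ring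
    linarith
  -- the resolvent of `P + K` in the half-plane `Re z < β`
  have hQ : ∀ (K : E →L[ℂ] E) (β : ℝ),
      (∀ u : T.domain, β * ‖(u : E)‖ ^ 2 ≤ (⟪T u + K u, (u : E)⟫_ℂ).re) →
      ∀ K' : E →L[ℂ] E, ∀ β' : ℝ,
      (∀ u : T.domain, β' * ‖(u : E)‖ ^ 2 ≤ (⟪T u + K' u, (u : E)⟫_ℂ).re) →
      ∀ z : ℂ, z.re < β' → ∃ R : E →L[ℂ] E,
      (∀ v u : E, R v = u ↔ ∃ hu : u ∈ P.domain, P ⟨u, hu⟩ - z • u + K' u = v) ∧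
      ∀ v, (β' - z.re) * ‖R v‖ ≤ ‖v‖ := by
    intro K β hK K' β' hK' z hz
    obtain ⟨R, hR1, hR2⟩ := exists_inverse_friedrichsExtension_add hd (hsemi K β hK)
      (S + K' - z • 1) (δ := β' - z.re) (sub_pos.2 hz) fun u => by
        have h1 := hK' u
        have e : T u + (S + K' - z • (1 : E →L[ℂ] E)) (u : E)
            = (T u + K' u) + S u - z • (u : E) := by
          change T u + (S u + K' u - z • (u : E)) = _
          abel
        rw [e, inner_sub_left, inner_add_left _ (S u), Complex.sub_re, Complex.add_re, hS,
          inner_smul_left, hself, Complex.re_mul_ofReal, Complex.conj_re]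
        linarith
    refine ⟨R, fun v u => ?_, hR2⟩
    rw [hR1]
    have e : ∀ hu : u ∈ (friedrichsExtension T).domain,
        friedrichsExtension T ⟨u, hu⟩ + (S + K' - z • (1 : E →L[ℂ] E)) u
          = P ⟨u, hu⟩ - z • u + K' u := fun hu => by
      rw [hPapp]
      change friedrichsExtension T ⟨u, hu⟩ + (S u + K' u - z • u) = _
      abel
    constructor
    · rintro ⟨hu, h⟩; exact ⟨hu, by rw [← e, h]⟩
    · rintro ⟨hu, h⟩; exact ⟨hu, by rw [e]; exact h⟩
  constructor
  · intro hα
    obtain ⟨β, -, hβ⟩ := EReal.lt_iff_exists_real_btwn.1 hα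
    obtain ⟨K, hK, -⟩ := h β hβ
    have hsb := hsemi K β hK
    obtain ⟨c, hc⟩ := hsb.2
    obtain ⟨R, hR, -⟩ := hQ K β hK 0 c (fun u => by simpa using hc u) ((c - 1 : ℝ) : ℂ)
      (by simp)
    refine isClosed_of_isResolventAt (z := ((c - 1 : ℝ) : ℂ)) (R := R) fun v u => ?_
    rw [hR]; simp
  · intro w hwP hwα
    obtain ⟨β, hwβ, hβ⟩ := EReal.lt_iff_exists_real_btwn.1 hwα
    rw [EReal.coe_lt_coe_iff] at hwβ
    obtain ⟨K, hK, hKc⟩ := h β hβ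
    have hsb := hsemi K β hK
    choose! Q hQ1 hQ2 using hQ K β hK K β hK
    set Z : Set ℂ := {z | z.re < β} with hZdef
    have hZ : IsOpen Z := isOpen_lt Complex.continuous_re continuous_const
    have hQn : ∀ z ∈ Z, ‖Q z‖ ≤ (β - z.re)⁻¹ := fun z hz => by
      have hpos : 0 < β - z.re := sub_pos.2 hz
      refine ContinuousLinearMap.opNorm_le_bound _ (by positivity) fun v => ?_
      rw [inv_mul_eq_div, le_div_iff₀ hpos, mul_comm]
      exact hQ2 z hz v
    refine isDiscreteEigenvalue_of_compact hZ (convex_halfSpace_re_lt β).isPreconnected hQ1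
      (fun z hz => (differentiableAt_of_resolvent_identity hZ ?_ hz).differentiableWithinAt)
      ?_ ?_ hwβ hwP
    · intro z hz w hw
      ext v
      change Q z (v - (z - w) • Q w v) = Q w v
      obtain ⟨hu, hv⟩ := (hQ1 w hw v _).1 rfl
      refine (hQ1 z hz _ _).2 ⟨hu, ?_⟩
      have hv' : v = P ⟨Q w v, hu⟩ - w • Q w v + K (Q w v) := hv.symm
      generalize hx : Q w v = x at *
      rw [hv', sub_smul]
      abel
    · -- compactness: approximate `Q z v` by elements of the domain of `T`
      intro z hz
      have hpos : 0 < β - z.re := sub_pos.2 hz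
      set δ := β - z.re
      set C : ℝ := (1 + (‖S‖ + ‖K‖ + ‖z‖) * δ⁻¹) * δ⁻¹ + δ⁻¹ + 1 with hC
      have hδ : 0 < δ⁻¹ := by positivity
      have hb0 : 0 ≤ (‖S‖ + ‖K‖ + ‖z‖) * δ⁻¹ := by positivity
      rw [Metric.totallyBounded_iff]
      intro ε hε
      obtain ⟨t, ht, htc⟩ := Metric.totallyBounded_iff.1 (hKc C) (ε / 2) (by positivity)
      refine ⟨t, ht, ?_⟩
      rintro _ ⟨v, hv, rfl⟩
      have hv1 : ‖v‖ ≤ 1 := by simpa using hv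
      obtain ⟨hu, huv⟩ := (hQ1 z hz v _).1 rfl
      set u := Q z v with hudef
      have hun : ‖u‖ ≤ δ⁻¹ := by
        calc ‖u‖ ≤ ‖Q z‖ * ‖v‖ := (Q z).le_opNorm v
          _ ≤ δ⁻¹ * 1 := by gcongr; exact hQn z hz
          _ = δ⁻¹ := mul_one _
      have hFu : friedrichsExtension T ⟨u, hu⟩ = v - S u - K u + z • u := by
        rw [← huv, hPapp]; abel
      have hFn : ‖friedrichsExtension T ⟨u, hu⟩‖ ≤ 1 + (‖S‖ + ‖K‖ + ‖z‖) * δ⁻¹ := by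
        rw [hFu]
        calc ‖v - S u - K u + z • u‖ ≤ ‖v‖ + ‖S u‖ + ‖K u‖ + ‖z • u‖ := by
              refine (norm_add_le _ _).trans ?_
              gcongr
              refine (norm_sub_le _ _).trans ?_
              gcongr
              exact norm_sub_le _ _
          _ ≤ 1 + ‖S‖ * δ⁻¹ + ‖K‖ * δ⁻¹ + ‖z‖ * δ⁻¹ := by
              have h1 := (S.le_opNorm u).trans (mul_le_mul_of_nonneg_left hun (norm_nonneg _))
              have h2 := (K.le_opNorm u).trans (mul_le_mul_of_nonneg_left hun (norm_nonneg _))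
              have h3 : ‖z • u‖ ≤ ‖z‖ * δ⁻¹ := by rw [norm_smul]; gcongr
              linarith
          _ = _ := by ring
      have hq : (⟪friedrichsExtension T ⟨u, hu⟩, u⟫_ℂ).re
          ≤ (1 + (‖S‖ + ‖K‖ + ‖z‖) * δ⁻¹) * δ⁻¹ := by
        refine (Complex.re_le_norm _).trans ((norm_inner_le_norm _ _).trans ?_)
        gcongr
      obtain ⟨x, hx1, hx2⟩ := exists_seq_tendsto_quadForm hd hsb ⟨u, hu⟩
      have hKx : Tendsto (fun k => K (x k)) atTop (𝓝 (K u)) := (K.continuous.tendsto u).comp hx1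
      have e1 := hx1.norm.eventually_lt_const (show ‖u‖ < C by
        rw [hC]; have : 0 ≤ (1 + (‖S‖ + ‖K‖ + ‖z‖) * δ⁻¹) * δ⁻¹ := by positivity
        linarith)
      have e2 := hx2.eventually_lt_const (show _ < C by rw [hC]; linarith)
      have e3 := Metric.tendsto_nhds.1 hKx (ε / 2) (by positivity)
      obtain ⟨k, ⟨h1, h2⟩, h3⟩ := ((e1.and e2).and e3).exists
      obtain ⟨y, hy, hyt⟩ := Set.mem_iUnion₂.1 (htc ⟨x k, h1.le, h2.le, rfl⟩)
      refine Set.mem_iUnion₂.2 ⟨y, hy, ?_⟩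
      rw [Metric.mem_ball] at hyt ⊢
      calc dist (K u) y ≤ dist (K u) (K (x k)) + dist (K (x k)) y := dist_triangle _ _ _
        _ < ε := by rw [dist_comm (K u)]; linarith
    · refine ⟨((β - ‖K‖ - 1 : ℝ) : ℂ), ?_, ?_⟩
      · simp only [hZdef, Set.mem_ofPred_eq, Complex.ofReal_re]
        linarith [norm_nonneg K]
      · have hz : ((β - ‖K‖ - 1 : ℝ) : ℂ) ∈ Z := by
          simp only [hZdef, Set.mem_ofPred_eq, Complex.ofReal_re]
          linarith [norm_nonneg K]
        have h1 := hQn _ hz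
        rw [Complex.ofReal_re, show β - (β - ‖K‖ - 1) = ‖K‖ + 1 by ring] at h1
        have hp : 0 < ‖K‖ + 1 := by positivity
        calc ‖K ∘L Q ((β - ‖K‖ - 1 : ℝ) : ℂ)‖ ≤ ‖K‖ * ‖Q ((β - ‖K‖ - 1 : ℝ) : ℂ)‖ :=
              ContinuousLinearMap.opNorm_comp_le _ _
          _ ≤ ‖K‖ * (‖K‖ + 1)⁻¹ := by gcongr
          _ < 1 := by rw [← div_eq_mul_inv, div_lt_one hp]; linarith

end DiscreteSpectrum

/-! ### The Rellich compactness theorem in Euclidean space -/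

section Rellich

/-- The Cauchy-Schwarz inequality against the constant `1`. -/
theorem sq_lintegral_le {X : Type*} [MeasurableSpace X] (ν : Measure X) {f : X → ℝ≥0∞}
    (hf : AEMeasurable f ν) : (∫⁻ x, f x ∂ν) ^ 2 ≤ ν Set.univ * ∫⁻ x, f x ^ 2 ∂ν := by
  have h := ENNReal.lintegral_mul_le_Lp_mul_Lq ν (p := 2) (q := 2)
    ⟨by norm_num, by norm_num, by norm_num⟩
    (f := fun _ => 1) aemeasurable_const hf
  simp only [Pi.mul_apply, one_mul, ENNReal.one_rpow, lintegral_const, one_div] at h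
  calc (∫⁻ x, f x ∂ν) ^ 2
      ≤ (ν Set.univ ^ (2 : ℝ)⁻¹ * (∫⁻ x, f x ^ (2 : ℝ) ∂ν) ^ (2 : ℝ)⁻¹) ^ 2 := by gcongr
    _ = ν Set.univ * ∫⁻ x, f x ^ 2 ∂ν := by
      rw [mul_pow, ← ENNReal.rpow_two, ← ENNReal.rpow_two, ← ENNReal.rpow_mul, ← ENNReal.rpow_mul]
      simp

variable {V : Type*} [NormedAddCommGroup V] [NormedSpace ℝ V] [FiniteDimensional ℝ V]
  [MeasurableSpace V] [BorelSpace V] {μ : Measure V} [μ.IsAddHaarMeasure]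

/-- Translation by `y` moves `f` by at most `‖y‖ ‖∇f‖` in `L²`. -/
theorem lintegral_enorm_sub_translate_sq_le {f : V → ℂ} (hf : ContDiff ℝ 1 f) (y : V) :
    ∫⁻ x, ‖f (x - y) - f x‖ₑ ^ 2 ∂μ ≤ ‖y‖ₑ ^ 2 * ∫⁻ x, ‖fderiv ℝ f x‖ₑ ^ 2 ∂μ := by
  have hf' : Continuous (fderiv ℝ f) := hf.continuous_fderiv one_ne_zero
  have hpt : ∀ x, ‖f (x - y) - f x‖ₑ ^ 2
      ≤ ‖y‖ₑ ^ 2 * ∫⁻ t in Set.Ioc (0 : ℝ) 1, ‖fderiv ℝ f (x - t • y)‖ₑ ^ 2 := by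
    intro x
    have hd : ∀ t : ℝ, HasDerivAt (fun t : ℝ => f (x - t • y)) (-(fderiv ℝ f (x - t • y) y)) t := by
      intro t
      have h1 : HasDerivAt (fun t : ℝ => x - t • y) (-y) t := by
        simpa using ((hasDerivAt_id t).smul_const y).const_sub x
      have h2 := ((hf.differentiable one_ne_zero) (x - t • y)).hasFDerivAt.comp_hasDerivAt t h1
      have e : fderiv ℝ f (x - t • y) (-y) = -(fderiv ℝ f (x - t • y) y) := map_neg _ _
      rw [← e]
      exact h2
    have h1 : (∫ t in (0 : ℝ)..1, -(fderiv ℝ f (x - t • y) y)) = f (x - y) - f x := by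
      rw [intervalIntegral.integral_eq_sub_of_hasDerivAt (fun t _ => hd t)
        (Continuous.intervalIntegrable (by fun_prop) _ _)]
      simp
    have h2 : ‖f (x - y) - f x‖ₑ
        ≤ ‖y‖ₑ * ∫⁻ t in Set.Ioc (0 : ℝ) 1, ‖fderiv ℝ f (x - t • y)‖ₑ := by
      rw [← h1, intervalIntegral.integral_of_le zero_le_one]
      refine (enorm_integral_le_lintegral_enorm _).trans ?_
      rw [← lintegral_const_mul' _ _ enorm_ne_top]
      refine lintegral_mono fun t => ?_
      rw [enorm_neg, mul_comm]
      exact ContinuousLinearMap.le_opENorm _ _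
    calc ‖f (x - y) - f x‖ₑ ^ 2
        ≤ (‖y‖ₑ * ∫⁻ t in Set.Ioc (0 : ℝ) 1, ‖fderiv ℝ f (x - t • y)‖ₑ) ^ 2 := by gcongr
      _ ≤ _ := by
        rw [mul_pow]
        gcongr
        refine (sq_lintegral_le _ ?_).trans (by simp)
        exact (Continuous.enorm (by fun_prop)).aemeasurable
  calc ∫⁻ x, ‖f (x - y) - f x‖ₑ ^ 2 ∂μ
      ≤ ∫⁻ x, ‖y‖ₑ ^ 2 * (∫⁻ t in Set.Ioc (0 : ℝ) 1, ‖fderiv ℝ f (x - t • y)‖ₑ ^ 2) ∂μ :=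
        lintegral_mono hpt
    _ = ‖y‖ₑ ^ 2 * ∫⁻ x, (∫⁻ t in Set.Ioc (0 : ℝ) 1, ‖fderiv ℝ f (x - t • y)‖ₑ ^ 2) ∂μ :=
        lintegral_const_mul' _ _ (by simp)
    _ = ‖y‖ₑ ^ 2 * ∫⁻ t in Set.Ioc (0 : ℝ) 1, ∫⁻ x, ‖fderiv ℝ f (x - t • y)‖ₑ ^ 2 ∂μ := by
        rw [lintegral_lintegral_swap]
        have : Continuous fun p : V × ℝ => ‖fderiv ℝ f (p.1 - p.2 • y)‖ₑ ^ 2 := by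
          refine (ENNReal.continuous_pow 2).comp (Continuous.enorm (by fun_prop))
        exact this.aemeasurable
    _ = ‖y‖ₑ ^ 2 * ∫⁻ x, ‖fderiv ℝ f x‖ₑ ^ 2 ∂μ := by
        congr 1
        have : ∀ t : ℝ, ∫⁻ x, ‖fderiv ℝ f (x - t • y)‖ₑ ^ 2 ∂μ = ∫⁻ x, ‖fderiv ℝ f x‖ₑ ^ 2 ∂μ :=
          fun t => lintegral_sub_right_eq_self (fun x => ‖fderiv ℝ f x‖ₑ ^ 2) (t • y)
        simp [this]

variable (μ) in
/-- Convolution of `f` with the normalized bump function `φ`, centred at `0`. -/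
noncomputable def mollify (φ : ContDiffBump (0 : V)) (f : V → ℂ) (x : V) : ℂ :=
  ∫ y, φ.normed μ y • f (x - y) ∂μ

theorem mollify_eq (φ : ContDiffBump (0 : V)) (f : V → ℂ) (x : V) :
    mollify μ φ f x = ∫ y, φ.normed μ (x - y) • f y ∂μ := by
  rw [mollify, ← integral_sub_left_eq_self _ μ x]
  simp

/-- A mollification on the scale `φ.rOut` moves `f` by at most `φ.rOut ‖∇f‖` in `L²`: it is an
average of translations. -/
theorem lintegral_enorm_mollify_sub_sq_le (φ : ContDiffBump (0 : V)) {f : V → ℂ}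
    (hf : ContDiff ℝ 1 f) :
    ∫⁻ x, ‖mollify μ φ f x - f x‖ₑ ^ 2 ∂μ
      ≤ ENNReal.ofReal φ.rOut ^ 2 * ∫⁻ x, ‖fderiv ℝ f x‖ₑ ^ 2 ∂μ := by
  set ρ : V → ℝ≥0∞ := fun y => ENNReal.ofReal (φ.normed μ y) with hρ
  have hρm : Measurable ρ := (φ.continuous_normed.measurable).ennreal_ofReal
  set ν := μ.withDensity ρ with hν
  have hν1 : ν Set.univ = 1 := by
    rw [hν, withDensity_apply _ MeasurableSet.univ, Measure.restrict_univ,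
      ← ofReal_integral_eq_lintegral_ofReal φ.integrable_normed
        (ae_of_all _ φ.nonneg_normed), φ.integral_normed, ENNReal.ofReal_one]
  have hsf : SFinite ν := by
    have : IsProbabilityMeasure ν := ⟨hν1⟩
    infer_instance
  have hpt : ∀ x, ‖mollify μ φ f x - f x‖ₑ ^ 2 ≤ ∫⁻ y, ‖f (x - y) - f x‖ₑ ^ 2 ∂ν := by
    intro x
    have h1 : mollify μ φ f x - f x = ∫ y, φ.normed μ y • (f (x - y) - f x) ∂μ := by
      simp only [smul_sub]
      rw [integral_sub, integral_smul_const, φ.integral_normed, one_smul, mollify]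
      · refine Continuous.integrable_of_hasCompactSupport ?_ ?_
        · exact φ.continuous_normed.smul (hf.continuous.comp (by fun_prop))
        · exact φ.hasCompactSupport_normed.smul_right
      · exact φ.integrable_normed.smul_const _
    have h2 : ‖mollify μ φ f x - f x‖ₑ ≤ ∫⁻ y, ‖f (x - y) - f x‖ₑ ∂ν := by
      rw [h1, hν, lintegral_withDensity_eq_lintegral_mul _ hρm]
      · refine (enorm_integral_le_lintegral_enorm _).trans (lintegral_mono fun y => ?_)
        rw [enorm_smul, Pi.mul_apply, hρ, Real.enorm_of_nonneg (φ.nonneg_normed y)]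
      · exact (Continuous.enorm ((hf.continuous.comp (by fun_prop)).sub
          continuous_const)).measurable
    calc ‖mollify μ φ f x - f x‖ₑ ^ 2 ≤ (∫⁻ y, ‖f (x - y) - f x‖ₑ ∂ν) ^ 2 := by gcongr
      _ ≤ ν Set.univ * ∫⁻ y, ‖f (x - y) - f x‖ₑ ^ 2 ∂ν := by
        refine sq_lintegral_le _ ?_
        exact (Continuous.enorm ((hf.continuous.comp (by fun_prop)).sub
          continuous_const)).aemeasurable
      _ = _ := by rw [hν1, one_mul]
  have hcont : Continuous fun p : V × V => ‖f (p.1 - p.2) - f p.1‖ₑ ^ 2 :=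
    (ENNReal.continuous_pow 2).comp (Continuous.enorm ((hf.continuous.comp (by fun_prop)).sub
      (hf.continuous.comp (by fun_prop))))
  calc ∫⁻ x, ‖mollify μ φ f x - f x‖ₑ ^ 2 ∂μ
      ≤ ∫⁻ x, ∫⁻ y, ‖f (x - y) - f x‖ₑ ^ 2 ∂ν ∂μ := lintegral_mono hpt
    _ = ∫⁻ y, ∫⁻ x, ‖f (x - y) - f x‖ₑ ^ 2 ∂μ ∂ν := by
        rw [lintegral_lintegral_swap]
        exact hcont.aemeasurable
    _ ≤ ∫⁻ y, ‖y‖ₑ ^ 2 * ∫⁻ x, ‖fderiv ℝ f x‖ₑ ^ 2 ∂μ ∂ν :=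
        lintegral_mono fun y => lintegral_enorm_sub_translate_sq_le hf y
    _ = ∫⁻ y, ρ y * (‖y‖ₑ ^ 2 * ∫⁻ x, ‖fderiv ℝ f x‖ₑ ^ 2 ∂μ) ∂μ := by
        rw [hν, lintegral_withDensity_eq_lintegral_mul _ hρm]
        · rfl
        · exact (((ENNReal.continuous_pow 2).comp continuous_enorm).measurable).mul_const _
    _ ≤ ∫⁻ y, ρ y * (ENNReal.ofReal φ.rOut ^ 2 * ∫⁻ x, ‖fderiv ℝ f x‖ₑ ^ 2 ∂μ) ∂μ := by
        refine lintegral_mono fun y => ?_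
        by_cases hy : y ∈ Metric.ball (0 : V) φ.rOut
        · gcongr
          rw [← ofReal_norm]
          exact ENNReal.ofReal_le_ofReal (by simpa using (Metric.mem_ball.1 hy).le)
        · have : φ.normed μ y = 0 := by
            rw [← Function.notMem_support, φ.support_normed_eq]; exact hy
          simp [hρ, this]
    _ = (∫⁻ y, ρ y ∂μ) * (ENNReal.ofReal φ.rOut ^ 2 * ∫⁻ x, ‖fderiv ℝ f x‖ₑ ^ 2 ∂μ) :=
        lintegral_mul_const _ hρm
    _ = _ := by
        have : ∫⁻ y, ρ y ∂μ = ν Set.univ := by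
          rw [hν, withDensity_apply _ MeasurableSet.univ, Measure.restrict_univ]
        rw [this, hν1, one_mul]

theorem measurable_mollify (φ : ContDiffBump (0 : V)) {f : V → ℂ} (hf : Continuous f) :
    Measurable (mollify μ φ f) := by
  have : Continuous fun p : V × V => φ.normed μ p.2 • f (p.1 - p.2) :=
    (φ.continuous_normed.comp continuous_snd).smul (hf.comp (by fun_prop))
  exact (this.stronglyMeasurable.integral_prod_right' (ν := μ)).measurable

theorem exists_pos_ofReal_sq_mul_le {A ε : ℝ≥0∞} (hA : A ≠ ⊤) (hε : ε ≠ 0) :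
    ∃ η : ℝ, 0 < η ∧ ENNReal.ofReal η ^ 2 * A ≤ ε := by
  have h : Tendsto (fun η : ℝ => ENNReal.ofReal η ^ 2 * A) (𝓝[>] 0) (𝓝 (0 ^ 2 * A)) := by
    refine ENNReal.Tendsto.mul_const ?_ (Or.inr hA)
    refine ((ENNReal.continuous_pow 2).tendsto _).comp ?_
    have := (ENNReal.continuous_ofReal.tendsto (0 : ℝ))
    rw [ENNReal.ofReal_zero] at this
    exact this.mono_left nhdsWithin_le_nhds
  rw [zero_pow two_ne_zero, zero_mul] at h
  have h1 := h.eventually_lt_const (pos_iff_ne_zero.2 hε)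
  obtain ⟨η, h2, h3⟩ := (h1.and self_mem_nhdsWithin).exists
  exact ⟨η, h3, h2.le⟩

theorem ENNReal.add_sq_le_four (a b : ℝ≥0∞) : (a + b) ^ 2 ≤ 4 * (a ^ 2 + b ^ 2) := by
  have h : a + b ≤ 2 * max a b := by
    rw [two_mul]; exact add_le_add (le_max_left _ _) (le_max_right _ _)
  calc (a + b) ^ 2 ≤ (2 * max a b) ^ 2 := by gcongr
    _ = 4 * max a b ^ 2 := by rw [mul_pow]; norm_num
    _ ≤ 4 * (a ^ 2 + b ^ 2) := by
      gcongr
      rcases le_total a b with h | h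
      · rw [max_eq_right h]; exact le_add_self
      · rw [max_eq_left h]; exact le_self_add

/-- A bounded set of `ℂᵐ` can be coloured with finitely many colours such that points of the same
colour are close to each other. -/
theorem exists_finite_coloring_closedBall (m : ℕ) (R : ℝ) {δ : ℝ} (hδ : 0 < δ) :
    ∃ (ι : Type) (_ : Finite ι) (c : (Fin m → ℂ) → ι), ∀ a b, ‖a‖ ≤ R → ‖b‖ ≤ R → c a = c b →
      ‖a - b‖ ≤ δ := by
  classical
  obtain ⟨t, ht, htc⟩ := Metric.totallyBounded_iff.1
    (isCompact_closedBall (0 : Fin m → ℂ) R).totallyBounded (δ / 2) (by positivity)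
  have : Finite t := ht
  have hex : ∀ a : Fin m → ℂ, ‖a‖ ≤ R → ∃ y : t, a ∈ Metric.ball (y : Fin m → ℂ) (δ / 2) := by
    intro a ha
    obtain ⟨y, hy, hay⟩ := Set.mem_iUnion₂.1
      (htc (show a ∈ Metric.closedBall 0 R by simpa using ha))
    exact ⟨⟨y, hy⟩, hay⟩
  refine ⟨Option t, inferInstance, fun a =>
    if h : ∃ y : t, a ∈ Metric.ball (y : Fin m → ℂ) (δ / 2) then some h.choose else none, ?_⟩
  intro a b ha hb hab
  simp only [dif_pos (hex a ha), dif_pos (hex b hb), Option.some.injEq] at hab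
  have h1 := Metric.mem_ball.1 (hex a ha).choose_spec
  have h2 := Metric.mem_ball.1 (hex b hb).choose_spec
  rw [hab] at h1
  rw [← dist_eq_norm]
  calc dist a b ≤ dist a (hex b hb).choose + dist b (hex b hb).choose := dist_triangle_right _ _ _
    _ ≤ δ := by linarith

variable (μ) in
/-- The `C¹` functions with support in `K` and squared `L²` norms of `f` and of its derivative at
most `C`. -/
def h1Ball (K : Set V) (C : ℝ≥0∞) : Set (V → ℂ) :=
  {f | ContDiff ℝ 1 f ∧ Function.support f ⊆ K ∧ ∫⁻ x, ‖f x‖ₑ ^ 2 ∂μ ≤ C ∧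
    ∫⁻ x, ‖fderiv ℝ f x‖ₑ ^ 2 ∂μ ≤ C}

/-- **Rellich's theorem**: the `C¹` functions supported in a fixed compact set and bounded in `H¹`
form a totally bounded set for the `L²` distance. Total boundedness is expressed by finite
colourings, so that it can be used without forming equivalence classes of functions. -/
theorem exists_finite_coloring_h1Ball {K : Set V} (hK : IsCompact K) {C : ℝ≥0∞}
    (hC : C ≠ ⊤) {ε : ℝ≥0∞} (hε : ε ≠ 0) :
    ∃ (ι : Type) (_ : Finite ι) (c : (V → ℂ) → ι), ∀ f ∈ h1Ball μ K C, ∀ g ∈ h1Ball μ K C,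
      c f = c g → ∫⁻ x, ‖f x - g x‖ₑ ^ 2 ∂μ ≤ ε := by
  have hKμ : μ K ≠ ⊤ := hK.measure_lt_top.ne
  set I : ℝ≥0∞ := μ K * C + 1 with hI
  have hIt : I ≠ ⊤ := ENNReal.add_ne_top.2 ⟨ENNReal.mul_ne_top hKμ hC, ENNReal.one_ne_top⟩
  have hL1 : ∀ f ∈ h1Ball μ K C, ∫⁻ x, ‖f x‖ₑ ∂μ ≤ I := by
    rintro f ⟨hf, hs, hf2, -⟩
    have h1 : ∫⁻ x, ‖f x‖ₑ ∂μ = ∫⁻ x in K, ‖f x‖ₑ ∂μ := by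
      rw [setLIntegral_eq_of_support_subset]
      intro x hx
      exact hs (by simpa using hx)
    have h2 : (∫⁻ x, ‖f x‖ₑ ∂μ) ^ 2 ≤ μ K * C := by
      rw [h1]
      refine (sq_lintegral_le _ hf.continuous.enorm.aemeasurable).trans ?_
      rw [Measure.restrict_apply_univ]
      gcongr
      exact (setLIntegral_le_lintegral _ _).trans hf2
    rcases le_total (∫⁻ x, ‖f x‖ₑ ∂μ) 1 with h | h
    · exact h.trans le_add_self
    · calc ∫⁻ x, ‖f x‖ₑ ∂μ ≤ (∫⁻ x, ‖f x‖ₑ ∂μ) ^ 2 := le_self_pow₀ h two_ne_zero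
        _ ≤ μ K * C := h2
        _ ≤ I := le_self_add
  have hε4 : ε / 2 ≠ 0 := by simp [hε]
  obtain ⟨η, hη, hηε⟩ := exists_pos_ofReal_sq_mul_le (A := 32 * C)
    (ENNReal.mul_ne_top (by norm_num) hC) hε4
  obtain ⟨s, hs, hsε⟩ := exists_pos_ofReal_sq_mul_le (A := 16 * μ K)
    (ENNReal.mul_ne_top (by norm_num) hKμ) hε4
  let φ : ContDiffBump (0 : V) := ⟨η / 2, η, by positivity, by linarith⟩
  set ρ := φ.normed μ with hρ
  have hρc : Continuous ρ := φ.continuous_normed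
  have hρu : UniformContinuous ρ :=
    φ.hasCompactSupport_normed.uniformContinuous_of_continuous hρc
  obtain ⟨M, hM⟩ := φ.hasCompactSupport_normed.exists_bound_of_continuous hρc
  -- the mollified functions are uniformly bounded and equicontinuous
  have hbd : ∀ f ∈ h1Ball μ K C, ∀ x, ‖mollify μ φ f x‖ ≤ M * I.toReal := by
    intro f hf x
    have hM0 : 0 ≤ M := (norm_nonneg _).trans (hM 0)
    rw [← toReal_enorm, ← ENNReal.toReal_ofReal hM0, ← ENNReal.toReal_mul]
    refine ENNReal.toReal_mono (ENNReal.mul_ne_top ENNReal.ofReal_ne_top hIt) ?_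
    rw [mollify_eq]
    refine (enorm_integral_le_lintegral_enorm _).trans ?_
    calc ∫⁻ y, ‖ρ (x - y) • f y‖ₑ ∂μ ≤ ∫⁻ y, ENNReal.ofReal M * ‖f y‖ₑ ∂μ := by
          refine lintegral_mono fun y => ?_
          rw [enorm_smul]
          gcongr
          rw [← ofReal_norm]
          exact ENNReal.ofReal_le_ofReal (hM _)
      _ = ENNReal.ofReal M * ∫⁻ y, ‖f y‖ₑ ∂μ := lintegral_const_mul' _ _ ENNReal.ofReal_ne_top
      _ ≤ _ := by gcongr; exact hL1 f hf
  set τ : ℝ := s / 3 / (I.toReal + 1) with hτ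
  have hI0 : 0 ≤ I.toReal := ENNReal.toReal_nonneg
  have hτ0 : 0 < τ := by positivity
  obtain ⟨θ, hθ, hθρ⟩ := Metric.uniformContinuous_iff.1 hρu τ hτ0
  have hlip : ∀ f ∈ h1Ball μ K C, ∀ x x', dist x x' < θ →
      ‖mollify μ φ f x - mollify μ φ f x'‖ ≤ s / 3 := by
    intro f hf x x' hxx
    have hint : ∀ x, Integrable (fun y => ρ (x - y) • f y) μ := by
      intro x
      refine Continuous.integrable_of_hasCompactSupport ?_ ?_
      · exact (hρc.comp (by fun_prop)).smul hf.1.continuous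
      · refine HasCompactSupport.of_support_subset_isCompact hK ?_
        exact fun y hy => hf.2.1 fun h => hy (by simp [h])
    have h1 : ‖mollify μ φ f x - mollify μ φ f x'‖ₑ ≤ ENNReal.ofReal τ * I := by
      rw [mollify_eq, mollify_eq, ← integral_sub (hint x) (hint x')]
      refine (enorm_integral_le_lintegral_enorm _).trans ?_
      calc ∫⁻ y, ‖ρ (x - y) • f y - ρ (x' - y) • f y‖ₑ ∂μ
          ≤ ∫⁻ y, ENNReal.ofReal τ * ‖f y‖ₑ ∂μ := by
            refine lintegral_mono fun y => ?_
            rw [← sub_smul, enorm_smul]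
            gcongr
            rw [← ofReal_norm, ← dist_eq_norm]
            exact ENNReal.ofReal_le_ofReal (hθρ (by simpa using hxx)).le
        _ = ENNReal.ofReal τ * ∫⁻ y, ‖f y‖ₑ ∂μ := lintegral_const_mul' _ _ ENNReal.ofReal_ne_top
        _ ≤ _ := by gcongr; exact hL1 f hf
    have h2 := ENNReal.toReal_mono (ENNReal.mul_ne_top ENNReal.ofReal_ne_top hIt) h1
    rw [toReal_enorm, ENNReal.toReal_mul, ENNReal.toReal_ofReal hτ0.le] at h2
    refine h2.trans ?_
    calc τ * I.toReal ≤ τ * (I.toReal + 1) := by gcongr; linarith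
      _ = s / 3 := by rw [hτ]; field_simp
  -- hence they are determined up to a small error by their values on a finite net
  obtain ⟨t, ht, htK⟩ := Metric.totallyBounded_iff.1 hK.totallyBounded θ hθ
  obtain ⟨m, x, hx⟩ : ∃ (m : ℕ) (x : Fin m → V), Set.range x = t := by
    have : Finite t := ht
    obtain ⟨m, ⟨e⟩⟩ := Finite.exists_equiv_fin t
    exact ⟨m, fun i => e.symm i, by
      ext y; constructor
      · rintro ⟨i, rfl⟩; exact (e.symm i).2
      · intro hy; exact ⟨e ⟨y, hy⟩, by simp⟩⟩
  obtain ⟨ι, hι, c, hc⟩ := exists_finite_coloring_closedBall m (M * I.toReal)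
    (show 0 < s / 3 by positivity)
  refine ⟨ι, hι, fun f => c fun i => mollify μ φ f (x i), fun f hf g hg hfg => ?_⟩
  have hnorm : ∀ f ∈ h1Ball μ K C, ‖fun i => mollify μ φ f (x i)‖ ≤ M * I.toReal := by
    intro f hf
    refine (pi_norm_le_iff_of_nonneg ?_).2 fun i => hbd f hf _
    exact (norm_nonneg _).trans (hbd f hf 0)
  have hnet := hc _ _ (hnorm f hf) (hnorm g hg) hfg
  have hclose : ∀ y ∈ K, ‖mollify μ φ f y - mollify μ φ g y‖ₑ ≤ ENNReal.ofReal s := by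
    intro y hy
    obtain ⟨z, hz, hyz⟩ := Set.mem_iUnion₂.1 (htK hy)
    rw [← hx] at hz
    obtain ⟨i, rfl⟩ := hz
    have h1 := hlip f hf y (x i) hyz
    have h2 := hlip g hg (x i) y (by rw [dist_comm]; exact hyz)
    have h3 := (norm_le_pi_norm _ i).trans hnet
    rw [Pi.sub_apply] at h3
    rw [← ofReal_norm]
    refine ENNReal.ofReal_le_ofReal ?_
    calc ‖mollify μ φ f y - mollify μ φ g y‖
        = ‖(mollify μ φ f y - mollify μ φ f (x i)) + (mollify μ φ f (x i) - mollify μ φ g (x i))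
          + (mollify μ φ g (x i) - mollify μ φ g y)‖ := by congr 1; abel
      _ ≤ s / 3 + s / 3 + s / 3 := (norm_add_le _ _).trans
          (add_le_add ((norm_add_le _ _).trans (add_le_add h1 h3)) h2)
      _ = s := by ring
  have hmf := measurable_mollify (μ := μ) φ hf.1.continuous
  have hmg := measurable_mollify (μ := μ) φ hg.1.continuous
  have hm1 : Measurable fun y => ‖mollify μ φ f y - f y‖ₑ ^ 2 :=
    ((hmf.sub hf.1.continuous.measurable).enorm).pow_const 2
  have hm2 : Measurable fun y => ‖mollify μ φ g y - g y‖ₑ ^ 2 :=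
    ((hmg.sub hg.1.continuous.measurable).enorm).pow_const 2
  have hpt : ∀ y, ‖f y - g y‖ₑ ^ 2 ≤ 16 * (‖mollify μ φ f y - f y‖ₑ ^ 2
      + (‖mollify μ φ g y - g y‖ₑ ^ 2 + ‖mollify μ φ f y - mollify μ φ g y‖ₑ ^ 2)) := by
    intro y
    have e : f y - g y = -(mollify μ φ f y - f y) + ((mollify μ φ g y - g y)
        + (mollify μ φ f y - mollify μ φ g y)) := by ring
    calc ‖f y - g y‖ₑ ^ 2 ≤ (‖mollify μ φ f y - f y‖ₑ + (‖mollify μ φ g y - g y‖ₑ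
          + ‖mollify μ φ f y - mollify μ φ g y‖ₑ)) ^ 2 := by
          rw [e]
          gcongr
          refine (enorm_add_le _ _).trans ?_
          rw [enorm_neg]
          gcongr
          exact enorm_add_le _ _
      _ ≤ 4 * (‖mollify μ φ f y - f y‖ₑ ^ 2 + 4 * (‖mollify μ φ g y - g y‖ₑ ^ 2
          + ‖mollify μ φ f y - mollify μ φ g y‖ₑ ^ 2)) := by
          refine (ENNReal.add_sq_le_four _ _).trans ?_
          gcongr
          exact ENNReal.add_sq_le_four _ _
      _ ≤ 4 * (4 * ‖mollify μ φ f y - f y‖ₑ ^ 2 + 4 * (‖mollify μ φ g y - g y‖ₑ ^ 2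
          + ‖mollify μ φ f y - mollify μ φ g y‖ₑ ^ 2)) := by
          gcongr
          exact le_mul_of_one_le_left zero_le (by norm_num)
      _ = _ := by rw [← mul_add, ← mul_assoc]; norm_num
  have e1 : ∀ f ∈ h1Ball μ K C, ∫⁻ y in K, ‖mollify μ φ f y - f y‖ₑ ^ 2 ∂μ
      ≤ ENNReal.ofReal η ^ 2 * C := fun f hf =>
    (setLIntegral_le_lintegral _ _).trans ((lintegral_enorm_mollify_sub_sq_le φ hf.1).trans
      (mul_le_mul_right hf.2.2.2 _))
  calc ∫⁻ y, ‖f y - g y‖ₑ ^ 2 ∂μ = ∫⁻ y in K, ‖f y - g y‖ₑ ^ 2 ∂μ := by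
        rw [setLIntegral_eq_of_support_subset]
        intro y hy
        by_contra h
        have h1 : f y = 0 := by by_contra h'; exact h (hf.2.1 h')
        have h2 : g y = 0 := by by_contra h'; exact h (hg.2.1 h')
        simp [h1, h2] at hy
    _ ≤ ∫⁻ y in K, 16 * (‖mollify μ φ f y - f y‖ₑ ^ 2
      + (‖mollify μ φ g y - g y‖ₑ ^ 2 + ENNReal.ofReal s ^ 2)) ∂μ := by
        refine setLIntegral_mono' hK.measurableSet fun y hy => (hpt y).trans ?_
        gcongr
        exact hclose y hy
    _ = 16 * (∫⁻ y in K, ‖mollify μ φ f y - f y‖ₑ ^ 2 ∂μ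
        + (∫⁻ y in K, ‖mollify μ φ g y - g y‖ₑ ^ 2 ∂μ + ENNReal.ofReal s ^ 2 * μ K)) := by
        rw [lintegral_const_mul' _ _ (by norm_num), lintegral_add_left hm1,
          lintegral_add_left hm2, lintegral_const, Measure.restrict_apply_univ]
    _ ≤ 16 * (ENNReal.ofReal η ^ 2 * C + (ENNReal.ofReal η ^ 2 * C
        + ENNReal.ofReal s ^ 2 * μ K)) := by
        gcongr
        exacts [e1 f hf, e1 g hg]
    _ = ENNReal.ofReal η ^ 2 * (32 * C) + ENNReal.ofReal s ^ 2 * (16 * μ K) := by ring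
    _ ≤ ε / 2 + ε / 2 := add_le_add hηε hsε
    _ = ε := ENNReal.add_halves ε

end Rellich

/-! ### Schrödinger operators defined by a Laplacian with finite energy -/

section AbstractSchrodinger

theorem mulOperator_coeFn {X : Type*} [MeasurableSpace X] {μ : Measure X} (a : X → ℂ)
    (ha : MemLp a ∞ μ) (f : Lp ℂ 2 μ) : mulOperator μ a ha f =ᵐ[μ] fun x => a x * f x := by
  have h := (ContinuousLinearMap.mul ℂ ℂ).coeFn_holder (r := 2) (ha.toLp a) f
  filter_upwards [h, ha.coeFn_toLp] with x h1 h2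
  have h1' : mulOperator μ a ha f x = ha.toLp a x * f x := h1
  rw [h1', h2]

theorem lintegral_enorm_sq_eq {X : Type*} [MeasurableSpace X] {μ : Measure X} (f : Lp ℂ 2 μ) :
    ∫⁻ x, ‖f x‖ₑ ^ 2 ∂μ = ENNReal.ofReal (‖f‖ ^ 2) := by
  rw [ENNReal.ofReal_pow (norm_nonneg _), ofReal_norm, Lp.enorm_def,
    eLpNorm_eq_lintegral_rpow_enorm_toReal (by norm_num) (by norm_num)]
  simp only [ENNReal.toReal_ofNat, one_div]
  rw [← ENNReal.rpow_two, ← ENNReal.rpow_mul]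
  simp

/-- For a linear map `A` on a subspace `D` that respects equality almost everywhere, the graph of
`operatorOn μ D A` consists of the classes of the pairs `(u, A u)`: the span in its definition
changes nothing, and the graph is that of a function. -/
theorem graph_operatorOn {X : Type*} [MeasurableSpace X] {μ : Measure X}
    (D : Submodule ℂ (X → ℂ)) (A : (X → ℂ) → X → ℂ)
    (hadd : ∀ u ∈ D, ∀ v ∈ D, A (u + v) = A u + A v)
    (hsmul : ∀ (c : ℂ), ∀ u ∈ D, A (c • u) = c • A u)
    (h0 : ∀ u ∈ D, u =ᵐ[μ] 0 → A u =ᵐ[μ] 0) (f g : Lp ℂ 2 μ) :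
    (∃ hf : f ∈ (operatorOn μ (D : Set (X → ℂ)) A).domain,
      operatorOn μ (D : Set (X → ℂ)) A ⟨f, hf⟩ = g) ↔ ∃ u ∈ D, f =ᵐ[μ] u ∧ g =ᵐ[μ] A u := by
  let S : Submodule ℂ (Lp ℂ 2 μ × Lp ℂ 2 μ) :=
    { carrier := {p | ∃ u ∈ D, (p.1 : X → ℂ) =ᵐ[μ] u ∧ (p.2 : X → ℂ) =ᵐ[μ] A u}
      zero_mem' := ⟨0, D.zero_mem, Lp.coeFn_zero _ _ _, by
        have : A 0 = 0 := by simpa using hsmul 0 0 D.zero_mem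
        rw [this]; exact Lp.coeFn_zero _ _ _⟩
      add_mem' := by
        rintro p q ⟨u, hu, h1, h2⟩ ⟨v, hv, h3, h4⟩
        refine ⟨u + v, D.add_mem hu hv, (Lp.coeFn_add _ _).trans (h1.add h3), ?_⟩
        rw [hadd u hu v hv]
        exact (Lp.coeFn_add _ _).trans (h2.add h4)
      smul_mem' := by
        rintro c p ⟨u, hu, h1, h2⟩
        refine ⟨c • u, D.smul_mem c hu, (Lp.coeFn_smul _ _).trans (h1.const_smul c), ?_⟩
        rw [hsmul c u hu]
        exact (Lp.coeFn_smul _ _).trans (h2.const_smul c) }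
  have hS : Submodule.span ℂ {p : Lp ℂ 2 μ × Lp ℂ 2 μ |
      ∃ u ∈ (D : Set (X → ℂ)), (p.1 : X → ℂ) =ᵐ[μ] u ∧ (p.2 : X → ℂ) =ᵐ[μ] A u} = S :=
    Submodule.span_eq S
  have hgraph : (operatorOn μ (D : Set (X → ℂ)) A).graph = S := by
    rw [operatorOn, hS]
    refine Submodule.toLinearPMap_graph_eq S ?_
    rintro ⟨f, g⟩ ⟨u, hu, h1, h2⟩ hf
    simp only at hf h1 h2 ⊢
    subst hf
    exact (Lp.eq_zero_iff_ae_eq_zero).2 (h2.trans (h0 u hu (h1.symm.trans (Lp.coeFn_zero _ _ _))))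
  have h1 : (∃ hf : f ∈ (operatorOn μ (D : Set (X → ℂ)) A).domain,
      operatorOn μ (D : Set (X → ℂ)) A ⟨f, hf⟩ = g) ↔
      (f, g) ∈ (operatorOn μ (D : Set (X → ℂ)) A).graph := by
    simp [LinearPMap.mem_graph_iff]
  rw [h1, hgraph]
  rfl

variable {X : Type*} [TopologicalSpace X] [MeasurableSpace X] [BorelSpace X]

/-- The properties of the Laplacian `Lap` on the space `D` of test functions that the spectral
theory of `-h²Δ + V` relies on: Green's formula enters as symmetry of `Lap` and as the identity
between `-⟪Lap u, u⟫` and the Dirichlet energy of `u`. -/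
structure IsDirichletLaplacian (μ : Measure X) (D : Submodule ℂ (X → ℂ))
    (Lap : (X → ℂ) → X → ℂ) (energy : (X → ℂ) → ℝ) : Prop where
  continuous : ∀ u ∈ D, Continuous u
  hasCompactSupport : ∀ u ∈ D, HasCompactSupport u
  map_add : ∀ u ∈ D, ∀ v ∈ D, Lap (u + v) = Lap u + Lap v
  map_smul : ∀ (c : ℂ), ∀ u ∈ D, Lap (c • u) = c • Lap u
  memLp : ∀ u ∈ D, MemLp (Lap u) 2 μ
  symm : ∀ u ∈ D, ∀ v ∈ D, ∫ x, ⟪Lap u x, v x⟫_ℂ ∂μ = ∫ x, ⟪u x, Lap v x⟫_ℂ ∂μ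
  energy_nonneg : ∀ u ∈ D, 0 ≤ energy u
  energy_eq : ∀ u ∈ D, (∫ x, ⟪Lap u x, u x⟫_ℂ ∂μ).re = -energy u
  dense : ∀ f : Lp ℂ 2 μ, ∀ ε > 0, ∃ u ∈ D, eLpNorm (⇑f - u) 2 μ ≤ ENNReal.ofReal ε

/-- Sets of test functions that are bounded in the form norm become totally bounded in `L²` after
multiplication by `k`. Total boundedness is expressed by finite colourings: functions of the same
colour are close to each other. -/
def IsFormCompactMultiplier (μ : Measure X) (D : Submodule ℂ (X → ℂ)) (energy : (X → ℂ) → ℝ)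
    (k : X → ℝ) : Prop :=
  ∀ (C : ℝ) (δ : ℝ), 0 < δ → ∃ (ι : Type) (_ : Finite ι) (c : (X → ℂ) → ι),
    ∀ u ∈ D, ∀ v ∈ D, ∫⁻ x, ‖u x‖ₑ ^ 2 ∂μ ≤ ENNReal.ofReal C → energy u ≤ C →
      ∫⁻ x, ‖v x‖ₑ ^ 2 ∂μ ≤ ENNReal.ofReal C → energy v ≤ C → c u = c v →
      ∫⁻ x, ‖(k x : ℂ) * (u x - v x)‖ₑ ^ 2 ∂μ ≤ ENNReal.ofReal δ

omit [TopologicalSpace X] [BorelSpace X] in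
theorem re_inner_toLp_mul_self {μ : Measure X} {a : X → ℝ} {f g : Lp ℂ 2 μ}
    (hg : g =ᵐ[μ] fun x => (a x : ℂ) * f x) :
    (⟪g, f⟫_ℂ).re = ∫ x, a x * ‖f x‖ ^ 2 ∂μ := by
  have hint := L2.integrable_inner (𝕜 := ℂ) g f
  rw [L2.inner_def]
  have h1 := integral_re hint
  simp only [RCLike.re_to_complex] at h1
  rw [← h1]
  refine integral_congr_ae ?_
  filter_upwards [hg] with x hx
  rw [hx, ← smul_eq_mul, inner_smul_left, inner_self_eq_norm_sq_to_K, Complex.conj_ofReal]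
  simp only [Complex.coe_algebraMap, ← Complex.ofReal_pow, ← Complex.ofReal_mul, Complex.ofReal_re]

omit [TopologicalSpace X] [BorelSpace X] in
theorem integrable_mul_norm_sq {μ : Measure X} {a : X → ℝ} {f g : Lp ℂ 2 μ}
    (hg : g =ᵐ[μ] fun x => (a x : ℂ) * f x) : Integrable (fun x => a x * ‖f x‖ ^ 2) μ := by
  have hint := (L2.integrable_inner (𝕜 := ℂ) g f).re
  refine hint.congr ?_
  filter_upwards [hg] with x hx
  rw [hx, ← smul_eq_mul, inner_smul_left, inner_self_eq_norm_sq_to_K, Complex.conj_ofReal]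
  simp only [Complex.coe_algebraMap, ← Complex.ofReal_pow, ← Complex.ofReal_mul,
    RCLike.re_to_complex, Complex.ofReal_re]

theorem re_inner_mulOperator_perturbation (μ : Measure X) {W : X → ℝ} (hW : Continuous W)
    (hb : ∃ C : ℝ, ∀ x, |W x| ≤ C) (ε : ℝ) (f : Lp ℂ 2 μ) :
    (⟪mulOperator μ _ (memLp_perturbation μ hW hb ε) f, f⟫_ℂ).re = 0 := by
  have hint := L2.integrable_inner (𝕜 := ℂ) (mulOperator μ _ (memLp_perturbation μ hW hb ε) f) f
  rw [L2.inner_def]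
  have h1 := integral_re hint
  simp only [RCLike.re_to_complex] at h1
  rw [← h1]
  refine integral_eq_zero_of_ae ?_
  filter_upwards [mulOperator_coeFn _ (memLp_perturbation μ hW hb ε) f] with x hx
  rw [hx, ← smul_eq_mul, inner_smul_left, inner_self_eq_norm_sq_to_K]
  simp only [map_mul, Complex.conj_I, Complex.conj_ofReal, Complex.coe_algebraMap]
  have e : -Complex.I * (ε : ℂ) * (W x : ℂ) * ((‖f x‖ : ℝ) : ℂ) ^ 2
      = ((-(ε * W x * ‖f x‖ ^ 2) : ℝ) : ℂ) * Complex.I := by push_cast; ring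
  rw [e, Complex.re_ofReal_mul, Complex.I_re, mul_zero]
  rfl

omit [TopologicalSpace X] [BorelSpace X] in
theorem integral_norm_sq_eq {μ : Measure X} (f : Lp ℂ 2 μ) :
    ∫ x, ‖f x‖ ^ 2 ∂μ = ‖f‖ ^ 2 := by
  have h := re_inner_toLp_mul_self (μ := μ) (a := fun _ => 1) (f := f) (g := f) (by simp)
  simp only [one_mul] at h
  rw [← h]
  exact inner_self_eq_norm_sq (𝕜 := ℂ) f

/-- The discreteness criterion for `-h² Lap + V + iεW`: it suffices that, for every real `β < α`,
a bounded continuous form compact potential `k` lifts `V` to `V + k ≥ β`. -/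
theorem isClosed_and_hasDiscreteSpectrumBelow_perturbedOperator {μ : Measure X}
    [IsFiniteMeasureOnCompacts μ] [μ.IsOpenPosMeasure] {D : Submodule ℂ (X → ℂ)}
    {Lap : (X → ℂ) → X → ℂ} {energy : (X → ℂ) → ℝ} (hL : IsDirichletLaplacian μ D Lap energy)
    {V W : X → ℝ} (hV : Continuous V) (hW : Continuous W) (hb : ∃ C : ℝ, ∀ x, |W x| ≤ C)
    (h ε : ℝ) (hh : 0 < h) (α : EReal)
    (hk : ∀ β : ℝ, (β : EReal) < α → ∃ k : X → ℝ, Continuous k ∧ (∃ C : ℝ, ∀ x, |k x| ≤ C) ∧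
      (∀ x, β ≤ V x + k x) ∧ IsFormCompactMultiplier μ D energy k) :
    (⊥ < α → (perturbedOperator μ (friedrichsExtension (operatorOn μ (D : Set (X → ℂ))
      fun u x => -(h : ℂ) ^ 2 * Lap u x + V x * u x)) hW hb ε).IsClosed) ∧
    HasDiscreteSpectrumBelow (perturbedOperator μ (friedrichsExtension (operatorOn μ
      (D : Set (X → ℂ)) fun u x => -(h : ℂ) ^ 2 * Lap u x + V x * u x)) hW hb ε) α := by
  set A : (X → ℂ) → X → ℂ := fun u x => -(h : ℂ) ^ 2 * Lap u x + V x * u x with hA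
  set T := operatorOn μ (D : Set (X → ℂ)) A with hT
  have hmem : ∀ u ∈ D, MemLp u 2 μ := fun u hu =>
    (hL.continuous u hu).memLp_of_hasCompactSupport (hL.hasCompactSupport u hu)
  have hVmem : ∀ u ∈ D, MemLp (fun x => (V x : ℂ) * u x) 2 μ := fun u hu =>
    ((Complex.continuous_ofReal.comp hV).mul (hL.continuous u hu)).memLp_of_hasCompactSupport
      ((hL.hasCompactSupport u hu).mul_left)
  have hgraph := graph_operatorOn (μ := μ) D A
    (fun u hu v hv => by
      ext x; simp only [hA, hL.map_add u hu v hv, Pi.add_apply]; ring)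
    (fun c u hu => by
      ext x; simp only [hA, hL.map_smul c u hu, Pi.smul_apply, smul_eq_mul]; ring)
    (fun u hu h0 => by
      have h1 : u = 0 := (hL.continuous u hu).ae_eq_iff_eq μ continuous_zero |>.1 h0
      have h2 : Lap 0 = 0 := by simpa using hL.map_smul 0 0 D.zero_mem
      subst h1
      refine ae_of_all _ fun x => ?_
      simp [hA, h2])
  -- a representative in `D` for each element of the domain, and the action of `T` on it
  have hrep : ∀ x : T.domain, ∃ (u : X → ℂ) (hu : u ∈ D), (x : Lp ℂ 2 μ) = (hmem u hu).toLp u ∧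
      T x = (-(h : ℂ) ^ 2) • (hL.memLp u hu).toLp (Lap u) + (hVmem u hu).toLp _ := by
    intro x
    obtain ⟨u, hu, h1, h2⟩ := (hgraph x (T x)).1 ⟨x.2, rfl⟩
    refine ⟨u, hu, ?_, ?_⟩
    · exact Lp.ext (h1.trans (hmem u hu).coeFn_toLp.symm)
    · refine Lp.ext (h2.trans ?_)
      filter_upwards [Lp.coeFn_add ((-(h : ℂ) ^ 2) • (hL.memLp u hu).toLp (Lap u))
        ((hVmem u hu).toLp _), Lp.coeFn_smul (-(h : ℂ) ^ 2) ((hL.memLp u hu).toLp (Lap u)),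
        (hL.memLp u hu).coeFn_toLp, (hVmem u hu).coeFn_toLp] with x e1 e2 e3 e4
      rw [e1, Pi.add_apply, e2, Pi.smul_apply, e3, e4, smul_eq_mul]
  have hdense : Dense (T.domain : Set (Lp ℂ 2 μ)) := by
    rw [Metric.dense_iff]
    intro f r hr
    obtain ⟨u, hu, hfu⟩ := hL.dense f (r / 2) (by positivity)
    have hAu : MemLp (A u) 2 μ := ((hL.memLp u hu).const_mul (-(h : ℂ) ^ 2)).add (hVmem u hu)
    obtain ⟨hd, -⟩ := (hgraph ((hmem u hu).toLp u) (hAu.toLp (A u))).2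
      ⟨u, hu, (hmem u hu).coeFn_toLp, hAu.coeFn_toLp⟩
    refine ⟨(hmem u hu).toLp u, ?_, hd⟩
    rw [Metric.mem_ball, dist_comm, Lp.dist_def]
    refine lt_of_le_of_lt (ENNReal.toReal_mono ENNReal.ofReal_ne_top
      (b := ENNReal.ofReal (r / 2)) ?_) (by rw [ENNReal.toReal_ofReal (by positivity)]; linarith)
    refine le_trans (le_of_eq (eLpNorm_congr_ae ?_)) hfu
    filter_upwards [(hmem u hu).coeFn_toLp] with x hx
    simp [hx]
  have hinner : ∀ (a b : X → ℂ) (ha : MemLp a 2 μ) (hb : MemLp b 2 μ),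
      ⟪ha.toLp a, hb.toLp b⟫_ℂ = ∫ x, ⟪a x, b x⟫_ℂ ∂μ := by
    intro a b ha hb
    rw [L2.inner_def]
    refine integral_congr_ae ?_
    filter_upwards [ha.coeFn_toLp, hb.coeFn_toLp] with x e1 e2
    rw [e1, e2]
  have hsym : T.IsFormalAdjoint T := by
    intro x y
    obtain ⟨u, hu, e1, e2⟩ := hrep x
    obtain ⟨v, hv, e3, e4⟩ := hrep y
    rw [e1, e2, e3, e4, inner_add_left, inner_add_right, inner_smul_left, inner_smul_right,
      hinner, hinner, hinner, hinner, hL.symm u hu v hv]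
    congr 1
    · simp
    · refine integral_congr_ae (ae_of_all _ fun x => ?_)
      simp only
      rw [← smul_eq_mul, ← smul_eq_mul, inner_smul_left, inner_smul_right, Complex.conj_ofReal]
  have hform : ∀ x : T.domain, ∃ u ∈ D, (x : Lp ℂ 2 μ) =ᵐ[μ] u ∧
      Integrable (fun y => V y * ‖(x : Lp ℂ 2 μ) y‖ ^ 2) μ ∧
      (⟪T x, (x : Lp ℂ 2 μ)⟫_ℂ).re = h ^ 2 * energy u
        + ∫ y, V y * ‖(x : Lp ℂ 2 μ) y‖ ^ 2 ∂μ := by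
    intro x
    obtain ⟨u, hu, e1, e2⟩ := hrep x
    have hx : (x : Lp ℂ 2 μ) =ᵐ[μ] u := by rw [e1]; exact (hmem u hu).coeFn_toLp
    have hVx : ((hVmem u hu).toLp _ : Lp ℂ 2 μ) =ᵐ[μ] fun y => (V y : ℂ) * (x : Lp ℂ 2 μ) y := by
      filter_upwards [hx, (hVmem u hu).coeFn_toLp] with y h1 h2
      rw [h1, h2]
    refine ⟨u, hu, hx, integrable_mul_norm_sq hVx, ?_⟩
    rw [e2, inner_add_left, Complex.add_re, re_inner_toLp_mul_self hVx, inner_smul_left, e1, hinner]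
    congr 1
    have e : (starRingEnd ℂ) (-(h : ℂ) ^ 2) = ((-h ^ 2 : ℝ) : ℂ) := by
      simp
    rw [e, Complex.re_ofReal_mul, hL.energy_eq u hu]
    ring
  refine isClosed_and_hasDiscreteSpectrumBelow hdense hsym _
    (re_inner_mulOperator_perturbation μ hW hb ε) α fun β hβ => ?_
  obtain ⟨k, hkc, ⟨Ck, hCk⟩, hkV, hkcomp⟩ := hk β hβ
  have hkm : MemLp (fun x => (k x : ℂ)) ∞ μ :=
    memLp_top_of_bound (Complex.continuous_ofReal.comp hkc).measurable.aestronglyMeasurable Ck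
      (ae_of_all _ fun x => by simpa using hCk x)
  set K := mulOperator μ _ hkm with hK
  have hKf : ∀ f : Lp ℂ 2 μ, K f =ᵐ[μ] fun x => (k x : ℂ) * f x := mulOperator_coeFn _ hkm
  have hsqint : ∀ f : Lp ℂ 2 μ, Integrable (fun y => ‖f y‖ ^ 2) μ := fun f => by
    simpa using integrable_mul_norm_sq (μ := μ) (a := fun _ => 1) (f := f) (g := f) (by simp)
  have hlow : ∀ x : T.domain, h ^ 2 * 0 + β * ‖(x : Lp ℂ 2 μ)‖ ^ 2
      ≤ (⟪T x + K x, (x : Lp ℂ 2 μ)⟫_ℂ).re := by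
    intro x
    obtain ⟨u, hu, e1, e2, e3⟩ := hform x
    rw [inner_add_left, Complex.add_re, e3, re_inner_toLp_mul_self (hKf x), add_assoc,
      ← integral_add e2 (integrable_mul_norm_sq (hKf x))]
    refine add_le_add (mul_le_mul_of_nonneg_left (hL.energy_nonneg u hu) (by positivity)) ?_
    rw [← integral_norm_sq_eq, ← integral_const_mul]
    refine integral_mono ((hsqint _).const_mul _)
      (e2.add (integrable_mul_norm_sq (hKf x))) fun y => ?_
    change β * _ ≤ V y * _ + k y * _
    rw [← add_mul]
    exact mul_le_mul_of_nonneg_right (hkV y) (by positivity)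
  refine ⟨K, fun x => by simpa only [mul_zero, zero_add] using hlow x, fun C => ?_⟩
  -- bounds in the form norm of `T` are bounds on the energy
  set m : ℝ := |β| + |Ck| with hm
  have hVlow : ∀ x, -m ≤ V x := fun x => by
    have h1 := hkV x
    have h2 := (abs_le.1 (hCk x)).2
    have h3 := neg_abs_le β
    have h4 := le_abs_self Ck
    linarith
  set C' : ℝ := max (C ^ 2) ((C + m * C ^ 2) / h ^ 2) with hC'
  refine Metric.totallyBounded_of_finite_discretization fun δ hδ => ?_
  obtain ⟨ι, hι, c, hc⟩ := hkcomp C' ((δ / 2) ^ 2) (by positivity)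
  have hrep' : ∀ y : {y | ∃ u : T.domain, ‖(u : Lp ℂ 2 μ)‖ ≤ C ∧
      (⟪T u, (u : Lp ℂ 2 μ)⟫_ℂ).re ≤ C ∧ K u = y}, ∃ u ∈ D,
      (∫⁻ x, ‖u x‖ₑ ^ 2 ∂μ ≤ ENNReal.ofReal C' ∧ energy u ≤ C') ∧
      (y : Lp ℂ 2 μ) =ᵐ[μ] fun x => (k x : ℂ) * u x := by
    rintro ⟨y, x, hx1, hx2, rfl⟩
    obtain ⟨u, hu, e1, e2, e3⟩ := hform x
    have hC0 : 0 ≤ C := (norm_nonneg _).trans hx1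
    have hsq : ‖(x : Lp ℂ 2 μ)‖ ^ 2 ≤ C ^ 2 := by gcongr
    refine ⟨u, hu, ⟨?_, ?_⟩, ?_⟩
    · have : ∫⁻ y, ‖u y‖ₑ ^ 2 ∂μ = ∫⁻ y, ‖(x : Lp ℂ 2 μ) y‖ₑ ^ 2 ∂μ :=
        lintegral_congr_ae (by filter_upwards [e1] with y hy; rw [hy])
      rw [this, lintegral_enorm_sq_eq]
      exact ENNReal.ofReal_le_ofReal (hsq.trans (le_max_left _ _))
    · refine le_trans ?_ (le_max_right _ _)
      rw [le_div_iff₀ (by positivity)]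
      have h1 : -m * ‖(x : Lp ℂ 2 μ)‖ ^ 2 ≤ ∫ y, V y * ‖(x : Lp ℂ 2 μ) y‖ ^ 2 ∂μ := by
        rw [← integral_norm_sq_eq, ← integral_const_mul]
        exact integral_mono ((hsqint _).const_mul _) e2 fun y =>
          mul_le_mul_of_nonneg_right (hVlow y) (by positivity)
      have hm0 : 0 ≤ m := by positivity
      nlinarith
    · filter_upwards [hKf x, e1] with y h1 h2
      rw [h1, h2]
  choose F hFD hFb hFe using hrep'
  have : Fintype ι := Fintype.ofFinite ι
  refine ⟨ULift ι, inferInstance, fun y => ⟨c (F y)⟩, fun y z hyz => ?_⟩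
  have h1 := hc (F y) (hFD y) (F z) (hFD z) (hFb y).1 (hFb y).2 (hFb z).1 (hFb z).2
    (ULift.up_injective hyz)
  have h2 : ∫⁻ x, ‖((y : Lp ℂ 2 μ) - z) x‖ₑ ^ 2 ∂μ ≤ ENNReal.ofReal ((δ / 2) ^ 2) := by
    refine le_trans (le_of_eq (lintegral_congr_ae ?_)) h1
    filter_upwards [Lp.coeFn_sub (y : Lp ℂ 2 μ) z, hFe y, hFe z] with x e1 e2 e3
    rw [e1, Pi.sub_apply, e2, e3, mul_sub]
  rw [lintegral_enorm_sq_eq, ENNReal.ofReal_le_ofReal_iff (by positivity)] at h2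
  have h3 := abs_le_of_sq_le_sq h2 (by positivity)
  rw [abs_of_nonneg (norm_nonneg _)] at h3
  rw [dist_eq_norm]
  linarith

end AbstractSchrodinger

/-! ### From Green's formula to Dirichlet Laplacians -/

section Green

variable {X : Type*} [TopologicalSpace X] [MeasurableSpace X] [BorelSpace X]

/-- Complex conjugation of functions. -/
noncomputable def conjFun {X : Type*} (u : X → ℂ) (x : X) : ℂ := starRingEnd ℂ (u x)

omit [BorelSpace X] in
/-- A real operator `Lap` is a Dirichlet Laplacian if Green's formula
`∫ Lap u · v = - ∫ Γ(u, v)` holds with a symmetric pairing `Γ` that is positive on the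
diagonal `(ū, u)`. -/
theorem IsDirichletLaplacian.of_green {μ : Measure X} {D : Submodule ℂ (X → ℂ)}
    {Lap : (X → ℂ) → X → ℂ} {Γ : (X → ℂ) → (X → ℂ) → X → ℂ} {e : (X → ℂ) → X → ℝ}
    (continuous : ∀ u ∈ D, Continuous u) (hasCompactSupport : ∀ u ∈ D, HasCompactSupport u)
    (map_add : ∀ u ∈ D, ∀ v ∈ D, Lap (u + v) = Lap u + Lap v)
    (map_smul : ∀ (c : ℂ), ∀ u ∈ D, Lap (c • u) = c • Lap u)
    (memLp : ∀ u ∈ D, MemLp (Lap u) 2 μ)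
    (dense : ∀ f : Lp ℂ 2 μ, ∀ ε > 0, ∃ u ∈ D, eLpNorm (⇑f - u) 2 μ ≤ ENNReal.ofReal ε)
    (conj_mem : ∀ u ∈ D, conjFun u ∈ D) (map_conj : ∀ u ∈ D, Lap (conjFun u) = conjFun (Lap u))
    (hΓ : ∀ u ∈ D, ∀ v ∈ D, ∀ x, Γ u v x = Γ v u x)
    (he : ∀ u ∈ D, ∀ x, Γ (conjFun u) u x = e u x) (he0 : ∀ u ∈ D, ∀ x, 0 ≤ e u x)
    (green : ∀ u ∈ D, ∀ v ∈ D, ∫ x, Lap u x * v x ∂μ = -∫ x, Γ u v x ∂μ) :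
    IsDirichletLaplacian μ D Lap fun u => ∫ x, e u x ∂μ where
  continuous := continuous
  hasCompactSupport := hasCompactSupport
  map_add := map_add
  map_smul := map_smul
  memLp := memLp
  dense := dense
  symm u hu v hv := by
    have h1 : ∀ x, ⟪Lap u x, v x⟫_ℂ = Lap (conjFun u) x * v x := fun x => by
      rw [map_conj u hu, RCLike.inner_apply']; rfl
    have h2 : ∀ x, ⟪u x, Lap v x⟫_ℂ = Lap v x * conjFun u x := fun x => by
      rw [RCLike.inner_apply]; rfl
    simp only [h1, h2]
    rw [green _ (conj_mem u hu) v hv, green v hv _ (conj_mem u hu)]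
    simp only [hΓ v hv _ (conj_mem u hu)]
  energy_nonneg u hu := integral_nonneg (he0 u hu)
  energy_eq u hu := by
    have h1 : ∀ x, ⟪Lap u x, u x⟫_ℂ = Lap (conjFun u) x * u x := fun x => by
      rw [map_conj u hu, RCLike.inner_apply']; rfl
    simp only [h1]
    rw [green _ (conj_mem u hu) u hu]
    simp only [he u hu]
    rw [integral_complex_ofReal, Complex.neg_re, Complex.ofReal_re]

end Green

/-! ### Partial derivatives -/

section PartialDeriv

variable {n : ℕ}

theorem partialDeriv_conjFun (i : Fin n) (f : EuclideanSpace ℝ (Fin n) → ℂ) :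
    partialDeriv i (conjFun f) = conjFun (partialDeriv i f) := by
  ext y
  have h : conjFun f = Complex.conjCLE ∘ f := rfl
  rw [partialDeriv, h, ContinuousLinearEquiv.comp_fderiv]
  rfl

theorem partialDeriv_add {i : Fin n} {f g : EuclideanSpace ℝ (Fin n) → ℂ}
    {y : EuclideanSpace ℝ (Fin n)} (hf : DifferentiableAt ℝ f y) (hg : DifferentiableAt ℝ g y) :
    partialDeriv i (fun y => f y + g y) y = partialDeriv i f y + partialDeriv i g y := by
  rw [partialDeriv, fderiv_fun_add hf hg]; rfl

theorem partialDeriv_const_mul {i : Fin n} {f : EuclideanSpace ℝ (Fin n) → ℂ}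
    {y : EuclideanSpace ℝ (Fin n)} (c : ℂ) (hf : DifferentiableAt ℝ f y) :
    partialDeriv i (fun y => c * f y) y = c * partialDeriv i f y := by
  rw [partialDeriv, fderiv_const_mul hf]; rfl

theorem partialDeriv_congr {i : Fin n} {f g : EuclideanSpace ℝ (Fin n) → ℂ}
    {y : EuclideanSpace ℝ (Fin n)} (h : f =ᶠ[𝓝 y] g) : partialDeriv i f y = partialDeriv i g y := by
  rw [partialDeriv, h.fderiv_eq]; rfl

theorem ContDiffOn.partialDeriv {U : Set (EuclideanSpace ℝ (Fin n))} (hU : IsOpen U)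
    {f : EuclideanSpace ℝ (Fin n) → ℂ} {m k : ℕ∞} (hf : ContDiffOn ℝ m f U) (hk : k + 1 ≤ m)
    (i : Fin n) : ContDiffOn ℝ k (partialDeriv i f) U := by
  have h : ContDiffOn ℝ k (fderiv ℝ f) U :=
    hf.fderiv_of_isOpen hU (by exact_mod_cast hk)
  exact h.clm_apply contDiffOn_const

theorem ContDiff.partialDeriv {f : EuclideanSpace ℝ (Fin n) → ℂ} (hf : ContDiff ℝ ∞ f)
    (i : Fin n) : ContDiff ℝ ∞ (partialDeriv i f) := by
  rw [← contDiffOn_univ] at hf ⊢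
  exact hf.partialDeriv isOpen_univ (m := ⊤) (k := ⊤) (by simp) i

theorem HasCompactSupport.partialDeriv {f : EuclideanSpace ℝ (Fin n) → ℂ}
    (hf : HasCompactSupport f) (i : Fin n) : HasCompactSupport (partialDeriv i f) :=
  hf.fderiv_apply ℝ _

theorem partialDeriv_of_notMem_tsupport {f : EuclideanSpace ℝ (Fin n) → ℂ} (i : Fin n)
    {y : EuclideanSpace ℝ (Fin n)} (hy : y ∉ tsupport f) : _root_.partialDeriv i f y = 0 := by
  rw [_root_.partialDeriv, fderiv_of_notMem_tsupport _ hy]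
  rfl

/-- A product of a function that is continuous on an open set and of a continuous function
compactly supported in that set is integrable. -/
theorem integrable_mul_of_tsupport_subset {V : Type*} [TopologicalSpace V] [MeasurableSpace V]
    [BorelSpace V] {μ : Measure V} [IsFiniteMeasureOnCompacts μ]
    {U : Set V} (hU : IsOpen U) {f g : V → ℂ} (hf : ContinuousOn f U) (hg : Continuous g)
    (hgc : HasCompactSupport g) (hgU : tsupport g ⊆ U) : Integrable (fun x => f x * g x) μ := by
  refine Continuous.integrable_of_hasCompactSupport ?_ hgc.mul_left
  refine continuous_of_tsupport fun x hx => ?_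
  have hxU : x ∈ U := hgU (tsupport_mul_subset_right hx)
  exact (hf.continuousAt (hU.mem_nhds hxU)).mul hg.continuousAt

/-- Integration by parts on an open set `U`, against functions compactly supported in `U`. -/
theorem integral_partialDeriv_mul {U : Set (EuclideanSpace ℝ (Fin n))} (hU : IsOpen U)
    {f g : EuclideanSpace ℝ (Fin n) → ℂ} (hf : ContDiffOn ℝ 1 f U) (hg : ContDiff ℝ 1 g)
    (hgc : HasCompactSupport g) (hgU : tsupport g ⊆ U) (i : Fin n) :
    ∫ y, _root_.partialDeriv i f y * g y = -∫ y, f y * _root_.partialDeriv i g y := by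
  have hgi : Continuous (_root_.partialDeriv i g) :=
    (hg.continuous_fderiv one_ne_zero).clm_apply continuous_const
  have hfi : ContinuousOn (_root_.partialDeriv i f) U :=
    (hf.continuousOn_fderiv_of_isOpen hU le_rfl).clm_apply continuousOn_const
  have hgi' : tsupport (_root_.partialDeriv i g) ⊆ U :=
    (closure_minimal (fun y hy => by
      by_contra h
      exact hy (partialDeriv_of_notMem_tsupport i h)) (isClosed_tsupport g)).trans hgU
  have := integral_mul_fderiv_eq_neg_fderiv_mul_of_integrable (μ := volume)
    (f := f) (g := g) (v := EuclideanSpace.single i (1 : ℝ))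
    (integrable_mul_of_tsupport_subset hU hfi hg.continuous hgc hgU)
    (integrable_mul_of_tsupport_subset hU hf.continuousOn hgi (hgc.partialDeriv i) hgi')
    (integrable_mul_of_tsupport_subset hU hf.continuousOn hg.continuous hgc hgU)
    (fun y hy => (hf.differentiableOn one_ne_zero).differentiableAt (hU.mem_nhds (hgU hy)))
    (fun y _ => hg.differentiable one_ne_zero y)
  simp only [_root_.partialDeriv] at *
  rw [this, neg_neg]

theorem enorm_sq_le_sum_enorm_apply_sq (L : EuclideanSpace ℝ (Fin n) →L[ℝ] ℂ) :
    ‖L‖ₑ ^ 2 ≤ ∑ i, ‖L (EuclideanSpace.single i 1)‖ₑ ^ 2 := by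
  have h : ‖L‖ ≤ √(∑ i, ‖L (EuclideanSpace.single i 1)‖ ^ 2) := by
    refine L.opNorm_le_bound (by positivity) fun x => ?_
    have hx : L x = ∑ i, x i • L (EuclideanSpace.single i 1) := by
      conv_lhs => rw [← (EuclideanSpace.basisFun (Fin n) ℝ).sum_repr x]
      simp
    rw [hx, EuclideanSpace.norm_eq, mul_comm, ← Real.sqrt_mul (by positivity)]
    refine (norm_sum_le _ _).trans (Real.le_sqrt_of_sq_le ?_)
    simp only [norm_smul]
    exact Finset.sum_mul_sq_le_sq_mul_sq _ _ _
  have h2 : ‖L‖ ^ 2 ≤ ∑ i, ‖L (EuclideanSpace.single i 1)‖ ^ 2 := by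
    calc ‖L‖ ^ 2 ≤ √(∑ i, ‖L (EuclideanSpace.single i 1)‖ ^ 2) ^ 2 := by gcongr
      _ = _ := Real.sq_sqrt (by positivity)
  have h3 := ENNReal.ofReal_le_ofReal h2
  rw [ENNReal.ofReal_sum_of_nonneg fun i _ => by positivity] at h3
  simpa [ENNReal.ofReal_pow] using h3

/-- The derivative of a product, at a point where the first factor is under control in `C¹`. -/
theorem enorm_fderiv_mul_sq_le {V : Type*} [NormedAddCommGroup V] [NormedSpace ℝ V]
    {χ f : V → ℂ} {y : V} {a : ℝ≥0∞} (hχ : DifferentiableAt ℝ χ y) (hf : DifferentiableAt ℝ f y)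
    (h1 : ‖χ y‖ₑ ≤ a) (h2 : ‖fderiv ℝ χ y‖ₑ ≤ a) :
    ‖fderiv ℝ (fun y => χ y * f y) y‖ₑ ^ 2 ≤ 4 * a ^ 2 * (‖fderiv ℝ f y‖ₑ ^ 2 + ‖f y‖ₑ ^ 2) := by
  rw [fderiv_fun_mul hχ hf]
  calc ‖χ y • fderiv ℝ f y + f y • fderiv ℝ χ y‖ₑ ^ 2
      ≤ (a * ‖fderiv ℝ f y‖ₑ + a * ‖f y‖ₑ) ^ 2 := by
        gcongr
        refine (enorm_add_le (χ y • fderiv ℝ f y) (f y • fderiv ℝ χ y)).trans ?_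
        rw [enorm_smul, enorm_smul, mul_comm a ‖f y‖ₑ]
        gcongr
    _ ≤ 4 * ((a * ‖fderiv ℝ f y‖ₑ) ^ 2 + (a * ‖f y‖ₑ) ^ 2) := ENNReal.add_sq_le_four _ _
    _ = _ := by ring

end PartialDeriv

/-! ### Schrödinger operators on Euclidean space -/

section Euclidean

variable {n : ℕ}

theorem laplacian_eq_sum_partialDeriv {u : EuclideanSpace ℝ (Fin n) → ℂ} (hu : ContDiff ℝ ∞ u)
    (x : EuclideanSpace ℝ (Fin n)) : Δ u x = ∑ i, partialDeriv i (partialDeriv i u) x := by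
  rw [InnerProductSpace.laplacian_eq_iteratedFDeriv_orthonormalBasis u
    (EuclideanSpace.basisFun (Fin n) ℝ)]
  refine Finset.sum_congr rfl fun i _ => ?_
  rw [iteratedFDeriv_two_apply]
  have h : DifferentiableAt ℝ (fderiv ℝ u) x :=
    (hu.fderiv_right (m := ∞) (by simp)).differentiable (by simp) x
  have e : partialDeriv i u = fun y => fderiv ℝ u y (EuclideanSpace.single i 1) := rfl
  rw [e, partialDeriv, fderiv_clm_apply h (differentiableAt_const _)]
  simp

/-- The smooth compactly supported functions on `ℝⁿ`, as a subspace. -/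
def euclideanTestFunctions (n : ℕ) : Submodule ℂ (EuclideanSpace ℝ (Fin n) → ℂ) where
  carrier := {u | ContDiff ℝ ∞ u ∧ HasCompactSupport u}
  add_mem' hu hv := ⟨hu.1.add hv.1, hu.2.add hv.2⟩
  zero_mem' := ⟨contDiff_const, HasCompactSupport.zero⟩
  smul_mem' _ _ hu := ⟨contDiff_const.smul hu.1, hu.2.smul_left⟩

/-- The Laplacian of `ℝⁿ`, with the energy `∫ |∇u|²`. -/
theorem isDirichletLaplacian_euclidean (n : ℕ) :
    IsDirichletLaplacian volume (euclideanTestFunctions n) (fun u => Δ u)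
      fun u => ∫ x, ∑ i, ‖partialDeriv i u x‖ ^ 2 := by
  have hsum : ∀ u ∈ euclideanTestFunctions n,
      (Δ u : EuclideanSpace ℝ (Fin n) → ℂ) = fun x => ∑ i, partialDeriv i (partialDeriv i u) x :=
    fun u hu => funext fun x => laplacian_eq_sum_partialDeriv hu.1 x
  refine IsDirichletLaplacian.of_green
    (Γ := fun u v x => ∑ i, partialDeriv i u x * partialDeriv i v x)
    (fun u hu => hu.1.continuous) (fun u hu => hu.2) ?_ ?_ ?_ ?_ ?_ ?_ ?_ ?_ ?_ ?_
  · intro u hu v hv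
    ext x
    exact ContDiffAt.laplacian_add
      (hu.1.contDiffAt.of_le (WithTop.coe_le_coe.2 (le_top : (2 : ℕ∞) ≤ ⊤)))
      (hv.1.contDiffAt.of_le (WithTop.coe_le_coe.2 (le_top : (2 : ℕ∞) ≤ ⊤)))
  · intro c u hu
    ext x
    rw [hsum _ (Submodule.smul_mem _ c hu), hsum u hu]
    simp only [Pi.smul_apply, smul_eq_mul, Finset.mul_sum]
    refine Finset.sum_congr rfl fun i _ => ?_
    have h1 : partialDeriv i (c • u) = fun y => c * partialDeriv i u y := by
      ext y
      exact partialDeriv_const_mul c (hu.1.differentiable (by simp) y)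
    rw [h1, partialDeriv_const_mul c ((hu.1.partialDeriv i).differentiable (by simp) x)]
  · intro u hu
    have hc : Continuous (Δ u) := by
      rw [hsum u hu]
      exact continuous_finsetSum _ fun i _ => ((hu.1.partialDeriv i).partialDeriv i).continuous
    refine hc.memLp_of_hasCompactSupport (HasCompactSupport.of_support_subset_isCompact hu.2 ?_)
    intro x hx
    by_contra h
    refine hx ?_
    rw [hsum u hu]
    refine Finset.sum_eq_zero fun i _ => partialDeriv_of_notMem_tsupport i fun h' => h ?_
    refine closure_minimal (fun y hy => ?_) (isClosed_tsupport u) h'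
    by_contra h''
    exact hy (partialDeriv_of_notMem_tsupport i h'')
  · intro f ε hε
    obtain ⟨g, hg1, hg2, hg3⟩ := (Lp.memLp f).exist_eLpNorm_sub_le (by simp) (by simp) hε
    exact ⟨g, ⟨hg2, hg1⟩, hg3⟩
  · intro u hu
    exact ⟨Complex.conjCLE.contDiff.comp hu.1, hu.2.comp_left (map_zero _)⟩
  · intro u hu
    have hu' : conjFun u ∈ euclideanTestFunctions n :=
      ⟨Complex.conjCLE.contDiff.comp hu.1, hu.2.comp_left (map_zero _)⟩
    ext x
    rw [hsum _ hu', hsum u hu]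
    simp only [partialDeriv_conjFun, conjFun, map_sum]
  · intro u hu v hv x
    simp only [mul_comm]
  · intro u hu x
    simp only [partialDeriv_conjFun, conjFun, Complex.conj_mul']
    push_cast
    rfl
  · intro u hu x
    positivity
  · intro u hu v hv
    have hv1 : ContDiff ℝ 1 v := hv.1.of_le (by exact_mod_cast le_top)
    have hint : ∀ i, Integrable fun x => partialDeriv i (partialDeriv i u) x * v x := fun i =>
      integrable_mul_of_tsupport_subset isOpen_univ
        ((hu.1.partialDeriv i).partialDeriv i).continuous.continuousOn hv1.continuous hv.2
        (Set.subset_univ _)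
    have hint2 : ∀ i, Integrable fun x => partialDeriv i u x * partialDeriv i v x := fun i =>
      integrable_mul_of_tsupport_subset isOpen_univ
        (hu.1.partialDeriv i).continuous.continuousOn (hv.1.partialDeriv i).continuous
        (hv.2.partialDeriv i) (Set.subset_univ _)
    rw [integral_finsetSum _ fun i _ => hint2 i, ← Finset.sum_neg_distrib]
    simp only [hsum u hu, Finset.sum_mul]
    rw [integral_finsetSum _ fun i _ => hint i]
    refine Finset.sum_congr rfl fun i _ => ?_
    exact integral_partialDeriv_mul isOpen_univ
      ((hu.1.partialDeriv i).of_le (by exact_mod_cast le_top)).contDiffOn hv1 hv.2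
      (Set.subset_univ _) i

/-- Rellich's theorem: functions bounded in `H¹(ℝⁿ)` become bounded in `H¹` of the support of `k`
after multiplication by `k`. -/
theorem isFormCompactMultiplier_euclidean {k : EuclideanSpace ℝ (Fin n) → ℝ}
    (hk : ContDiff ℝ ∞ k) (hkc : HasCompactSupport k) :
    IsFormCompactMultiplier volume (euclideanTestFunctions n)
      (fun u => ∫ x, ∑ i, ‖partialDeriv i u x‖ ^ 2) k := by
  intro C δ hδ
  set χ : EuclideanSpace ℝ (Fin n) → ℂ := fun x => (k x : ℂ) with hχ
  have hχs : ContDiff ℝ ∞ χ := Complex.ofRealCLM.contDiff.comp hk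
  have hχc : HasCompactSupport χ := hkc.comp_left Complex.ofReal_zero
  obtain ⟨a1, ha1⟩ := hχc.exists_bound_of_continuous hχs.continuous
  obtain ⟨a2, ha2⟩ := (hχc.fderiv ℝ).exists_bound_of_continuous
    (hχs.continuous_fderiv (by simp))
  set a : ℝ≥0∞ := ENNReal.ofReal (max a1 a2) with ha
  have hb1 : ∀ x, ‖χ x‖ₑ ≤ a := fun x => by
    rw [← ofReal_norm]; exact ENNReal.ofReal_le_ofReal ((ha1 x).trans (le_max_left _ _))
  have hb2 : ∀ x, ‖fderiv ℝ χ x‖ₑ ≤ a := fun x => by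
    rw [← ofReal_norm]; exact ENNReal.ofReal_le_ofReal ((ha2 x).trans (le_max_right _ _))
  set C' : ℝ≥0∞ := 4 * a ^ 2 * (ENNReal.ofReal C + ENNReal.ofReal C) with hC'
  have hC't : C' ≠ ⊤ := by
    refine ENNReal.mul_ne_top (ENNReal.mul_ne_top (by norm_num) (by simp [ha])) (by simp)
  obtain ⟨ι, hι, c, hc⟩ := exists_finite_coloring_h1Ball (μ := volume) (K := tsupport χ) hχc hC't
    (ε := ENNReal.ofReal δ) (by simpa using hδ)
  have key : ∀ u ∈ euclideanTestFunctions n, ∫⁻ x, ‖u x‖ₑ ^ 2 ≤ ENNReal.ofReal C →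
      ∫ x, ∑ i, ‖partialDeriv i u x‖ ^ 2 ≤ C →
      (fun x => χ x * u x) ∈ h1Ball volume (tsupport χ) C' := by
    intro u hu h1 h2
    have hu1 : ContDiff ℝ 1 u := hu.1.of_le (by exact_mod_cast le_top)
    have hχ1 : ContDiff ℝ 1 χ := hχs.of_le (by exact_mod_cast le_top)
    have hm : Measurable fun x => ‖fderiv ℝ u x‖ₑ ^ 2 :=
      ((hu1.continuous_fderiv one_ne_zero).enorm.measurable).pow_const 2
    have hgrad : ∫⁻ x, ‖fderiv ℝ u x‖ₑ ^ 2 ≤ ENNReal.ofReal C := by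
      have hint : Integrable fun x => ∑ i, ‖partialDeriv i u x‖ ^ 2 := by
        refine integrable_finsetSum _ fun i _ => ?_
        refine Continuous.integrable_of_hasCompactSupport
          ((hu.1.partialDeriv i).continuous.norm.pow 2) ?_
        exact (hu.2.partialDeriv i).comp_left (g := fun z => ‖z‖ ^ 2) (by simp)
      calc ∫⁻ x, ‖fderiv ℝ u x‖ₑ ^ 2
          ≤ ∫⁻ x, ENNReal.ofReal (∑ i, ‖partialDeriv i u x‖ ^ 2) := by
            refine lintegral_mono fun x => (enorm_sq_le_sum_enorm_apply_sq _).trans (le_of_eq ?_)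
            rw [ENNReal.ofReal_sum_of_nonneg fun i _ => by positivity]
            refine Finset.sum_congr rfl fun i _ => ?_
            rw [ENNReal.ofReal_pow (norm_nonneg _), ofReal_norm]
            rfl
        _ = ENNReal.ofReal (∫ x, ∑ i, ‖partialDeriv i u x‖ ^ 2) :=
            (ofReal_integral_eq_lintegral_ofReal hint
              (ae_of_all _ fun x => Finset.sum_nonneg fun i _ => by positivity)).symm
        _ ≤ ENNReal.ofReal C := ENNReal.ofReal_le_ofReal h2
    refine ⟨hχ1.mul hu1, fun x hx => ?_, ?_, ?_⟩
    · refine subset_tsupport _ fun h => hx ?_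
      simp only [h, zero_mul]
    · calc ∫⁻ x, ‖χ x * u x‖ₑ ^ 2 ≤ ∫⁻ x, a ^ 2 * ‖u x‖ₑ ^ 2 := by
            refine lintegral_mono fun x => ?_
            rw [enorm_mul, mul_pow]
            gcongr
            exact hb1 x
        _ = a ^ 2 * ∫⁻ x, ‖u x‖ₑ ^ 2 := lintegral_const_mul' _ _ (by simp [ha])
        _ ≤ a ^ 2 * ENNReal.ofReal C := by gcongr
        _ ≤ C' := by
            rw [hC']
            gcongr
            · exact le_mul_of_one_le_left zero_le (by norm_num)
            · exact le_self_add
    · calc ∫⁻ x, ‖fderiv ℝ (fun x => χ x * u x) x‖ₑ ^ 2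
          ≤ ∫⁻ x, 4 * a ^ 2 * (‖fderiv ℝ u x‖ₑ ^ 2 + ‖u x‖ₑ ^ 2) :=
            lintegral_mono fun x => enorm_fderiv_mul_sq_le (hχ1.differentiable one_ne_zero x)
              (hu1.differentiable one_ne_zero x) (hb1 x) (hb2 x)
        _ = 4 * a ^ 2 * ((∫⁻ x, ‖fderiv ℝ u x‖ₑ ^ 2) + ∫⁻ x, ‖u x‖ₑ ^ 2) := by
            rw [lintegral_const_mul' _ _ (ENNReal.mul_ne_top (by norm_num) (by simp [ha])),
              lintegral_add_left hm]
        _ ≤ C' := by rw [hC']; gcongr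
  refine ⟨ι, hι, fun u => c fun x => χ x * u x, fun u hu v hv h1 h2 h3 h4 h5 => ?_⟩
  have := hc _ (key u hu h1 h2) _ (key v hv h3 h4) h5
  simpa only [mul_sub] using this

theorem euclideanSchrodinger_perturbed (h : ℝ) (hh : 0 < h) (ε : ℝ)
    (V W : EuclideanSpace ℝ (Fin n) → ℝ) (hV : ContDiff ℝ ∞ V) (hW : Continuous W)
    (hb : ∃ C : ℝ, ∀ x, |W x| ≤ C) :
    (⊥ < liminf (fun x => (V x : EReal)) (cocompact (EuclideanSpace ℝ (Fin n))) →
      (perturbedOperator volume (euclideanSchrodinger n h V) hW hb ε).IsClosed) ∧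
    HasDiscreteSpectrumBelow (perturbedOperator volume (euclideanSchrodinger n h V) hW hb ε)
      (liminf (fun x => (V x : EReal)) (cocompact (EuclideanSpace ℝ (Fin n)))) := by
  refine isClosed_and_hasDiscreteSpectrumBelow_perturbedOperator (isDirichletLaplacian_euclidean n)
    hV.continuous hW hb h ε hh _ fun β hβ => ?_
  -- add a smooth compactly supported potential where `V` is below `β`
  have h1 := eventually_lt_of_lt_liminf hβ
  obtain ⟨t, ht, htV⟩ := mem_cocompact.1 h1
  obtain ⟨R, htR⟩ := ht.isBounded.subset_closedBall (0 : EuclideanSpace ℝ (Fin n))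
  have hR : ∀ x, x ∉ Metric.closedBall (0 : EuclideanSpace ℝ (Fin n)) R → (β : EReal) < V x :=
    fun x hx => htV fun h => hx (htR h)
  obtain ⟨m, hm⟩ := (isCompact_closedBall (0 : EuclideanSpace ℝ (Fin n)) R).bddBelow_image
    hV.continuous.continuousOn
  let φ : ContDiffBump (0 : EuclideanSpace ℝ (Fin n)) :=
    ⟨max R 0 + 1, max R 0 + 2, by positivity, by linarith⟩
  set b : ℝ := max (β - m) 0
  have hφ : ContDiff ℝ ∞ φ := φ.contDiff
  refine ⟨fun x => b * φ x, continuous_const.mul hφ.continuous, ⟨b, fun x => ?_⟩, fun x => ?_,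
    isFormCompactMultiplier_euclidean (contDiff_const.mul hφ) φ.hasCompactSupport.mul_left⟩
  · rw [abs_of_nonneg (mul_nonneg (le_max_right _ _) φ.nonneg)]
    exact mul_le_of_le_one_right (le_max_right _ _) φ.le_one
  · by_cases hx : x ∈ Metric.closedBall (0 : EuclideanSpace ℝ (Fin n)) R
    · change β ≤ V x + b * φ x
      have e1 : φ x = 1 := φ.one_of_mem_closedBall
        (Metric.closedBall_subset_closedBall (by
          change R ≤ max R 0 + 1
          linarith [le_max_left R 0]) hx)
      have e2 : m ≤ V x := hm ⟨x, hx, rfl⟩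
      rw [e1, mul_one]
      linarith [le_max_left (β - m) 0]
    · have e1 : β < V x := by exact_mod_cast hR x hx
      have e2 : 0 ≤ b * φ x := mul_nonneg (le_max_right _ _) φ.nonneg
      linarith

end Euclidean

/-! ### Changes of coordinates -/

section CoordChange

variable {n : ℕ} {M : Type*} [TopologicalSpace M] [ChartedSpace (EuclideanSpace ℝ (Fin n)) M]

/-- The coordinate change from the chart at `x` to the chart at `x'`. -/
noncomputable def coordChange (x x' : M) :
    EuclideanSpace ℝ (Fin n) → EuclideanSpace ℝ (Fin n) :=
  extChartAt (𝓡 n) x' ∘ (extChartAt (𝓡 n) x).symm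

/-- The domain of the coordinate change from the chart at `x` to the chart at `x'`. -/
def chartOverlap (x x' : M) : Set (EuclideanSpace ℝ (Fin n)) :=
  (extChartAt (𝓡 n) x).target ∩ (extChartAt (𝓡 n) x).symm ⁻¹' (extChartAt (𝓡 n) x').source

theorem isOpen_chartOverlap (x x' : M) : IsOpen (chartOverlap (n := n) x x') :=
  (continuousOn_extChartAt_symm x).isOpen_inter_preimage (isOpen_extChartAt_target x)
    (isOpen_extChartAt_source x')

theorem extChartAt_symm_coordChange {x x' : M} {y : EuclideanSpace ℝ (Fin n)}
    (hy : y ∈ chartOverlap x x') :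
    (extChartAt (𝓡 n) x').symm (coordChange x x' y) = (extChartAt (𝓡 n) x).symm y :=
  (extChartAt (𝓡 n) x').left_inv hy.2

theorem coordChange_mem_target {x x' : M} {y : EuclideanSpace ℝ (Fin n)}
    (hy : y ∈ chartOverlap x x') : coordChange x x' y ∈ (extChartAt (𝓡 n) x').target :=
  (extChartAt (𝓡 n) x').map_source hy.2

theorem mem_chartOverlap_of_mem_source {x x' p : M} (h : p ∈ (extChartAt (𝓡 n) x).source)
    (h' : p ∈ (extChartAt (𝓡 n) x').source) : extChartAt (𝓡 n) x p ∈ chartOverlap x x' :=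
  ⟨(extChartAt (𝓡 n) x).map_source h, by
    rwa [Set.mem_preimage, (extChartAt (𝓡 n) x).left_inv h]⟩

theorem coordChange_extChartAt {x x' p : M} (h : p ∈ (extChartAt (𝓡 n) x).source) :
    coordChange x x' (extChartAt (𝓡 n) x p) = extChartAt (𝓡 n) x' p := by
  rw [coordChange, Function.comp_apply, (extChartAt (𝓡 n) x).left_inv h]

/-- The Jacobian matrix of a coordinate change. -/
noncomputable def coordJacobian (x x' : M) (y : EuclideanSpace ℝ (Fin n)) :
    Matrix (Fin n) (Fin n) ℝ :=
  Matrix.of fun k i => fderiv ℝ (coordChange x x') y (EuclideanSpace.single i 1) k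

theorem coordJacobian_mulVec (x x' : M) (y v : EuclideanSpace ℝ (Fin n)) :
    (coordJacobian x x' y).mulVec v.ofLp = (fderiv ℝ (coordChange x x') y v).ofLp := by
  have e : v = ∑ i, v i • (EuclideanSpace.single i (1 : ℝ) : EuclideanSpace ℝ (Fin n)) := by
    conv_lhs => rw [← (EuclideanSpace.basisFun (Fin n) ℝ).sum_repr v]
    simp
  conv_rhs => rw [e]
  ext k
  simp [coordJacobian, Matrix.mulVec, dotProduct, map_sum, mul_comm]

theorem det_coordJacobian (x x' : M) (y : EuclideanSpace ℝ (Fin n)) :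
    (coordJacobian x x' y).det = (fderiv ℝ (coordChange x x') y).det := by
  rw [ContinuousLinearMap.det,
    ← LinearMap.det_toMatrix (EuclideanSpace.basisFun (Fin n) ℝ).toBasis]
  congr 1

end CoordChange

/-! ### The metric in a chart -/

section ChartMetric

variable {n : ℕ} {M : Type*} [TopologicalSpace M] [ChartedSpace (EuclideanSpace ℝ (Fin n)) M]
  [IsManifold (𝓡 n) ∞ M]

theorem contMDiffAt_extChartAt_symm {x : M} {y : EuclideanSpace ℝ (Fin n)}
    (hy : y ∈ (extChartAt (𝓡 n) x).target) :
    ContMDiffAt 𝓘(ℝ, EuclideanSpace ℝ (Fin n)) (𝓡 n) ∞ (extChartAt (𝓡 n) x).symm y :=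
  (contMDiffOn_extChartAt_symm x).contMDiffAt ((isOpen_extChartAt_target x).mem_nhds hy)

theorem ContMDiff.contDiffOn_comp_extChartAt_symm {F : Type*} [NormedAddCommGroup F]
    [NormedSpace ℝ F] {u : M → F} (hu : ContMDiff (𝓡 n) 𝓘(ℝ, F) ∞ u) (x : M) :
    ContDiffOn ℝ ∞ (u ∘ (extChartAt (𝓡 n) x).symm) (extChartAt (𝓡 n) x).target := by
  rw [← contMDiffOn_iff_contDiffOn]
  exact hu.comp_contMDiffOn (contMDiffOn_extChartAt_symm x)

theorem contMDiffAt_coordVector {x : M} {y : EuclideanSpace ℝ (Fin n)}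
    (hy : y ∈ (extChartAt (𝓡 n) x).target) (i : Fin n) :
    ContMDiffAt 𝓘(ℝ, EuclideanSpace ℝ (Fin n)) (𝓡 n).tangent ∞
      (fun z => (⟨(extChartAt (𝓡 n) x).symm z, coordVector x i z⟩ : TangentBundle (𝓡 n) M)) y := by
  have ho : IsOpen (extChartAt (𝓡 n) x).target := isOpen_extChartAt_target x
  have h1 := (contMDiffOn_extChartAt_symm (I := 𝓡 n) (n := ∞) x).contMDiffOn_tangentMapWithin
    (m := ∞) (by simp) ho.uniqueMDiffOn
  have h2 : ContMDiffAt 𝓘(ℝ, EuclideanSpace ℝ (Fin n)) 𝓘(ℝ, EuclideanSpace ℝ (Fin n)).tangent ∞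
      (fun z => (⟨z, EuclideanSpace.single i (1 : ℝ)⟩ :
        TangentBundle 𝓘(ℝ, EuclideanSpace ℝ (Fin n)) (EuclideanSpace ℝ (Fin n)))) y := by
    exact (contMDiffAt_vectorSpace_iff_contDiffAt
      (V := fun _ => EuclideanSpace.single i (1 : ℝ))).2 contDiffAt_const
  have h3 := (h1 ⟨y, EuclideanSpace.single i (1 : ℝ)⟩ hy).comp_of_eq
    (x := y) (h2.contMDiffWithinAt (s := (extChartAt (𝓡 n) x).target)) (fun z hz => hz) rfl
  refine (h3.contMDiffAt (ho.mem_nhds hy)).congr_of_eventuallyEq ?_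
  filter_upwards [ho.mem_nhds hy] with z hz
  simp only [Function.comp_apply, tangentMapWithin]
  rw [mfderivWithin_of_isOpen ho hz]
  rfl

theorem contDiffOn_coordChange (x x' : M) :
    ContDiffOn ℝ ∞ (coordChange (n := n) x x') (chartOverlap x x') := by
  rw [← contMDiffOn_iff_contDiffOn]
  have h := contMDiffOn_extChartAt (I := 𝓡 n) (n := ∞) (x := x')
  rw [← extChartAt_source (𝓡 n)] at h
  exact h.comp ((contMDiffOn_extChartAt_symm x).mono Set.inter_subset_left) fun y hy => hy.2

theorem contDiffOn_metricMatrix (g : SmoothMetric n M) (x : M) (i j : Fin n) :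
    ContDiffOn ℝ ∞ (fun y => metricMatrix g x y i j) (extChartAt (𝓡 n) x).target := by
  intro y hy
  refine ContDiffAt.contDiffWithinAt ?_
  rw [← contMDiffAt_iff_contDiffAt]
  have h := ContMDiffAt.clm_bundle_apply₂ (F₁ := EuclideanSpace ℝ (Fin n))
    (F₂ := EuclideanSpace ℝ (Fin n)) (F₃ := ℝ) (E₃ := Bundle.Trivial M ℝ)
    (b := (extChartAt (𝓡 n) x).symm)
    (ψ := fun z => g.inner ((extChartAt (𝓡 n) x).symm z))
    (v := fun z => coordVector x i z) (w := fun z => coordVector x j z)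
    (g.contMDiff.contMDiffAt.comp y (contMDiffAt_extChartAt_symm hy))
    (contMDiffAt_coordVector hy i) (contMDiffAt_coordVector hy j)
  simp only [Bundle.contMDiffAt_totalSpace] at h
  exact h.2

/-- The metric on the tangent vectors with coordinates `v` and `w`. -/
theorem inner_mfderiv_extChartAt_symm (g : SmoothMetric n M) (x : M)
    (y v w : EuclideanSpace ℝ (Fin n)) :
    g.inner ((extChartAt (𝓡 n) x).symm y)
      (mfderiv 𝓘(ℝ, EuclideanSpace ℝ (Fin n)) (𝓡 n) (extChartAt (𝓡 n) x).symm y v)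
      (mfderiv 𝓘(ℝ, EuclideanSpace ℝ (Fin n)) (𝓡 n) (extChartAt (𝓡 n) x).symm y w) =
      v.ofLp ⬝ᵥ (metricMatrix g x y).mulVec w.ofLp := by
  have hv : ∀ v : EuclideanSpace ℝ (Fin n),
      mfderiv 𝓘(ℝ, EuclideanSpace ℝ (Fin n)) (𝓡 n) (extChartAt (𝓡 n) x).symm y v =
        ∑ i, v i • coordVector x i y := fun v => by
    have e : v = ∑ i, v i • (EuclideanSpace.single i (1 : ℝ) : EuclideanSpace ℝ (Fin n)) := by
      conv_lhs => rw [← (EuclideanSpace.basisFun (Fin n) ℝ).sum_repr v]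
      simp
    conv_lhs => rw [e]
    erw [map_sum]
    refine Finset.sum_congr rfl fun i _ => ?_
    erw [map_smul]
    rfl
  rw [hv v, hv w]
  simp only [map_sum, map_smul, sum_apply, smul_apply, smul_eq_mul, dotProduct, Matrix.mulVec,
    Finset.mul_sum, metricMatrix, Matrix.of_apply]
  rw [Finset.sum_comm]
  refine Finset.sum_congr rfl fun _ _ => Finset.sum_congr rfl fun _ _ => ?_
  ring

theorem isSymm_metricMatrix (g : SmoothMetric n M) (x : M) (y : EuclideanSpace ℝ (Fin n)) :
    (metricMatrix g x y).IsSymm :=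
  Matrix.IsSymm.ext fun _ _ => g.symm _ _ _

theorem posDef_metricMatrix (g : SmoothMetric n M) {x : M} {y : EuclideanSpace ℝ (Fin n)}
    (hy : y ∈ (extChartAt (𝓡 n) x).target) : (metricMatrix g x y).PosDef := by
  refine Matrix.PosDef.of_dotProduct_mulVec_pos (isSymm_metricMatrix g x y) fun v hv => ?_
  have h := inner_mfderiv_extChartAt_symm g x y (WithLp.toLp 2 v) (WithLp.toLp 2 v)
  simp only [star_trivial]
  rw [← h]
  refine g.pos _ _ fun h0 => hv ?_
  have hinv := isInvertible_mfderivWithin_extChartAt_symm (I := 𝓡 n) hy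
  have hr : Set.range (𝓡 n) = Set.univ := by simp
  rw [hr, mfderivWithin_univ] at hinv
  obtain ⟨e, he⟩ := hinv
  rw [← he] at h0
  have : WithLp.toLp 2 v = (0 : EuclideanSpace ℝ (Fin n)) :=
    e.injective (h0.trans (map_zero e).symm)
  simpa using congrArg WithLp.ofLp this

theorem volumeDensity_pos (g : SmoothMetric n M) {x : M} {y : EuclideanSpace ℝ (Fin n)}
    (hy : y ∈ (extChartAt (𝓡 n) x).target) : 0 < volumeDensity g x y :=
  Real.sqrt_pos.2 (posDef_metricMatrix g hy).det_pos

theorem ContDiffOn.matrix_det {ι : Type*} [Fintype ι] [DecidableEq ι] {V : Type*}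
    [NormedAddCommGroup V] [NormedSpace ℝ V] {s : Set V} {A : V → Matrix ι ι ℝ}
    (hA : ∀ i j, ContDiffOn ℝ ∞ (fun y => A y i j) s) :
    ContDiffOn ℝ ∞ (fun y => (A y).det) s := by
  simp only [Matrix.det_apply']
  exact ContDiffOn.sum fun σ _ => contDiffOn_const.mul (contDiffOn_prod fun i _ => hA _ _)

theorem contDiffOn_volumeDensity (g : SmoothMetric n M) (x : M) :
    ContDiffOn ℝ ∞ (volumeDensity g x) (extChartAt (𝓡 n) x).target :=
  (ContDiffOn.matrix_det (contDiffOn_metricMatrix g x)).sqrt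
    fun _ hy => (posDef_metricMatrix g hy).det_pos.ne'

theorem contDiffOn_metricMatrix_inv (g : SmoothMetric n M) (x : M) (i j : Fin n) :
    ContDiffOn ℝ ∞ (fun y => (metricMatrix g x y)⁻¹ i j) (extChartAt (𝓡 n) x).target := by
  simp only [Matrix.inv_def, Matrix.smul_apply, Ring.inverse_eq_inv', smul_eq_mul,
    Matrix.adjugate_apply]
  refine ((ContDiffOn.matrix_det (contDiffOn_metricMatrix g x)).inv
    fun _ hy => (posDef_metricMatrix g hy).det_pos.ne').mul (ContDiffOn.matrix_det fun k l => ?_)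
  by_cases hk : k = j
  · subst hk
    simpa using contDiffOn_const
  · simpa [Matrix.updateRow_ne hk] using contDiffOn_metricMatrix g x k l

/-- Coordinate changes act on the metric by congruence with the Jacobian matrix. -/
theorem metricMatrix_eq_of_mem_chartOverlap (g : SmoothMetric n M) {x x' : M}
    {y : EuclideanSpace ℝ (Fin n)} (hy : y ∈ chartOverlap x x') :
    metricMatrix g x y = (coordJacobian x x' y).transpose *
      metricMatrix g x' (coordChange x x' y) * coordJacobian x x' y := by
  have ho := isOpen_chartOverlap (n := n) x x'
  have hd : DifferentiableAt ℝ (coordChange x x') y :=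
    ((contDiffOn_coordChange x x').differentiableOn (by simp)).differentiableAt (ho.mem_nhds hy)
  have h1 := ((contMDiffAt_extChartAt_symm (coordChange_mem_target hy)).mdifferentiableAt
    (by simp)).hasMFDerivAt.comp y hd.hasFDerivAt.hasMFDerivAt
  have h2 : (extChartAt (𝓡 n) x).symm =ᶠ[𝓝 y] (extChartAt (𝓡 n) x').symm ∘ coordChange x x' := by
    filter_upwards [ho.mem_nhds hy] with z hz
    exact (extChartAt_symm_coordChange hz).symm
  have h3 := (h1.congr_of_eventuallyEq h2).mfderiv
  have hp : ∀ p q : M, p = q → ∀ v w : EuclideanSpace ℝ (Fin n),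
      g.inner p (v : TangentSpace (𝓡 n) p) (w : TangentSpace (𝓡 n) p) =
        g.inner q (v : TangentSpace (𝓡 n) q) (w : TangentSpace (𝓡 n) q) := by
    rintro p _ rfl v w
    rfl
  ext i j
  have h := inner_mfderiv_extChartAt_symm g x' (coordChange x x' y)
    (fderiv ℝ (coordChange x x') y (EuclideanSpace.single i 1))
    (fderiv ℝ (coordChange x x') y (EuclideanSpace.single j 1))
  replace h := (hp _ _ (extChartAt_symm_coordChange hy).symm _ _).trans h
  have h4 : metricMatrix g x y i j = g.inner ((extChartAt (𝓡 n) x).symm y)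
      (mfderiv 𝓘(ℝ, EuclideanSpace ℝ (Fin n)) (𝓡 n) (extChartAt (𝓡 n) x).symm y
        (EuclideanSpace.single i (1 : ℝ) : EuclideanSpace ℝ (Fin n)))
      (mfderiv 𝓘(ℝ, EuclideanSpace ℝ (Fin n)) (𝓡 n) (extChartAt (𝓡 n) x).symm y
        (EuclideanSpace.single j (1 : ℝ) : EuclideanSpace ℝ (Fin n))) := rfl
  rw [h4, h3]
  refine h.trans ?_
  rw [← coordJacobian_mulVec, ← coordJacobian_mulVec]
  simp only [PiLp.ofLp_single, Matrix.mulVec_single_one]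
  rw [Matrix.mul_assoc, Matrix.mul_apply]
  rfl

/-- The transformation law of the volume density, from `G = Jᵀ G' J` for the metric matrices and
the Jacobian matrix `J` of the coordinate change. -/
theorem volumeDensity_eq_of_mem_chartOverlap (g : SmoothMetric n M) {x x' : M}
    {y : EuclideanSpace ℝ (Fin n)} (hy : y ∈ chartOverlap x x') :
    volumeDensity g x y =
      |(fderiv ℝ (coordChange x x') y).det| * volumeDensity g x' (coordChange x x' y) := by
  rw [volumeDensity, metricMatrix_eq_of_mem_chartOverlap g hy, Matrix.det_mul, Matrix.det_mul,
    Matrix.det_transpose, det_coordJacobian, mul_right_comm, ← sq,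
    Real.sqrt_mul (sq_nonneg _), Real.sqrt_sq_eq_abs, volumeDensity]

/-- Coordinate changes preserve `p ⬝ G⁻¹ q` if `p` and `q` are transformed like differentials. -/
theorem dotProduct_metricMatrix_inv_mulVec (g : SmoothMetric n M) {x x' : M}
    {y : EuclideanSpace ℝ (Fin n)} (hy : y ∈ chartOverlap x x') (p q : Fin n → ℂ) :
    (((coordJacobian x x' y).map Complex.ofReal).transpose.mulVec p) ⬝ᵥ
      (((metricMatrix g x y)⁻¹.map Complex.ofReal).mulVec
        (((coordJacobian x x' y).map Complex.ofReal).transpose.mulVec q)) =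
    p ⬝ᵥ (((metricMatrix g x' (coordChange x x' y))⁻¹.map Complex.ofReal).mulVec q) := by
  set J := coordJacobian x x' y
  set G' := metricMatrix g x' (coordChange x x' y)
  have hG := metricMatrix_eq_of_mem_chartOverlap g hy
  have hdet : IsUnit (metricMatrix g x y).det := (posDef_metricMatrix g hy.1).det_pos.ne'.isUnit
  have hJ : IsUnit J.det := by
    rw [hG, Matrix.det_mul] at hdet
    exact isUnit_of_mul_isUnit_right hdet
  have hmat : J * (metricMatrix g x y)⁻¹ * J.transpose = G'⁻¹ := by
    rw [hG, Matrix.mul_inv_rev, Matrix.mul_inv_rev, ← Matrix.mul_assoc, Matrix.mul_assoc,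
      Matrix.mul_nonsing_inv _ hJ, Matrix.one_mul, Matrix.mul_assoc,
      Matrix.nonsing_inv_mul _ (by rwa [Matrix.det_transpose]), Matrix.mul_one]
  rw [← hmat]
  rw [Matrix.mulVec_transpose, ← Matrix.dotProduct_mulVec, Matrix.mulVec_mulVec,
    Matrix.mulVec_mulVec]
  have hmap : ∀ A B : Matrix (Fin n) (Fin n) ℝ,
      (A * B).map Complex.ofReal = A.map Complex.ofReal * B.map Complex.ofReal :=
    fun A B => Matrix.map_mul (f := Complex.ofRealHom)
  rw [hmap, hmap, Matrix.transpose_map, Matrix.mul_assoc]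

end ChartMetric

/-! ### Gradients and the Laplace-Beltrami operator in a chart -/

section ChartLaplacian

variable {n : ℕ} {M : Type*} [TopologicalSpace M] [ChartedSpace (EuclideanSpace ℝ (Fin n)) M]

/-- The components `∂u/∂y_i` of the differential of `u` in the chart at `x`. -/
noncomputable def chartDifferential (x : M) (u : M → ℂ) (y : EuclideanSpace ℝ (Fin n)) :
    Fin n → ℂ :=
  fun i => partialDeriv i (u ∘ (extChartAt (𝓡 n) x).symm) y

variable [IsManifold (𝓡 n) ∞ M]

theorem ContMDiff.differentiableAt_comp_extChartAt_symm {u : M → ℂ}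
    (hu : ContMDiff (𝓡 n) 𝓘(ℝ, ℂ) ∞ u) {x : M} {y : EuclideanSpace ℝ (Fin n)}
    (hy : y ∈ (extChartAt (𝓡 n) x).target) :
    DifferentiableAt ℝ (u ∘ (extChartAt (𝓡 n) x).symm) y :=
  ((hu.contDiffOn_comp_extChartAt_symm x).differentiableOn (by simp)).differentiableAt
    ((isOpen_extChartAt_target x).mem_nhds hy)

theorem contDiffOn_chartDifferential {u : M → ℂ} (hu : ContMDiff (𝓡 n) 𝓘(ℝ, ℂ) ∞ u) (x : M)
    (i : Fin n) :
    ContDiffOn ℝ ∞ (fun y => chartDifferential x u y i) (extChartAt (𝓡 n) x).target :=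
  (hu.contDiffOn_comp_extChartAt_symm x).partialDeriv (isOpen_extChartAt_target x)
    (m := ⊤) (k := ⊤) (by simp) i

theorem chartDifferential_eq_of_mem_chartOverlap {u : M → ℂ}
    (hu : ContMDiff (𝓡 n) 𝓘(ℝ, ℂ) ∞ u) {x x' : M} {y : EuclideanSpace ℝ (Fin n)}
    (hy : y ∈ chartOverlap x x') :
    chartDifferential x u y = ((coordJacobian x x' y).map Complex.ofReal).transpose.mulVec
      (chartDifferential x' u (coordChange x x' y)) := by
  have ho := isOpen_chartOverlap (n := n) x x'
  have hd : DifferentiableAt ℝ (coordChange x x') y :=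
    ((contDiffOn_coordChange x x').differentiableOn (by simp)).differentiableAt (ho.mem_nhds hy)
  have h1 : u ∘ (extChartAt (𝓡 n) x).symm =ᶠ[𝓝 y]
      (u ∘ (extChartAt (𝓡 n) x').symm) ∘ coordChange x x' := by
    filter_upwards [ho.mem_nhds hy] with z hz
    simp only [Function.comp_apply, extChartAt_symm_coordChange hz]
  ext i
  rw [chartDifferential, partialDeriv_congr h1, partialDeriv, fderiv_comp y
    (hu.differentiableAt_comp_extChartAt_symm (coordChange_mem_target hy)) hd,
    ContinuousLinearMap.comp_apply]
  set w := fderiv ℝ (coordChange x x') y (EuclideanSpace.single i 1) with hw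
  have e : w = ∑ k, w k • (EuclideanSpace.single k (1 : ℝ) : EuclideanSpace ℝ (Fin n)) := by
    conv_lhs => rw [← (EuclideanSpace.basisFun (Fin n) ℝ).sum_repr w]
    simp
  rw [e, map_sum]
  simp only [map_smul, Matrix.mulVec, dotProduct, Matrix.transpose_apply, Matrix.map_apply,
    coordJacobian, Matrix.of_apply, Complex.real_smul]
  rfl

/-- The bilinear pairing of the gradients of `u` and `v` in the chart at `x`. -/
noncomputable def chartGradInner (g : SmoothMetric n M) (x : M) (u v : M → ℂ)
    (y : EuclideanSpace ℝ (Fin n)) : ℂ :=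
  chartDifferential x u y ⬝ᵥ
    (((metricMatrix g x y)⁻¹.map Complex.ofReal).mulVec (chartDifferential x v y))

/-- The bilinear pairing `g(∇u, ∇v)` of the gradients of `u` and `v`, computed at each point in
the preferred chart. -/
noncomputable def gradInner (g : SmoothMetric n M) (u v : M → ℂ) (p : M) : ℂ :=
  chartGradInner g p u v (extChartAt (𝓡 n) p p)

theorem chartGradInner_eq_sum (g : SmoothMetric n M) (x : M) (u v : M → ℂ)
    (y : EuclideanSpace ℝ (Fin n)) : chartGradInner g x u v y =
      ∑ i, ∑ j, chartDifferential x u y i *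
        (((metricMatrix g x y)⁻¹ i j : ℝ) * chartDifferential x v y j) := by
  simp only [chartGradInner, dotProduct, Matrix.mulVec, Finset.mul_sum, Matrix.map_apply]

theorem chartGradInner_comm (g : SmoothMetric n M) (x : M) (u v : M → ℂ)
    (y : EuclideanSpace ℝ (Fin n)) : chartGradInner g x u v y = chartGradInner g x v u y := by
  rw [chartGradInner_eq_sum, chartGradInner_eq_sum, Finset.sum_comm]
  refine Finset.sum_congr rfl fun i _ => Finset.sum_congr rfl fun j _ => ?_
  rw [(isSymm_metricMatrix g x y).inv.apply]
  ring

theorem gradInner_comm (g : SmoothMetric n M) (u v : M → ℂ) (p : M) :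
    gradInner g u v p = gradInner g v u p :=
  chartGradInner_comm g p u v _

theorem contDiffOn_chartGradInner (g : SmoothMetric n M) (x : M) {u v : M → ℂ}
    (hu : ContMDiff (𝓡 n) 𝓘(ℝ, ℂ) ∞ u) (hv : ContMDiff (𝓡 n) 𝓘(ℝ, ℂ) ∞ v) :
    ContDiffOn ℝ ∞ (chartGradInner g x u v) (extChartAt (𝓡 n) x).target := by
  have e : chartGradInner g x u v = _ := funext (chartGradInner_eq_sum g x u v)
  rw [e]
  exact ContDiffOn.sum fun i _ => ContDiffOn.sum fun j _ =>
    (contDiffOn_chartDifferential hu x i).mul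
      ((Complex.ofRealCLM.contDiff.comp_contDiffOn (contDiffOn_metricMatrix_inv g x i j)).mul
        (contDiffOn_chartDifferential hv x j))

theorem gradInner_eq_chartGradInner (g : SmoothMetric n M) {u v : M → ℂ}
    (hu : ContMDiff (𝓡 n) 𝓘(ℝ, ℂ) ∞ u) (hv : ContMDiff (𝓡 n) 𝓘(ℝ, ℂ) ∞ v) {x p : M}
    (hp : p ∈ (extChartAt (𝓡 n) x).source) :
    gradInner g u v p = chartGradInner g x u v (extChartAt (𝓡 n) x p) := by
  have hy := mem_chartOverlap_of_mem_source (n := n) (mem_extChartAt_source p) hp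
  rw [gradInner, chartGradInner, chartDifferential_eq_of_mem_chartOverlap hu hy,
    chartDifferential_eq_of_mem_chartOverlap hv hy, dotProduct_metricMatrix_inv_mulVec g hy,
    coordChange_extChartAt (mem_extChartAt_source p), chartGradInner]

theorem continuous_gradInner (g : SmoothMetric n M) {u v : M → ℂ}
    (hu : ContMDiff (𝓡 n) 𝓘(ℝ, ℂ) ∞ u) (hv : ContMDiff (𝓡 n) 𝓘(ℝ, ℂ) ∞ v) :
    Continuous (gradInner g u v) := by
  refine continuous_iff_continuousAt.2 fun p => ?_
  have h1 : ContinuousAt (chartGradInner g p u v) (extChartAt (𝓡 n) p p) :=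
    (contDiffOn_chartGradInner g p hu hv).continuousOn.continuousAt
      ((isOpen_extChartAt_target p).mem_nhds (mem_extChartAt_target p))
  refine (h1.comp (continuousAt_extChartAt p)).congr ?_
  filter_upwards [extChartAt_source_mem_nhds (I := 𝓡 n) p] with q hq
  exact (gradInner_eq_chartGradInner g hu hv hq).symm

/-- `√(det g) ∑ j, g^{ij} ∂u/∂y_j` in the chart at `x`. -/
noncomputable def chartFlux (g : SmoothMetric n M) (x : M) (u : M → ℂ) (i : Fin n)
    (y : EuclideanSpace ℝ (Fin n)) : ℂ :=
  (volumeDensity g x y : ℂ) * ∑ j, ((metricMatrix g x y)⁻¹ i j : ℂ) * chartDifferential x u y j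

/-- The Laplace-Beltrami operator in the chart at `x`. -/
noncomputable def chartLaplacian (g : SmoothMetric n M) (x : M) (u : M → ℂ)
    (y : EuclideanSpace ℝ (Fin n)) : ℂ :=
  ((volumeDensity g x y)⁻¹ : ℝ) * ∑ i, partialDeriv i (chartFlux g x u i) y

theorem laplaceBeltrami_eq_chartLaplacian_self (g : SmoothMetric n M) (u : M → ℂ) (p : M) :
    laplaceBeltrami g u p = chartLaplacian g p u (extChartAt (𝓡 n) p p) :=
  rfl

theorem contDiffOn_chartFlux (g : SmoothMetric n M) (x : M) {u : M → ℂ}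
    (hu : ContMDiff (𝓡 n) 𝓘(ℝ, ℂ) ∞ u) (i : Fin n) :
    ContDiffOn ℝ ∞ (chartFlux g x u i) (extChartAt (𝓡 n) x).target :=
  (Complex.ofRealCLM.contDiff.comp_contDiffOn (contDiffOn_volumeDensity g x)).mul
    (ContDiffOn.sum fun j _ =>
      (Complex.ofRealCLM.contDiff.comp_contDiffOn (contDiffOn_metricMatrix_inv g x i j)).mul
        (contDiffOn_chartDifferential hu x j))

theorem contDiffOn_chartLaplacian (g : SmoothMetric n M) (x : M) {u : M → ℂ}
    (hu : ContMDiff (𝓡 n) 𝓘(ℝ, ℂ) ∞ u) :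
    ContDiffOn ℝ ∞ (chartLaplacian g x u) (extChartAt (𝓡 n) x).target :=
  (Complex.ofRealCLM.contDiff.comp_contDiffOn ((contDiffOn_volumeDensity g x).inv
    fun _ hy => (volumeDensity_pos g hy).ne')).mul
    (ContDiffOn.sum fun i _ => (contDiffOn_chartFlux g x hu i).partialDeriv
      (isOpen_extChartAt_target x) (m := ⊤) (k := ⊤) (by simp) i)

/-- Green's formula in a chart. -/
theorem integral_chartLaplacian_mul (g : SmoothMetric n M) (x : M) {u : M → ℂ}
    (hu : ContMDiff (𝓡 n) 𝓘(ℝ, ℂ) ∞ u) {w : EuclideanSpace ℝ (Fin n) → ℂ} (hw : ContDiff ℝ 1 w)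
    (hwc : HasCompactSupport w) (hwT : tsupport w ⊆ (extChartAt (𝓡 n) x).target) :
    ∫ y, volumeDensity g x y * (chartLaplacian g x u y * w y) =
      -∫ y, ∑ i, chartFlux g x u i y * partialDeriv i w y := by
  have hT : IsOpen (extChartAt (𝓡 n) x).target := isOpen_extChartAt_target x
  have hw' : ∀ i, tsupport (partialDeriv i w) ⊆ (extChartAt (𝓡 n) x).target := fun i =>
    (closure_minimal (fun y hy => by
      by_contra h
      exact hy (partialDeriv_of_notMem_tsupport i h)) (isClosed_tsupport w)).trans hwT
  have e : ∀ y, volumeDensity g x y * (chartLaplacian g x u y * w y) =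
      ∑ i, partialDeriv i (chartFlux g x u i) y * w y := by
    intro y
    by_cases hy : y ∈ (extChartAt (𝓡 n) x).target
    · have h0 : (volumeDensity g x y : ℂ) ≠ 0 := by
        exact_mod_cast (volumeDensity_pos g hy).ne'
      rw [chartLaplacian, ← mul_assoc, ← mul_assoc, Complex.ofReal_inv, mul_inv_cancel₀ h0,
        one_mul, Finset.sum_mul]
    · have : w y = 0 := image_eq_zero_of_notMem_tsupport fun h => hy (hwT h)
      simp [this]
  simp only [e]
  rw [integral_finsetSum, integral_finsetSum, ← Finset.sum_neg_distrib]
  · exact Finset.sum_congr rfl fun i _ => integral_partialDeriv_mul hT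
      ((contDiffOn_chartFlux g x hu i).of_le (by exact_mod_cast le_top)) hw hwc hwT i
  · exact fun i _ => integrable_mul_of_tsupport_subset hT
      (contDiffOn_chartFlux g x hu i).continuousOn
      ((hw.continuous_fderiv one_ne_zero).clm_apply continuous_const) (hwc.partialDeriv i) (hw' i)
  · exact fun i _ => integrable_mul_of_tsupport_subset hT
      ((contDiffOn_chartFlux g x hu i).partialDeriv hT (m := ⊤) (k := ⊤) (by simp) i).continuousOn
      hw.continuous hwc hwT

theorem sum_chartFlux_mul (g : SmoothMetric n M) (x : M) (u v : M → ℂ)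
    (y : EuclideanSpace ℝ (Fin n)) :
    ∑ i, chartFlux g x u i y * chartDifferential x v y i =
      volumeDensity g x y * chartGradInner g x u v y := by
  rw [chartGradInner_comm, chartGradInner_eq_sum, Finset.mul_sum]
  refine Finset.sum_congr rfl fun i _ => ?_
  rw [chartFlux, mul_assoc, Finset.sum_mul]
  congr 1
  exact Finset.sum_congr rfl fun j _ => by ring

end ChartLaplacian

/-! ### The Riemannian volume in a chart -/

section Volume

variable {n : ℕ} {M : Type*} [TopologicalSpace M] [ChartedSpace (EuclideanSpace ℝ (Fin n)) M]

theorem measurableSet_extChartAt_source [MeasurableSpace M] [OpensMeasurableSpace M] (x : M) :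
    MeasurableSet (extChartAt (𝓡 n) x).source :=
  (isOpen_extChartAt_source x).measurableSet

theorem measurableSet_extChartAt_target (x : M) :
    MeasurableSet (extChartAt (𝓡 n) x).target :=
  (isOpen_extChartAt_target x).measurableSet

theorem aemeasurable_extChartAt_symm [MeasurableSpace M] [BorelSpace M] (x : M) :
    AEMeasurable (extChartAt (𝓡 n) x).symm
      ((volume : Measure (EuclideanSpace ℝ (Fin n))).restrict (extChartAt (𝓡 n) x).target) :=
  (continuousOn_extChartAt_symm x).aemeasurable (measurableSet_extChartAt_target x)

/-- The set of coordinates of the points of `s` in the chart at `x` is measurable. -/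
theorem measurableSet_target_inter_preimage [MeasurableSpace M] [BorelSpace M] (x : M)
    {s : Set M} (hs : MeasurableSet s) :
    MeasurableSet ((extChartAt (𝓡 n) x).target ∩ (extChartAt (𝓡 n) x).symm ⁻¹' s) := by
  have h := (continuousOn_iff_continuous_domRestrict.1
    (continuousOn_extChartAt_symm (I := 𝓡 n) x)).measurable hs
  have h2 := (measurableSet_extChartAt_target (n := n) x).subtype_image h
  convert h2 using 1
  ext y
  simp [and_comm]

variable [IsManifold (𝓡 n) ∞ M]

theorem aemeasurable_ofReal_volumeDensity (g : SmoothMetric n M) (x : M) :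
    AEMeasurable (fun y => ENNReal.ofReal (volumeDensity g x y))
      ((volume : Measure (EuclideanSpace ℝ (Fin n))).restrict (extChartAt (𝓡 n) x).target) :=
  ((contDiffOn_volumeDensity g x).continuousOn.aemeasurable
    (measurableSet_extChartAt_target x)).ennreal_ofReal

variable [MeasurableSpace M] [BorelSpace M]

theorem chartVolume_apply (g : SmoothMetric n M) (x : M) {s : Set M} (hs : MeasurableSet s) :
    chartVolume g x s = ∫⁻ y in (extChartAt (𝓡 n) x).target ∩ (extChartAt (𝓡 n) x).symm ⁻¹' s,
      ENNReal.ofReal (volumeDensity g x y) := by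
  rw [chartVolume, Measure.map_apply_of_aemeasurable
    ((aemeasurable_extChartAt_symm x).mono_ac (withDensity_absolutelyContinuous _ _)) hs,
    withDensity_apply', Measure.restrict_restrict' (measurableSet_extChartAt_target x),
    Set.inter_comm]

theorem chartVolume_compl_source (g : SmoothMetric n M) (x : M) :
    chartVolume g x (extChartAt (𝓡 n) x).sourceᶜ = 0 := by
  rw [chartVolume_apply g x (measurableSet_extChartAt_source x).compl]
  have : (extChartAt (𝓡 n) x).target ∩
      (extChartAt (𝓡 n) x).symm ⁻¹' (extChartAt (𝓡 n) x).sourceᶜ = ∅ := by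
    ext y
    simp only [Set.mem_inter_iff, Set.mem_preimage, Set.mem_compl_iff, Set.mem_empty_iff_false,
      iff_false, not_and, not_not]
    exact fun h => (extChartAt (𝓡 n) x).map_target h
  rw [this, Measure.restrict_empty, lintegral_zero_measure]

theorem chartVolume_inter_source (g : SmoothMetric n M) (x : M) (s : Set M) :
    chartVolume g x (s ∩ (extChartAt (𝓡 n) x).source) = chartVolume g x s :=
  measure_inter_conull (chartVolume_compl_source g x)

/-- By the change of variables formula the volumes in two charts agree on their overlap. -/
theorem chartVolume_eq_of_subset (g : SmoothMetric n M) (x x' : M) {s : Set M}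
    (hs : MeasurableSet s) (h : s ⊆ (extChartAt (𝓡 n) x).source)
    (h' : s ⊆ (extChartAt (𝓡 n) x').source) : chartVolume g x s = chartVolume g x' s := by
  set A := (extChartAt (𝓡 n) x).target ∩ (extChartAt (𝓡 n) x).symm ⁻¹' s with hA
  have hAo : A ⊆ chartOverlap x x' := fun y hy => ⟨hy.1, h' hy.2⟩
  have hA' : (extChartAt (𝓡 n) x').target ∩ (extChartAt (𝓡 n) x').symm ⁻¹' s =
      coordChange x x' '' A := by
    ext z
    constructor
    · rintro ⟨hz, hzs⟩
      refine ⟨extChartAt (𝓡 n) x ((extChartAt (𝓡 n) x').symm z),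
        ⟨(extChartAt (𝓡 n) x).map_source (h hzs), ?_⟩, ?_⟩
      · rwa [Set.mem_preimage, (extChartAt (𝓡 n) x).left_inv (h hzs)]
      · rw [coordChange_extChartAt (h hzs), (extChartAt (𝓡 n) x').right_inv hz]
    · rintro ⟨y, hy, rfl⟩
      refine ⟨coordChange_mem_target (hAo hy), ?_⟩
      rw [Set.mem_preimage, extChartAt_symm_coordChange (hAo hy)]
      exact hy.2
  have hinj : Set.InjOn (coordChange (n := n) x x') A := by
    intro y hy z hz hyz
    have e := congrArg (extChartAt (𝓡 n) x').symm hyz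
    rw [extChartAt_symm_coordChange (hAo hy), extChartAt_symm_coordChange (hAo hz)] at e
    exact (extChartAt (𝓡 n) x).symm.injOn hy.1 hz.1 e
  have hAm : MeasurableSet A := measurableSet_target_inter_preimage x hs
  rw [chartVolume_apply g x hs, chartVolume_apply g x' hs, hA',
    lintegral_image_eq_lintegral_abs_det_fderiv_mul volume hAm (fun y hy =>
      (((contDiffOn_coordChange x x').differentiableOn (by simp)).differentiableAt
        ((isOpen_chartOverlap x x').mem_nhds (hAo hy))).hasFDerivAt.hasFDerivWithinAt) hinj]
  refine setLIntegral_congr_fun hAm fun y hy => ?_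
  rw [volumeDensity_eq_of_mem_chartOverlap g (hAo hy), ENNReal.ofReal_mul (abs_nonneg _)]

/-- Outside the domain of the chart at `x` any measure is dominated by `∞` times the counting
measure, and inside it the volumes in the other charts are dominated by the one in this chart. -/
theorem chartVolume_le (g : SmoothMetric n M) (x x' : M) :
    chartVolume g x' ≤ chartVolume g x +
      ((⊤ : ℝ≥0∞) • Measure.count).restrict (extChartAt (𝓡 n) x).sourceᶜ := by
  have hx := measurableSet_extChartAt_source (n := n) x
  have hx' := measurableSet_extChartAt_source (n := n) x'
  refine Measure.le_iff.2 fun s hs => ?_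
  rw [Measure.add_apply, Measure.restrict_apply hs, Measure.smul_apply]
  rcases (s ∩ (extChartAt (𝓡 n) x).sourceᶜ).eq_empty_or_nonempty with h | h
  · have hsx : s ⊆ (extChartAt (𝓡 n) x).source := by
      rwa [← Set.sdiff_eq, Set.sdiff_eq_empty] at h
    rw [← chartVolume_inter_source g x' s, ← chartVolume_eq_of_subset g x x' (hs.inter hx')
      (Set.inter_subset_left.trans hsx) Set.inter_subset_right]
    exact (measure_mono Set.inter_subset_left).trans le_self_add
  · rw [smul_eq_mul, ENNReal.top_mul (Measure.count_ne_zero h), add_top]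
    exact le_top

/-- The supremum of the chart volumes that defines the Riemannian volume restricts to the given
volume in each chart. -/
theorem restrict_riemannianVolume (g : SmoothMetric n M) (x : M) :
    (riemannianVolume g).restrict (extChartAt (𝓡 n) x).source = chartVolume g x := by
  have hx := measurableSet_extChartAt_source (n := n) x
  ext s hs
  rw [Measure.restrict_apply hs, ← chartVolume_inter_source g x s]
  refine le_antisymm ?_ (le_iSup (chartVolume g) x _)
  have h : riemannianVolume g ≤ chartVolume g x +
      ((⊤ : ℝ≥0∞) • Measure.count).restrict (extChartAt (𝓡 n) x).sourceᶜ :=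
    iSup_le fun x' => chartVolume_le g x x'
  refine (h _).trans ?_
  rw [Measure.add_apply, Measure.restrict_apply (hs.inter hx), Set.inter_assoc,
    Set.inter_compl_self, Set.inter_empty, measure_empty, add_zero]

theorem setLIntegral_riemannianVolume (g : SmoothMetric n M) (x : M) {f : M → ℝ≥0∞}
    (hf : Measurable f) :
    ∫⁻ p in (extChartAt (𝓡 n) x).source, f p ∂riemannianVolume g =
      ∫⁻ y in (extChartAt (𝓡 n) x).target,
        ENNReal.ofReal (volumeDensity g x y) * f ((extChartAt (𝓡 n) x).symm y) := by
  rw [restrict_riemannianVolume, chartVolume, lintegral_map' hf.aemeasurable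
    ((aemeasurable_extChartAt_symm x).mono_ac (withDensity_absolutelyContinuous _ _)),
    lintegral_withDensity_eq_lintegral_mul₀ (aemeasurable_ofReal_volumeDensity g x)
      (g := fun y => f ((extChartAt (𝓡 n) x).symm y))
      (hf.comp_aemeasurable (aemeasurable_extChartAt_symm x))]
  rfl

theorem setIntegral_riemannianVolume (g : SmoothMetric n M) (x : M) {f : M → ℂ}
    (hf : Continuous f) :
    ∫ p in (extChartAt (𝓡 n) x).source, f p ∂riemannianVolume g =
      ∫ y in (extChartAt (𝓡 n) x).target,
        volumeDensity g x y * f ((extChartAt (𝓡 n) x).symm y) := by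
  rw [restrict_riemannianVolume, chartVolume, integral_map
    ((aemeasurable_extChartAt_symm x).mono_ac (withDensity_absolutelyContinuous _ _))
    hf.aestronglyMeasurable, integral_withDensity_eq_integral_toReal_smul₀
      (aemeasurable_ofReal_volumeDensity g x) (ae_of_all _ fun _ => ENNReal.ofReal_lt_top)]
  refine setIntegral_congr_fun (measurableSet_extChartAt_target x) fun y hy => ?_
  simp only [ENNReal.toReal_ofReal (volumeDensity_pos g hy).le, Complex.real_smul]

instance isLocallyFiniteMeasure_riemannianVolume (g : SmoothMetric n M) :
    IsLocallyFiniteMeasure (riemannianVolume g) := by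
  refine ⟨fun x => ?_⟩
  have hT : (extChartAt (𝓡 n) x).target ∈ 𝓝 (extChartAt (𝓡 n) x x) :=
    (isOpen_extChartAt_target x).mem_nhds (mem_extChartAt_target x)
  obtain ⟨K, hK, hKT, hKc⟩ := local_compact_nhds hT
  refine ⟨(extChartAt (𝓡 n) x).source ∩ extChartAt (𝓡 n) x ⁻¹' interior K, ?_, ?_⟩
  · exact inter_mem (extChartAt_source_mem_nhds x)
      ((continuousAt_extChartAt x).preimage_mem_nhds (interior_mem_nhds.2 hK))
  have hO : IsOpen ((extChartAt (𝓡 n) x).source ∩ extChartAt (𝓡 n) x ⁻¹' interior K) :=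
    (continuousOn_extChartAt x).isOpen_inter_preimage (isOpen_extChartAt_source x) isOpen_interior
  rw [← Set.inter_self (extChartAt (𝓡 n) x).source, Set.inter_assoc, Set.inter_comm,
    ← Measure.restrict_apply hO.measurableSet, restrict_riemannianVolume,
    chartVolume_apply g x hO.measurableSet]
  have hcont := (contDiffOn_volumeDensity g x).continuousOn.mono hKT
  obtain ⟨C, hC⟩ := hKc.exists_bound_of_continuousOn hcont
  have hsub : (extChartAt (𝓡 n) x).target ∩ (extChartAt (𝓡 n) x).symm ⁻¹'
      ((extChartAt (𝓡 n) x).source ∩ extChartAt (𝓡 n) x ⁻¹' interior K) ⊆ K := by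
    rintro y ⟨hy, -, hy'⟩
    rw [Set.mem_preimage, (extChartAt (𝓡 n) x).right_inv hy] at hy'
    exact interior_subset hy'
  calc _ ≤ ∫⁻ y in K, ENNReal.ofReal (volumeDensity g x y) := lintegral_mono_set hsub
    _ ≤ ∫⁻ _ in K, ENNReal.ofReal C := setLIntegral_mono' hKc.measurableSet fun y hy =>
        ENNReal.ofReal_le_ofReal ((le_abs_self _).trans (hC y hy))
    _ < ⊤ := by
        rw [setLIntegral_const]
        exact ENNReal.mul_lt_top ENNReal.ofReal_lt_top hKc.measure_lt_top

instance isOpenPosMeasure_riemannianVolume (g : SmoothMetric n M) :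
    (riemannianVolume g).IsOpenPosMeasure := by
  refine ⟨fun U hU ⟨x, hx⟩ h0 => ?_⟩
  have h1 : chartVolume g x U = 0 := le_antisymm ((le_iSup (chartVolume g) x U).trans h0.le) zero_le
  rw [chartVolume_apply g x hU.measurableSet] at h1
  have hO : IsOpen ((extChartAt (𝓡 n) x).target ∩ (extChartAt (𝓡 n) x).symm ⁻¹' U) :=
    (continuousOn_extChartAt_symm x).isOpen_inter_preimage (isOpen_extChartAt_target x) hU
  rw [lintegral_eq_zero_iff' ((aemeasurable_ofReal_volumeDensity g x).mono_set
    Set.inter_subset_left)] at h1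
  have h2 : (volume : Measure (EuclideanSpace ℝ (Fin n)))
      ((extChartAt (𝓡 n) x).target ∩ (extChartAt (𝓡 n) x).symm ⁻¹' U) = 0 := by
    rw [← Measure.restrict_eq_zero, ← ae_eq_bot, ← Filter.eventually_false_iff_eq_bot]
    filter_upwards [h1, ae_restrict_mem hO.measurableSet] with y hy hy'
    have := volumeDensity_pos g hy'.1
    simp only [Pi.zero_apply, ENNReal.ofReal_eq_zero] at hy
    linarith
  refine hO.measure_ne_zero volume ⟨extChartAt (𝓡 n) x x, mem_extChartAt_target x, ?_⟩ h2
  rwa [Set.mem_preimage, extChartAt_to_inv]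

end Volume

/-! ### Functions supported in the domain of a chart -/

section ChartPush

variable {n : ℕ} {M : Type*} [TopologicalSpace M] [ChartedSpace (EuclideanSpace ℝ (Fin n)) M]

/-- The function `w` in the coordinates of the chart at `x`, extended by `0`. -/
noncomputable def chartPush (x : M) (w : M → ℂ) : EuclideanSpace ℝ (Fin n) → ℂ :=
  (extChartAt (𝓡 n) x).target.indicator (w ∘ (extChartAt (𝓡 n) x).symm)

theorem chartPush_apply {x : M} {y : EuclideanSpace ℝ (Fin n)}
    (hy : y ∈ (extChartAt (𝓡 n) x).target) (w : M → ℂ) :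
    chartPush x w y = w ((extChartAt (𝓡 n) x).symm y) :=
  Set.indicator_of_mem hy _

theorem chartPush_eventuallyEq {x : M} {y : EuclideanSpace ℝ (Fin n)}
    (hy : y ∈ (extChartAt (𝓡 n) x).target) (w : M → ℂ) :
    chartPush x w =ᶠ[𝓝 y] w ∘ (extChartAt (𝓡 n) x).symm := by
  filter_upwards [(isOpen_extChartAt_target x).mem_nhds hy] with z hz
  exact chartPush_apply hz w

theorem partialDeriv_chartPush {x : M} {y : EuclideanSpace ℝ (Fin n)}
    (hy : y ∈ (extChartAt (𝓡 n) x).target) (w : M → ℂ) (i : Fin n) :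
    partialDeriv i (chartPush x w) y = chartDifferential x w y i :=
  partialDeriv_congr (chartPush_eventuallyEq hy w)

theorem image_tsupport_subset_target {x : M} {w : M → ℂ}
    (hw : tsupport w ⊆ (extChartAt (𝓡 n) x).source) :
    extChartAt (𝓡 n) x '' tsupport w ⊆ (extChartAt (𝓡 n) x).target :=
  Set.image_subset_iff.2 fun _ hp => (extChartAt (𝓡 n) x).map_source (hw hp)

theorem support_chartPush_subset (x : M) (w : M → ℂ) :
    Function.support (chartPush (n := n) x w) ⊆ extChartAt (𝓡 n) x '' tsupport w := by
  intro y hy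
  have hyT : y ∈ (extChartAt (𝓡 n) x).target := by
    by_contra h
    exact hy (Set.indicator_of_notMem h _)
  refine ⟨(extChartAt (𝓡 n) x).symm y, subset_tsupport _ ?_, (extChartAt (𝓡 n) x).right_inv hyT⟩
  rwa [Function.mem_support, chartPush_apply hyT] at hy

variable [CompactSpace M]

theorem isCompact_image_tsupport {x : M} {w : M → ℂ}
    (hw : tsupport w ⊆ (extChartAt (𝓡 n) x).source) :
    IsCompact (extChartAt (𝓡 n) x '' tsupport w) :=
  (isClosed_tsupport w).isCompact.image_of_continuousOn ((continuousOn_extChartAt x).mono hw)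

theorem tsupport_chartPush_subset {x : M} {w : M → ℂ}
    (hw : tsupport w ⊆ (extChartAt (𝓡 n) x).source) :
    tsupport (chartPush (n := n) x w) ⊆ extChartAt (𝓡 n) x '' tsupport w :=
  closure_minimal (support_chartPush_subset x w) (isCompact_image_tsupport hw).isClosed

theorem hasCompactSupport_chartPush {x : M} {w : M → ℂ}
    (hw : tsupport w ⊆ (extChartAt (𝓡 n) x).source) :
    HasCompactSupport (chartPush (n := n) x w) :=
  (isCompact_image_tsupport hw).of_isClosed_subset (isClosed_tsupport _)
    (tsupport_chartPush_subset hw)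

theorem contDiff_chartPush [IsManifold (𝓡 n) ∞ M] {x : M} {w : M → ℂ}
    (hws : ContMDiff (𝓡 n) 𝓘(ℝ, ℂ) ∞ w) (hw : tsupport w ⊆ (extChartAt (𝓡 n) x).source) :
    ContDiff ℝ ∞ (chartPush (n := n) x w) := by
  refine contDiff_iff_contDiffAt.2 fun y => ?_
  by_cases hy : y ∈ (extChartAt (𝓡 n) x).target
  · exact ((hws.contDiffOn_comp_extChartAt_symm x).contDiffAt
      ((isOpen_extChartAt_target x).mem_nhds hy)).congr_of_eventuallyEq
        (chartPush_eventuallyEq hy w)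
  · have hy' : y ∉ tsupport (chartPush x w) := fun h =>
      hy (image_tsupport_subset_target hw (tsupport_chartPush_subset hw h))
    exact contDiffAt_const.congr_of_eventuallyEq (notMem_tsupport_iff_eventuallyEq.1 hy')

end ChartPush

/-! ### Green's formula on a compact manifold -/

section RiemannianGreen

variable {n : ℕ} {M : Type*} [TopologicalSpace M] [ChartedSpace (EuclideanSpace ℝ (Fin n)) M]

theorem chartDifferential_of_notMem_tsupport {w : M → ℂ} {p : M} (hp : p ∉ tsupport w) :
    chartDifferential p w (extChartAt (𝓡 n) p p) = 0 := by
  have h : w ∘ (extChartAt (𝓡 n) p).symm =ᶠ[𝓝 (extChartAt (𝓡 n) p p)] fun _ => 0 := by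
    have h1 : ContinuousAt (extChartAt (𝓡 n) p).symm (extChartAt (𝓡 n) p p) :=
      continuousAt_extChartAt_symm p
    have h2 := notMem_tsupport_iff_eventuallyEq.1 hp
    rw [← extChartAt_to_inv (I := 𝓡 n) p] at h2
    exact h1.eventually h2
  ext i
  rw [chartDifferential, partialDeriv_congr h, partialDeriv]
  simp

theorem chartDifferential_add [IsManifold (𝓡 n) ∞ M] {u v : M → ℂ}
    (hu : ContMDiff (𝓡 n) 𝓘(ℝ, ℂ) ∞ u)
    (hv : ContMDiff (𝓡 n) 𝓘(ℝ, ℂ) ∞ v) {x : M} {y : EuclideanSpace ℝ (Fin n)}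
    (hy : y ∈ (extChartAt (𝓡 n) x).target) :
    chartDifferential x (u + v) y = chartDifferential x u y + chartDifferential x v y :=
  funext fun _ => partialDeriv_add (hu.differentiableAt_comp_extChartAt_symm hy)
    (hv.differentiableAt_comp_extChartAt_symm hy)

theorem chartDifferential_smul [IsManifold (𝓡 n) ∞ M] (c : ℂ) {u : M → ℂ}
    (hu : ContMDiff (𝓡 n) 𝓘(ℝ, ℂ) ∞ u) {x : M} {y : EuclideanSpace ℝ (Fin n)}
    (hy : y ∈ (extChartAt (𝓡 n) x).target) :
    chartDifferential x (c • u) y = c • chartDifferential x u y :=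
  funext fun _ => partialDeriv_const_mul c (hu.differentiableAt_comp_extChartAt_symm hy)

theorem chartDifferential_conjFun (x : M) (u : M → ℂ) (y : EuclideanSpace ℝ (Fin n))
    (i : Fin n) :
    chartDifferential x (conjFun u) y i = starRingEnd ℂ (chartDifferential x u y i) :=
  congrFun (partialDeriv_conjFun i (u ∘ (extChartAt (𝓡 n) x).symm)) y

theorem ContMDiff.conjFun {u : M → ℂ} (hu : ContMDiff (𝓡 n) 𝓘(ℝ, ℂ) ∞ u) :
    ContMDiff (𝓡 n) 𝓘(ℝ, ℂ) ∞ (_root_.conjFun u) :=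
  Complex.conjCLE.contDiff.contMDiff.comp hu

variable [IsManifold (𝓡 n) ∞ M]

theorem laplaceBeltrami_add (g : SmoothMetric n M) {u v : M → ℂ}
    (hu : ContMDiff (𝓡 n) 𝓘(ℝ, ℂ) ∞ u) (hv : ContMDiff (𝓡 n) 𝓘(ℝ, ℂ) ∞ v) :
    laplaceBeltrami g (u + v) = laplaceBeltrami g u + laplaceBeltrami g v := by
  ext p
  have hp := mem_extChartAt_target (I := 𝓡 n) p
  have hT := (isOpen_extChartAt_target (I := 𝓡 n) p).mem_nhds hp
  rw [Pi.add_apply]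
  simp only [laplaceBeltrami_eq_chartLaplacian_self, chartLaplacian]
  rw [← mul_add, ← Finset.sum_add_distrib]
  congr 1
  refine Finset.sum_congr rfl fun i _ => ?_
  rw [← partialDeriv_add
    (((contDiffOn_chartFlux g p hu i).contDiffAt hT).differentiableAt (by simp))
    (((contDiffOn_chartFlux g p hv i).contDiffAt hT).differentiableAt (by simp))]
  refine partialDeriv_congr ?_
  filter_upwards [hT] with y hy
  simp only [chartFlux, chartDifferential_add hu hv hy, Pi.add_apply, mul_add,
    Finset.sum_add_distrib]

theorem laplaceBeltrami_smul (g : SmoothMetric n M) (c : ℂ) {u : M → ℂ}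
    (hu : ContMDiff (𝓡 n) 𝓘(ℝ, ℂ) ∞ u) :
    laplaceBeltrami g (c • u) = c • laplaceBeltrami g u := by
  ext p
  have hp := mem_extChartAt_target (I := 𝓡 n) p
  have hT := (isOpen_extChartAt_target (I := 𝓡 n) p).mem_nhds hp
  rw [Pi.smul_apply, smul_eq_mul]
  simp only [laplaceBeltrami_eq_chartLaplacian_self, chartLaplacian]
  rw [mul_left_comm]
  congr 1
  rw [Finset.mul_sum]
  refine Finset.sum_congr rfl fun i _ => ?_
  rw [← partialDeriv_const_mul c
    (((contDiffOn_chartFlux g p hu i).contDiffAt hT).differentiableAt (by simp))]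
  refine partialDeriv_congr ?_
  filter_upwards [hT] with y hy
  simp only [chartFlux, chartDifferential_smul c hu hy, Pi.smul_apply, smul_eq_mul,
    mul_left_comm _ c, ← Finset.mul_sum]

theorem laplaceBeltrami_conjFun (g : SmoothMetric n M) (u : M → ℂ) :
    laplaceBeltrami g (conjFun u) = conjFun (laplaceBeltrami g u) := by
  ext p
  have h : ∀ i, chartFlux g p (conjFun u) i = conjFun (chartFlux g p u i) := fun i => by
    ext y
    simp only [chartFlux, chartDifferential_conjFun, conjFun, map_mul, map_sum,
      Complex.conj_ofReal]
  rw [conjFun]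
  simp only [laplaceBeltrami_eq_chartLaplacian_self, chartLaplacian, h, partialDeriv_conjFun,
    map_mul, map_sum, Complex.conj_ofReal]
  rfl

theorem gradInner_add_right (g : SmoothMetric n M) (u : M → ℂ) {v w : M → ℂ}
    (hv : ContMDiff (𝓡 n) 𝓘(ℝ, ℂ) ∞ v) (hw : ContMDiff (𝓡 n) 𝓘(ℝ, ℂ) ∞ w) (p : M) :
    gradInner g u (v + w) p = gradInner g u v p + gradInner g u w p := by
  rw [gradInner, chartGradInner, chartDifferential_add hv hw (mem_extChartAt_target p),
    Matrix.mulVec_add, dotProduct_add]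
  rfl

theorem gradInner_of_notMem_tsupport (g : SmoothMetric n M) (u : M → ℂ) {w : M → ℂ} {p : M}
    (hp : p ∉ tsupport w) : gradInner g u w p = 0 := by
  rw [gradInner, chartGradInner, chartDifferential_of_notMem_tsupport hp, Matrix.mulVec_zero,
    dotProduct_zero]

theorem gradInner_conjFun (g : SmoothMetric n M) (u v : M → ℂ) (p : M) :
    gradInner g (conjFun u) (conjFun v) p = starRingEnd ℂ (gradInner g u v p) := by
  simp only [gradInner, chartGradInner_eq_sum, chartDifferential_conjFun, map_sum, map_mul,
    Complex.conj_ofReal]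

/-- The squared length `|∇u|²` of the gradient of a complex function. -/
noncomputable def gradNormSq (g : SmoothMetric n M) (u : M → ℂ) (p : M) : ℝ :=
  (gradInner g (conjFun u) u p).re

theorem gradInner_conjFun_self (g : SmoothMetric n M) (u : M → ℂ) (p : M) :
    gradInner g (conjFun u) u p = gradNormSq g u p := by
  refine (Complex.conj_eq_iff_re.1 ?_).symm
  have hc : conjFun (conjFun u) = u := funext fun q => Complex.conj_conj (u q)
  rw [← gradInner_conjFun, hc, gradInner_comm]

theorem chartGradInner_conjFun_self_re (g : SmoothMetric n M) (x : M) (u : M → ℂ)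
    (y : EuclideanSpace ℝ (Fin n)) : (chartGradInner g x (conjFun u) u y).re =
      (fun i => (chartDifferential x u y i).re) ⬝ᵥ
          ((metricMatrix g x y)⁻¹.mulVec fun i => (chartDifferential x u y i).re) +
        (fun i => (chartDifferential x u y i).im) ⬝ᵥ
          ((metricMatrix g x y)⁻¹.mulVec fun i => (chartDifferential x u y i).im) := by
  simp only [chartGradInner_eq_sum, chartDifferential_conjFun, dotProduct, Matrix.mulVec,
    Finset.mul_sum, Complex.re_sum]
  rw [← Finset.sum_add_distrib]
  refine Finset.sum_congr rfl fun i _ => ?_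
  rw [← Finset.sum_add_distrib]
  refine Finset.sum_congr rfl fun j _ => ?_
  simp

theorem gradNormSq_nonneg (g : SmoothMetric n M) (u : M → ℂ) (p : M) : 0 ≤ gradNormSq g u p := by
  have h := (posDef_metricMatrix g (mem_extChartAt_target (I := 𝓡 n) p)).inv.posSemidef
  rw [gradNormSq, gradInner, chartGradInner_conjFun_self_re]
  exact add_nonneg (by simpa using h.dotProduct_mulVec_nonneg _)
    (by simpa using h.dotProduct_mulVec_nonneg _)

theorem continuous_chartLaplacian_mul (g : SmoothMetric n M) {x : M} {u w : M → ℂ}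
    (hu : ContMDiff (𝓡 n) 𝓘(ℝ, ℂ) ∞ u) (hw : Continuous w)
    (hwx : tsupport w ⊆ (extChartAt (𝓡 n) x).source) :
    Continuous fun p => chartLaplacian g x u (extChartAt (𝓡 n) x p) * w p := by
  refine continuous_of_tsupport fun p hp => ?_
  have hpx : p ∈ (extChartAt (𝓡 n) x).source := hwx (tsupport_mul_subset_right hp)
  have h1 : ContinuousAt (chartLaplacian g x u) (extChartAt (𝓡 n) x p) :=
    (contDiffOn_chartLaplacian g x hu).continuousOn.continuousAt
      ((isOpen_extChartAt_target x).mem_nhds ((extChartAt (𝓡 n) x).map_source hpx))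
  exact (h1.comp (continuousAt_extChartAt' hpx)).mul hw.continuousAt

variable [CompactSpace M] [MeasurableSpace M] [BorelSpace M]

/-- Green's formula, tested against a function supported in the domain of the chart at `x`. -/
theorem integral_chartLaplacian_comp_mul (g : SmoothMetric n M) {x : M} {u w : M → ℂ}
    (hu : ContMDiff (𝓡 n) 𝓘(ℝ, ℂ) ∞ u) (hw : ContMDiff (𝓡 n) 𝓘(ℝ, ℂ) ∞ w)
    (hwx : tsupport w ⊆ (extChartAt (𝓡 n) x).source) :
    ∫ p, chartLaplacian g x u (extChartAt (𝓡 n) x p) * w p ∂riemannianVolume g =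
      -∫ p, gradInner g u w p ∂riemannianVolume g := by
  have hTm := measurableSet_extChartAt_target (n := n) x
  have hw0 : ∀ p, p ∉ (extChartAt (𝓡 n) x).source → p ∉ tsupport w := fun p hp h => hp (hwx h)
  have hT0 : ∀ y, y ∉ (extChartAt (𝓡 n) x).target → y ∉ tsupport (chartPush x w) := fun y hy h =>
    hy (image_tsupport_subset_target hwx (tsupport_chartPush_subset hwx h))
  rw [← setIntegral_eq_integral_of_forall_compl_eq_zero (s := (extChartAt (𝓡 n) x).source)
      (fun p hp => by rw [image_eq_zero_of_notMem_tsupport (hw0 p hp), mul_zero]),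
    ← setIntegral_eq_integral_of_forall_compl_eq_zero (f := gradInner g u w)
      (s := (extChartAt (𝓡 n) x).source)
      (fun p hp => gradInner_of_notMem_tsupport g u (hw0 p hp)),
    setIntegral_riemannianVolume g x (continuous_chartLaplacian_mul g hu hw.continuous hwx),
    setIntegral_riemannianVolume g x (continuous_gradInner g hu hw)]
  have hgreen := integral_chartLaplacian_mul g x hu
    ((contDiff_chartPush hw hwx).of_le (by exact_mod_cast le_top))
    (hasCompactSupport_chartPush hwx)
    ((tsupport_chartPush_subset hwx).trans (image_tsupport_subset_target hwx))
  rw [← setIntegral_eq_integral_of_forall_compl_eq_zero (s := (extChartAt (𝓡 n) x).target)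
      (fun y hy => by rw [image_eq_zero_of_notMem_tsupport (hT0 y hy), mul_zero, mul_zero]),
    ← setIntegral_eq_integral_of_forall_compl_eq_zero (s := (extChartAt (𝓡 n) x).target)
      (f := fun y => ∑ i, chartFlux g x u i y * partialDeriv i (chartPush x w) y)
      (fun y hy => Finset.sum_eq_zero fun i _ => by
        rw [partialDeriv_of_notMem_tsupport i (hT0 y hy), mul_zero])] at hgreen
  have e1 : ∀ y ∈ (extChartAt (𝓡 n) x).target,
      (volumeDensity g x y : ℂ) * (chartLaplacian g x u y * chartPush x w y) =
      volumeDensity g x y * (chartLaplacian g x u (extChartAt (𝓡 n) x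
        ((extChartAt (𝓡 n) x).symm y)) * w ((extChartAt (𝓡 n) x).symm y)) := fun y hy => by
    rw [(extChartAt (𝓡 n) x).right_inv hy, chartPush_apply hy]
  have e2 : ∀ y ∈ (extChartAt (𝓡 n) x).target,
      ∑ i, chartFlux g x u i y * partialDeriv i (chartPush x w) y =
      volumeDensity g x y * gradInner g u w ((extChartAt (𝓡 n) x).symm y) := fun y hy => by
    rw [gradInner_eq_chartGradInner g hu hw ((extChartAt (𝓡 n) x).map_target hy),
      (extChartAt (𝓡 n) x).right_inv hy, ← sum_chartFlux_mul]
    simp only [partialDeriv_chartPush hy]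
  rwa [setIntegral_congr_fun hTm e1, setIntegral_congr_fun hTm e2] at hgreen

variable [T2Space M]

/-- The Laplace-Beltrami operator does not depend on the chart: by Green's formula its
expressions in two charts have the same integrals against all test functions supported in both. -/
theorem laplaceBeltrami_eq_chartLaplacian (g : SmoothMetric n M) {u : M → ℂ}
    (hu : ContMDiff (𝓡 n) 𝓘(ℝ, ℂ) ∞ u) {x p : M} (hp : p ∈ (extChartAt (𝓡 n) x).source) :
    laplaceBeltrami g u p = chartLaplacian g x u (extChartAt (𝓡 n) x p) := by
  set O := (extChartAt (𝓡 n) p).source ∩ (extChartAt (𝓡 n) x).source with hO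
  have hOo : IsOpen O := (isOpen_extChartAt_source p).inter (isOpen_extChartAt_source x)
  have hc : ∀ z, ContinuousOn (fun q => chartLaplacian g z u (extChartAt (𝓡 n) z q))
      (extChartAt (𝓡 n) z).source := fun z =>
    (contDiffOn_chartLaplacian g z hu).continuousOn.comp (continuousOn_extChartAt z)
      fun q hq => (extChartAt (𝓡 n) z).map_source hq
  have hcp := (hc p).mono (Set.inter_subset_left : O ⊆ _)
  have hcx := (hc x).mono (Set.inter_subset_right : O ⊆ _)
  have h := hOo.ae_eq_zero_of_integral_contMDiff_smul_eq_zero (𝓡 n) (μ := riemannianVolume g)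
    (f := fun q => chartLaplacian g p u (extChartAt (𝓡 n) p q) -
      chartLaplacian g x u (extChartAt (𝓡 n) x q))
    ((hcp.sub hcx).locallyIntegrableOn hOo.measurableSet) fun ψ hψ _ hψO => by
      have hw : ContMDiff (𝓡 n) 𝓘(ℝ, ℂ) ∞ fun q => (ψ q : ℂ) :=
        Complex.ofRealCLM.contDiff.contMDiff.comp hψ
      have hs : Function.support (fun q => (ψ q : ℂ)) ⊆ Function.support ψ :=
        fun q hq h0 => hq (by simp [h0])
      have hts : tsupport (fun q => (ψ q : ℂ)) ⊆ O := (closure_mono hs).trans hψO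
      have hp' := hts.trans Set.inter_subset_left
      have hx' := hts.trans Set.inter_subset_right
      have e : ∀ q, ψ q • (chartLaplacian g p u (extChartAt (𝓡 n) p q) -
          chartLaplacian g x u (extChartAt (𝓡 n) x q)) =
          chartLaplacian g p u (extChartAt (𝓡 n) p q) * (ψ q : ℂ) -
          chartLaplacian g x u (extChartAt (𝓡 n) x q) * (ψ q : ℂ) := fun q => by
        rw [Complex.real_smul]; ring
      simp only [e]
      rw [integral_sub, integral_chartLaplacian_comp_mul g hu hw hp',
        integral_chartLaplacian_comp_mul g hu hw hx', sub_self]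
      · exact (continuous_chartLaplacian_mul g hu hw.continuous hp').integrable_of_hasCompactSupport
          (HasCompactSupport.of_compactSpace _)
      · exact (continuous_chartLaplacian_mul g hu hw.continuous hx').integrable_of_hasCompactSupport
          (HasCompactSupport.of_compactSpace _)
  have hae : (fun q => chartLaplacian g p u (extChartAt (𝓡 n) p q)) =ᵐ[(riemannianVolume g).restrict
      O] fun q => chartLaplacian g x u (extChartAt (𝓡 n) x q) := by
    filter_upwards [ae_restrict_of_ae h, ae_restrict_mem hOo.measurableSet] with q hq hqO
    exact sub_eq_zero.1 (hq hqO)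
  exact Measure.eqOn_open_of_ae_eq hae hOo hcp hcx ⟨mem_extChartAt_source p, hp⟩

theorem continuous_laplaceBeltrami (g : SmoothMetric n M) {u : M → ℂ}
    (hu : ContMDiff (𝓡 n) 𝓘(ℝ, ℂ) ∞ u) : Continuous (laplaceBeltrami g u) := by
  refine continuous_iff_continuousAt.2 fun p => ?_
  have h1 : ContinuousAt (chartLaplacian g p u) (extChartAt (𝓡 n) p p) :=
    (contDiffOn_chartLaplacian g p hu).continuousOn.continuousAt
      ((isOpen_extChartAt_target p).mem_nhds (mem_extChartAt_target p))
  refine (h1.comp (continuousAt_extChartAt p)).congr ?_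
  filter_upwards [extChartAt_source_mem_nhds (I := 𝓡 n) p] with q hq
  exact (laplaceBeltrami_eq_chartLaplacian g hu hq).symm

end RiemannianGreen

/-! ### The Dirichlet Laplacian of a compact manifold -/

section RiemannianDirichlet

variable {n : ℕ} {M : Type*} [TopologicalSpace M] [ChartedSpace (EuclideanSpace ℝ (Fin n)) M]

theorem ContMDiff.complex_mul {u v : M → ℂ} (hu : ContMDiff (𝓡 n) 𝓘(ℝ, ℂ) ∞ u)
    (hv : ContMDiff (𝓡 n) 𝓘(ℝ, ℂ) ∞ v) : ContMDiff (𝓡 n) 𝓘(ℝ, ℂ) ∞ fun p => u p * v p :=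
  (contDiff_mul (𝕜 := ℝ) (𝔸 := ℂ)).contMDiff.comp (hu.prodMk_space hv)

/-- The smooth compactly supported functions on a manifold, as a subspace. -/
def manifoldTestFunctions (n : ℕ) (M : Type*) [TopologicalSpace M]
    [ChartedSpace (EuclideanSpace ℝ (Fin n)) M] : Submodule ℂ (M → ℂ) where
  carrier := {u | ContMDiff (𝓡 n) 𝓘(ℝ, ℂ) ∞ u ∧ HasCompactSupport u}
  add_mem' hu hv := ⟨hu.1.add hv.1, hu.2.add hv.2⟩
  zero_mem' := ⟨contMDiff_const, HasCompactSupport.zero⟩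
  smul_mem' _ _ hu := ⟨contMDiff_const.complex_mul hu.1, hu.2.smul_left⟩

variable [IsManifold (𝓡 n) ∞ M] [CompactSpace M] [T2Space M]

theorem exists_finite_smooth_partition (n : ℕ) (M : Type*) [TopologicalSpace M]
    [ChartedSpace (EuclideanSpace ℝ (Fin n)) M] [IsManifold (𝓡 n) ∞ M] [CompactSpace M]
    [T2Space M] : ∃ (t : Finset M) (ρ : M → M → ℝ),
      (∀ x, ContMDiff (𝓡 n) 𝓘(ℝ, ℝ) ∞ (ρ x)) ∧
      (∀ x, tsupport (ρ x) ⊆ (extChartAt (𝓡 n) x).source) ∧ ∀ p, ∑ x ∈ t, ρ x p = 1 := by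
  obtain ⟨f, hf⟩ := SmoothPartitionOfUnity.exists_isSubordinate_chartAt_source (𝓡 n) M
  have hfin := f.locallyFinite.finite_nonempty_of_compact
  refine ⟨hfin.toFinset, fun x => f x, fun x => (f x).contMDiff, fun x => ?_, fun p => ?_⟩
  · rw [extChartAt_source]
    exact hf x
  · rw [← f.sum_eq_one (Set.mem_univ p)]
    refine (finsum_eq_sum_of_support_subset _ fun x hx => ?_).symm
    exact hfin.mem_toFinset.2 ⟨p, hx⟩

variable [MeasurableSpace M] [BorelSpace M]

/-- Green's formula on a compact manifold. -/
theorem integral_laplaceBeltrami_mul (g : SmoothMetric n M) {u v : M → ℂ}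
    (hu : ContMDiff (𝓡 n) 𝓘(ℝ, ℂ) ∞ u) (hv : ContMDiff (𝓡 n) 𝓘(ℝ, ℂ) ∞ v) :
    ∫ p, laplaceBeltrami g u p * v p ∂riemannianVolume g =
      -∫ p, gradInner g u v p ∂riemannianVolume g := by
  obtain ⟨t, ρ, hρ, hρs, hρ1⟩ := exists_finite_smooth_partition n M
  have hw : ∀ x, ContMDiff (𝓡 n) 𝓘(ℝ, ℂ) ∞ fun p => (ρ x p : ℂ) * v p := fun x =>
    (Complex.ofRealCLM.contDiff.contMDiff.comp (hρ x)).complex_mul hv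
  have hws : ∀ x, tsupport (fun p => (ρ x p : ℂ) * v p) ⊆ (extChartAt (𝓡 n) x).source := by
    intro x
    have hs : Function.support (fun p => (ρ x p : ℂ) * v p) ⊆ Function.support (ρ x) :=
      fun q hq h0 => hq (by simp [h0])
    exact (closure_mono hs).trans (hρs x)
  have hsum : ∀ p, v p = ∑ x ∈ t, (ρ x p : ℂ) * v p := fun p => by
    rw [← Finset.sum_mul, ← Complex.ofReal_sum, hρ1, Complex.ofReal_one, one_mul]
  have hint : ∀ f : M → ℂ, Continuous f → Integrable f (riemannianVolume g) := fun f hf =>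
    hf.integrable_of_hasCompactSupport (HasCompactSupport.of_compactSpace _)
  have hgrad : ∀ p, gradInner g u v p =
      ∑ x ∈ t, gradInner g u (fun p => (ρ x p : ℂ) * v p) p := by
    intro p
    have hs : ∀ s : Finset M, ContMDiff (𝓡 n) 𝓘(ℝ, ℂ) ∞ (∑ x ∈ s, fun p => (ρ x p : ℂ) * v p) ∧
        gradInner g u (∑ x ∈ s, fun p => (ρ x p : ℂ) * v p) p =
          ∑ x ∈ s, gradInner g u (fun p => (ρ x p : ℂ) * v p) p := by
      classical
      intro s
      induction s using Finset.induction_on with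
      | empty =>
        refine ⟨contMDiff_const, ?_⟩
        rw [Finset.sum_empty, Finset.sum_empty]
        exact gradInner_of_notMem_tsupport g u (by simp [tsupport])
      | insert a s ha ih =>
        rw [Finset.sum_insert ha, Finset.sum_insert ha]
        exact ⟨(hw a).add ih.1, by rw [gradInner_add_right g u (hw a) ih.1, ih.2]⟩
    rw [← (hs t).2]
    congr 1
    ext q
    rw [Finset.sum_apply]
    exact hsum q
  have hL := continuous_laplaceBeltrami g hu
  have hmul : ∀ p, laplaceBeltrami g u p * v p =
      ∑ x ∈ t, laplaceBeltrami g u p * ((ρ x p : ℂ) * v p) := fun p => by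
    rw [← Finset.mul_sum, ← hsum p]
  simp only [hmul, hgrad]
  rw [integral_finsetSum _ fun x _ => hint (fun p => laplaceBeltrami g u p * ((ρ x p : ℂ) * v p))
      (hL.mul (hw x).continuous),
    integral_finsetSum _ fun x _ => hint _ (continuous_gradInner g hu (hw x)),
    ← Finset.sum_neg_distrib]
  refine Finset.sum_congr rfl fun x _ => ?_
  rw [← integral_chartLaplacian_comp_mul g hu (hw x) (hws x)]
  refine integral_congr_ae (ae_of_all _ fun p => ?_)
  by_cases hp : p ∈ (extChartAt (𝓡 n) x).source
  · simp only [laplaceBeltrami_eq_chartLaplacian g hu hp]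
  · have h0 : (ρ x p : ℂ) * v p = 0 :=
      image_eq_zero_of_notMem_tsupport (f := fun p => (ρ x p : ℂ) * v p) fun h => hp (hws x h)
    simp only [h0, mul_zero]

theorem exists_contMDiff_eLpNorm_sub_le {μ : Measure M} [IsFiniteMeasure μ] (f : Lp ℂ 2 μ)
    {ε : ℝ} (hε : 0 < ε) : ∃ u ∈ manifoldTestFunctions n M,
      eLpNorm (⇑f - u) 2 μ ≤ ENNReal.ofReal ε := by
  have := Manifold.metrizableSpace (𝓡 n) M
  have := ChartedSpace.secondCountable_of_sigmaCompact (EuclideanSpace ℝ (Fin n)) M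
  obtain ⟨f', -, hf', hf'c, hf'm⟩ := (Lp.memLp f).exists_hasCompactSupport_eLpNorm_sub_le
    (ε := ENNReal.ofReal (ε / 2)) (by simp) (by simpa using hε)
  set B : ℝ := (μ Set.univ ^ (1 / 2 : ℝ)).toReal with hB
  have hBt : μ Set.univ ^ (1 / 2 : ℝ) ≠ ⊤ := by simp
  obtain ⟨u, hu, -⟩ := hf'c.exists_contMDiff_approx (𝓡 n) ⊤
    (ε := fun _ => ε / 2 / (B + 1)) continuous_const (fun _ => by positivity)
  have hB0 : 0 ≤ B := ENNReal.toReal_nonneg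
  refine ⟨u, ⟨u.contMDiff, HasCompactSupport.of_compactSpace _⟩, ?_⟩
  have h2 : eLpNorm (f' - ⇑u) 2 μ ≤ ENNReal.ofReal (ε / 2) := by
    refine (eLpNorm_le_of_ae_bound (C := ε / 2 / (B + 1)) (ae_of_all _ fun p => ?_)).trans ?_
    · rw [Pi.sub_apply, ← dist_eq_norm, dist_comm]
      exact (hu p).le
    · rw [← ENNReal.ofReal_toReal (a := μ Set.univ ^ (2 : ℝ≥0∞).toReal⁻¹)
        (by simp), ← ENNReal.ofReal_mul ENNReal.toReal_nonneg]
      refine ENNReal.ofReal_le_ofReal ?_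
      have e : (μ Set.univ ^ (2 : ℝ≥0∞).toReal⁻¹).toReal = B := by simp [hB]
      rw [e, mul_div_assoc', div_le_iff₀ (by positivity)]
      nlinarith
  have h3 : ⇑f - ⇑u = (⇑f - f') + (f' - ⇑u) := by abel
  rw [h3]
  refine (eLpNorm_add_le ((Lp.memLp f).sub hf'm).aestronglyMeasurable
    (hf'c.sub u.contMDiff.continuous).aestronglyMeasurable (by norm_num)).trans ?_
  refine (add_le_add hf' h2).trans_eq ?_
  rw [← ENNReal.ofReal_add (by positivity) (by positivity), add_halves]

/-- The Laplace-Beltrami operator of a closed manifold, with the energy `∫ |∇u|²`. -/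
theorem isDirichletLaplacian_riemannian (g : SmoothMetric n M) :
    IsDirichletLaplacian (riemannianVolume g) (manifoldTestFunctions n M) (laplaceBeltrami g)
      fun u => ∫ p, gradNormSq g u p ∂riemannianVolume g := by
  refine IsDirichletLaplacian.of_green (Γ := gradInner g) (fun u hu => hu.1.continuous)
    (fun u hu => hu.2) (fun u hu v hv => laplaceBeltrami_add g hu.1 hv.1)
    (fun c u hu => laplaceBeltrami_smul g c hu.1) (fun u hu => ?_)
    (fun f ε hε => exists_contMDiff_eLpNorm_sub_le f hε)
    (fun u hu => ⟨hu.1.conjFun, HasCompactSupport.of_compactSpace _⟩)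
    (fun u _ => laplaceBeltrami_conjFun g u) (fun u _ v _ => gradInner_comm g u v)
    (fun u _ => gradInner_conjFun_self g u) (fun u _ => gradNormSq_nonneg g u)
    (fun u hu v hv => integral_laplaceBeltrami_mul g hu.1 hv.1)
  exact (continuous_laplaceBeltrami g hu.1).memLp_of_hasCompactSupport
    (HasCompactSupport.of_compactSpace _)

end RiemannianDirichlet

/-! ### Rellich's theorem on a compact manifold -/

section FormCompact

theorem IsFormCompactMultiplier.zero {X : Type*} [MeasurableSpace X] {μ : Measure X}
    {D : Submodule ℂ (X → ℂ)} {energy : (X → ℂ) → ℝ} :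
    IsFormCompactMultiplier μ D energy fun _ => 0 := fun _ _ _ =>
  ⟨Unit, inferInstance, fun _ => (), by simp⟩

theorem IsFormCompactMultiplier.add {X : Type*} [TopologicalSpace X] [MeasurableSpace X]
    [BorelSpace X] {μ : Measure X} {D : Submodule ℂ (X → ℂ)} {energy : (X → ℂ) → ℝ}
    (hD : ∀ u ∈ D, Continuous u) {k l : X → ℝ} (hkc : Continuous k)
    (hk : IsFormCompactMultiplier μ D energy k) (hl : IsFormCompactMultiplier μ D energy l) :
    IsFormCompactMultiplier μ D energy fun x => k x + l x := by
  intro C δ hδ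
  obtain ⟨ι, _, c, hc⟩ := hk C (δ / 8) (by positivity)
  obtain ⟨κ, _, d, hd⟩ := hl C (δ / 8) (by positivity)
  refine ⟨ι × κ, inferInstance, fun u => (c u, d u), fun u hu v hv h1 h2 h3 h4 h5 => ?_⟩
  have hm : Measurable fun x => ‖(k x : ℂ) * (u x - v x)‖ₑ ^ 2 :=
    ((Complex.continuous_ofReal.comp hkc).mul
      ((hD u hu).sub (hD v hv))).enorm.measurable.pow_const 2
  calc ∫⁻ x, ‖((k x + l x : ℝ) : ℂ) * (u x - v x)‖ₑ ^ 2 ∂μ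
      ≤ ∫⁻ x, 4 * (‖(k x : ℂ) * (u x - v x)‖ₑ ^ 2 + ‖(l x : ℂ) * (u x - v x)‖ₑ ^ 2) ∂μ := by
        refine lintegral_mono fun x => ?_
        rw [Complex.ofReal_add, add_mul]
        refine le_trans ?_ (ENNReal.add_sq_le_four _ _)
        gcongr
        exact enorm_add_le _ _
    _ = 4 * ((∫⁻ x, ‖(k x : ℂ) * (u x - v x)‖ₑ ^ 2 ∂μ) +
          ∫⁻ x, ‖(l x : ℂ) * (u x - v x)‖ₑ ^ 2 ∂μ) := by
        rw [lintegral_const_mul' _ _ (by norm_num), lintegral_add_left hm]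
    _ ≤ 4 * (ENNReal.ofReal (δ / 8) + ENNReal.ofReal (δ / 8)) := by
        gcongr
        · exact hc u hu v hv h1 h2 h3 h4 (congrArg Prod.fst h5)
        · exact hd u hu v hv h1 h2 h3 h4 (congrArg Prod.snd h5)
    _ = ENNReal.ofReal δ := by
        rw [← ENNReal.ofReal_add (by positivity) (by positivity),
          show (4 : ℝ≥0∞) = ENNReal.ofReal 4 by norm_num, ← ENNReal.ofReal_mul (by norm_num)]
        congr 1
        ring

theorem IsFormCompactMultiplier.sum {X : Type*} [TopologicalSpace X] [MeasurableSpace X]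
    [BorelSpace X] {μ : Measure X} {D : Submodule ℂ (X → ℂ)} {energy : (X → ℂ) → ℝ}
    (hD : ∀ u ∈ D, Continuous u) {ι : Type*} (t : Finset ι) {k : ι → X → ℝ}
    (hkc : ∀ i, Continuous (k i)) (hk : ∀ i, IsFormCompactMultiplier μ D energy (k i)) :
    IsFormCompactMultiplier μ D energy fun x => ∑ i ∈ t, k i x := by
  classical
  induction t using Finset.induction_on with
  | empty => simpa using IsFormCompactMultiplier.zero
  | insert a s ha ih =>
    simp only [Finset.sum_insert ha]
    exact (hk a).add hD (hkc a) ih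

/-- A continuous family of positive definite matrices is uniformly positive on a compact set. -/
theorem exists_pos_forall_le_dotProduct_mulVec {n : ℕ} {V : Type*} [TopologicalSpace V]
    {K : Set V} (hK : IsCompact K) {A : V → Matrix (Fin n) (Fin n) ℝ}
    (hA : ∀ i j, ContinuousOn (fun y => A y i j) K) (hpos : ∀ y ∈ K, (A y).PosDef) :
    ∃ c : ℝ, 0 < c ∧ ∀ y ∈ K, ∀ v : Fin n → ℝ, c * ∑ i, v i ^ 2 ≤ v ⬝ᵥ (A y).mulVec v := by
  have hS : IsCompact (K ×ˢ Metric.sphere (0 : EuclideanSpace ℝ (Fin n)) 1) :=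
    hK.prod (isCompact_sphere _ _)
  have hf : ContinuousOn (fun p : V × EuclideanSpace ℝ (Fin n) =>
      p.2.ofLp ⬝ᵥ (A p.1).mulVec p.2.ofLp) (K ×ˢ Metric.sphere 0 1) := by
    simp only [dotProduct, Matrix.mulVec]
    refine continuousOn_finsetSum _ fun i _ => ContinuousOn.mul (by fun_prop)
      (continuousOn_finsetSum _ fun j _ => ContinuousOn.mul ?_ (by fun_prop))
    exact (hA i j).comp continuousOn_fst fun p hp => hp.1
  obtain ⟨c, hc, hc'⟩ := hS.exists_forall_le' hf (a := 0) fun p hp => by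
    have h0 : p.2.ofLp ≠ 0 := fun h => by
      have h1 : p.2 = 0 := by ext i; exact congrFun h i
      have h2 := hp.2
      rw [h1] at h2
      simp at h2
    simpa using (hpos p.1 hp.1).dotProduct_mulVec_pos h0
  refine ⟨c, hc, fun y hy v => ?_⟩
  set w : EuclideanSpace ℝ (Fin n) := WithLp.toLp 2 v with hw
  have hn : ∑ i, v i ^ 2 = ‖w‖ ^ 2 := by rw [EuclideanSpace.real_norm_sq_eq]
  rw [hn]
  rcases eq_or_ne w 0 with h0 | h0
  · have hv : v = 0 := by simpa [hw] using congrArg WithLp.ofLp h0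
    rw [h0, hv]
    simp
  · have hw0 : 0 < ‖w‖ := norm_pos_iff.2 h0
    have h1 := hc' (y, ‖w‖⁻¹ • w) ⟨hy, by simp [norm_smul, hw0.ne']⟩
    simp only [WithLp.ofLp_smul, Matrix.mulVec_smul, smul_dotProduct, dotProduct_smul,
      smul_eq_mul] at h1
    have h2 := mul_le_mul_of_nonneg_right h1 (sq_nonneg ‖w‖)
    refine h2.trans_eq ?_
    change _ = w.ofLp ⬝ᵥ (A y).mulVec w.ofLp
    field_simp

variable {n : ℕ} {M : Type*} [TopologicalSpace M] [ChartedSpace (EuclideanSpace ℝ (Fin n)) M]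
  [IsManifold (𝓡 n) ∞ M]

/-- On a compact set of coordinates the Riemannian volume and the Riemannian length of gradients
are comparable to the Euclidean ones. -/
theorem exists_bounds_of_isCompact (g : SmoothMetric n M) {x : M}
    {K : Set (EuclideanSpace ℝ (Fin n))} (hK : IsCompact K)
    (hKT : K ⊆ (extChartAt (𝓡 n) x).target) :
    ∃ c B : ℝ, 0 < c ∧ c ≤ 1 ∧ 1 ≤ B ∧ ∀ y ∈ K, c ≤ volumeDensity g x y ∧
      volumeDensity g x y ≤ B ∧ ∀ u : M → ℂ, ContMDiff (𝓡 n) 𝓘(ℝ, ℂ) ∞ u →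
        c * ∑ i, ‖chartDifferential x u y i‖ ^ 2 ≤
          gradNormSq g u ((extChartAt (𝓡 n) x).symm y) := by
  have hd := (contDiffOn_volumeDensity g x).continuousOn.mono hKT
  obtain ⟨B, hB⟩ := hK.exists_bound_of_continuousOn hd
  obtain ⟨c1, hc1, hc1'⟩ := hK.exists_forall_le' hd (a := 0)
    fun y hy => volumeDensity_pos g (hKT hy)
  obtain ⟨c2, hc2, hc2'⟩ := exists_pos_forall_le_dotProduct_mulVec hK
    (A := fun y => (metricMatrix g x y)⁻¹)
    (fun i j => (contDiffOn_metricMatrix_inv g x i j).continuousOn.mono hKT)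
    fun y hy => (posDef_metricMatrix g (hKT hy)).inv
  refine ⟨min (min c1 c2) 1, max B 1, by positivity, min_le_right _ _, le_max_right _ _,
    fun y hy => ⟨(min_le_left _ _).trans ((min_le_left _ _).trans (hc1' y hy)),
      ((le_abs_self _).trans (hB y hy)).trans (le_max_left _ _), fun u hu => ?_⟩⟩
  rw [gradNormSq, gradInner_eq_chartGradInner g hu.conjFun hu
    ((extChartAt (𝓡 n) x).map_target (hKT hy)), (extChartAt (𝓡 n) x).right_inv (hKT hy),
    chartGradInner_conjFun_self_re]
  have h1 := hc2' y hy fun i => (chartDifferential x u y i).re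
  have h2 := hc2' y hy fun i => (chartDifferential x u y i).im
  have h3 : ∑ i, ‖chartDifferential x u y i‖ ^ 2 =
      ∑ i, (chartDifferential x u y i).re ^ 2 + ∑ i, (chartDifferential x u y i).im ^ 2 := by
    rw [← Finset.sum_add_distrib]
    refine Finset.sum_congr rfl fun i _ => ?_
    rw [Complex.sq_norm, Complex.normSq_apply]
    ring
  calc min (min c1 c2) 1 * ∑ i, ‖chartDifferential x u y i‖ ^ 2
      ≤ c2 * ∑ i, ‖chartDifferential x u y i‖ ^ 2 := by
        gcongr
        exact (min_le_left _ _).trans (min_le_right _ _)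
    _ ≤ _ := by
        rw [h3, mul_add]
        exact add_le_add h1 h2

variable [CompactSpace M] [MeasurableSpace M] [BorelSpace M]

/-- Multiplication by `k` and transport to the chart at `x` maps sets of functions that are
bounded in the form norm to bounded sets in `H¹` of a compact set of coordinates. -/
theorem exists_chartPush_mem_h1Ball (g : SmoothMetric n M) {x : M} {k : M → ℝ}
    (hk : ContMDiff (𝓡 n) 𝓘(ℝ, ℝ) ∞ k) (hkx : tsupport k ⊆ (extChartAt (𝓡 n) x).source)
    (C : ℝ) : ∃ C' : ℝ≥0∞, C' ≠ ⊤ ∧ ∀ u : M → ℂ, ContMDiff (𝓡 n) 𝓘(ℝ, ℂ) ∞ u →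
      ∫⁻ p, ‖u p‖ₑ ^ 2 ∂riemannianVolume g ≤ ENNReal.ofReal C →
      ∫ p, gradNormSq g u p ∂riemannianVolume g ≤ C →
      chartPush x (fun p => (k p : ℂ) * u p) ∈
        h1Ball volume (extChartAt (𝓡 n) x '' tsupport fun p => (k p : ℂ)) C' := by
  set κ : M → ℂ := fun p => (k p : ℂ) with hκ
  have hκs : ContMDiff (𝓡 n) 𝓘(ℝ, ℂ) ∞ κ := Complex.ofRealCLM.contDiff.contMDiff.comp hk
  have hs : Function.support κ ⊆ Function.support k := fun q hq h0 => hq (by simp [hκ, h0])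
  have hκx : tsupport κ ⊆ (extChartAt (𝓡 n) x).source := (closure_mono hs).trans hkx
  set K := extChartAt (𝓡 n) x '' tsupport κ with hKdef
  have hK : IsCompact K := isCompact_image_tsupport hκx
  have hKT : K ⊆ (extChartAt (𝓡 n) x).target := image_tsupport_subset_target hκx
  obtain ⟨c, B, hc, hc1, -, hcB⟩ := exists_bounds_of_isCompact g hK hKT
  have hχ : ContDiff ℝ ∞ (chartPush x κ) := contDiff_chartPush hκs hκx
  have hχc : HasCompactSupport (chartPush (n := n) x κ) := hasCompactSupport_chartPush hκx
  obtain ⟨a1, ha1⟩ := hχc.exists_bound_of_continuous hχ.continuous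
  obtain ⟨a2, ha2⟩ := (hχc.fderiv ℝ).exists_bound_of_continuous (hχ.continuous_fderiv (by simp))
  set a : ℝ≥0∞ := ENNReal.ofReal (max a1 a2) with ha
  have hb1 : ∀ y, ‖chartPush x κ y‖ₑ ≤ a := fun y => by
    rw [← ofReal_norm]; exact ENNReal.ofReal_le_ofReal ((ha1 y).trans (le_max_left _ _))
  have hb2 : ∀ y, ‖fderiv ℝ (chartPush x κ) y‖ₑ ≤ a := fun y => by
    rw [← ofReal_norm]; exact ENNReal.ofReal_le_ofReal ((ha2 y).trans (le_max_right _ _))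
  set b : ℝ≥0∞ := ENNReal.ofReal c⁻¹ with hb
  have hb1' : 1 ≤ b := ENNReal.one_le_ofReal.2 ((one_le_inv₀ hc).2 hc1)
  set L : ℝ≥0∞ := 4 * a ^ 2 * b ^ 2 with hL
  have hLt : L ≠ ⊤ := ENNReal.mul_ne_top (ENNReal.mul_ne_top (by norm_num) (by simp [ha]))
    (by simp [hb])
  refine ⟨L * (ENNReal.ofReal C + ENNReal.ofReal C), ENNReal.mul_ne_top hLt (by simp),
    fun u hu h1 h2 => ?_⟩
  set F := chartPush (n := n) x (fun p => κ p * u p) with hF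
  have hts : tsupport (fun p => κ p * u p) ⊆ tsupport κ := tsupport_mul_subset_left
  have hFs : ContDiff ℝ ∞ F := contDiff_chartPush (hκs.complex_mul hu) (hts.trans hκx)
  have hFK : tsupport F ⊆ K :=
    (tsupport_chartPush_subset (hts.trans hκx)).trans (Set.image_mono hts)
  -- the density of the form norm with respect to the Riemannian volume
  set N : M → ℝ≥0∞ := fun p => ENNReal.ofReal (gradNormSq g u p) + ‖u p‖ₑ ^ 2 with hN
  have hgc : Continuous (gradNormSq g u) :=
    Complex.continuous_re.comp (continuous_gradInner g hu.conjFun hu)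
  have hNm : Measurable N := hgc.measurable.ennreal_ofReal.add
    (hu.continuous.enorm.measurable.pow_const 2)
  have hNint : ∫⁻ p, N p ∂riemannianVolume g ≤ ENNReal.ofReal C + ENNReal.ofReal C := by
    rw [hN, lintegral_add_left hgc.measurable.ennreal_ofReal]
    refine add_le_add ?_ h1
    rw [← ofReal_integral_eq_lintegral_ofReal
      (hgc.integrable_of_hasCompactSupport (HasCompactSupport.of_compactSpace _))
      (ae_of_all _ fun p => gradNormSq_nonneg g u p)]
    exact ENNReal.ofReal_le_ofReal h2
  have hbd : ∀ y ∈ K, 1 ≤ b * ENNReal.ofReal (volumeDensity g x y) := fun y hy => by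
    rw [hb, ← ENNReal.ofReal_mul (by positivity)]
    refine ENNReal.one_le_ofReal.2 ?_
    rw [inv_mul_eq_div, one_le_div hc]
    exact (hcB y hy).1
  -- both squares are bounded by `L` times the density of the form norm
  have hint : ∀ G : EuclideanSpace ℝ (Fin n) → ℝ≥0∞, (∀ y, y ∉ K → G y = 0) →
      (∀ y ∈ K, G y ≤ 4 * a ^ 2 * (b * N ((extChartAt (𝓡 n) x).symm y))) →
      ∫⁻ y, G y ≤ L * (ENNReal.ofReal C + ENNReal.ofReal C) := by
    intro G hG0 hG
    calc ∫⁻ y, G y = ∫⁻ y in (extChartAt (𝓡 n) x).target, G y :=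
          (setLIntegral_eq_of_support_subset (Function.support_subset_iff'.2
            fun y hy => hG0 y fun h => hy (hKT h))).symm
      _ ≤ ∫⁻ y in (extChartAt (𝓡 n) x).target, L * (ENNReal.ofReal (volumeDensity g x y) *
            N ((extChartAt (𝓡 n) x).symm y)) := by
          refine lintegral_mono fun y => ?_
          by_cases hy : y ∈ K
          · calc G y ≤ 4 * a ^ 2 * (b * N ((extChartAt (𝓡 n) x).symm y)) * 1 := by
                  rw [mul_one]; exact hG y hy
              _ ≤ 4 * a ^ 2 * (b * N ((extChartAt (𝓡 n) x).symm y)) *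
                  (b * ENNReal.ofReal (volumeDensity g x y)) := by
                  gcongr
                  exact hbd y hy
              _ = _ := by rw [hL]; ring
          · rw [hG0 y hy]; exact zero_le
      _ = L * ∫⁻ p in (extChartAt (𝓡 n) x).source, N p ∂riemannianVolume g := by
          rw [lintegral_const_mul' _ _ hLt, setLIntegral_riemannianVolume g x hNm]
      _ ≤ L * (ENNReal.ofReal C + ENNReal.ofReal C) := by
          gcongr
          exact (setLIntegral_le_lintegral _ _).trans hNint
  have hF0 : ∀ y, y ∉ K → y ∉ tsupport F := fun y hy h => hy (hFK h)
  refine ⟨hFs.of_le (by exact_mod_cast le_top), (subset_tsupport F).trans hFK, ?_, ?_⟩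
  · refine hint _ (fun y hy => by rw [image_eq_zero_of_notMem_tsupport (hF0 y hy)]; simp)
      fun y hy => ?_
    have e : F y = chartPush x κ y * u ((extChartAt (𝓡 n) x).symm y) := by
      rw [hF, chartPush_apply (hKT hy), chartPush_apply (hKT hy)]
    rw [e, enorm_mul, mul_pow]
    calc ‖chartPush x κ y‖ₑ ^ 2 * ‖u ((extChartAt (𝓡 n) x).symm y)‖ₑ ^ 2
        ≤ a ^ 2 * N ((extChartAt (𝓡 n) x).symm y) := by
          gcongr
          · exact hb1 y
          · exact le_add_self
      _ ≤ (4 * a ^ 2) * (b * N ((extChartAt (𝓡 n) x).symm y)) := by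
          gcongr
          · exact le_mul_of_one_le_left zero_le (by norm_num)
          · exact le_mul_of_one_le_left zero_le hb1'
  · refine hint _ (fun y hy => by
      rw [← ofReal_norm, fderiv_of_notMem_tsupport _ (hF0 y hy), norm_zero]; simp)
      fun y hy => ?_
    have hT := (isOpen_extChartAt_target x).mem_nhds (hKT hy)
    have e : F =ᶠ[𝓝 y] fun z => chartPush x κ z * (u ∘ (extChartAt (𝓡 n) x).symm) z := by
      filter_upwards [hT] with z hz
      rw [hF, chartPush_apply hz, chartPush_apply hz]
      rfl
    rw [e.fderiv_eq]
    refine (enorm_fderiv_mul_sq_le (hχ.differentiable (by simp) y)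
      (hu.differentiableAt_comp_extChartAt_symm (hKT hy)) (hb1 y) (hb2 y)).trans ?_
    gcongr
    rw [hN, mul_add]
    refine add_le_add ((enorm_sq_le_sum_enorm_apply_sq _).trans ?_)
      (le_mul_of_one_le_left zero_le hb1')
    have h3 : ∑ i, ‖chartDifferential x u y i‖ ^ 2 ≤
        c⁻¹ * gradNormSq g u ((extChartAt (𝓡 n) x).symm y) := by
      rw [inv_mul_eq_div, le_div_iff₀' hc]
      exact (hcB y hy).2.2 u hu
    rw [hb, ← ENNReal.ofReal_mul (by positivity)]
    refine le_trans (le_of_eq ?_) (ENNReal.ofReal_le_ofReal h3)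
    rw [ENNReal.ofReal_sum_of_nonneg fun i _ => by positivity]
    refine Finset.sum_congr rfl fun i _ => ?_
    rw [ENNReal.ofReal_pow (norm_nonneg _), ofReal_norm]
    rfl

/-- Rellich's theorem for multipliers supported in the domain of a chart, by transport to the
Euclidean theorem. -/
theorem isFormCompactMultiplier_of_tsupport_subset (g : SmoothMetric n M) {x : M} {k : M → ℝ}
    (hk : ContMDiff (𝓡 n) 𝓘(ℝ, ℝ) ∞ k) (hkx : tsupport k ⊆ (extChartAt (𝓡 n) x).source) :
    IsFormCompactMultiplier (riemannianVolume g) (manifoldTestFunctions n M)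
      (fun u => ∫ p, gradNormSq g u p ∂riemannianVolume g) k := by
  intro C δ hδ
  obtain ⟨C', hC', hmem⟩ := exists_chartPush_mem_h1Ball g hk hkx C
  set κ : M → ℂ := fun p => (k p : ℂ) with hκ
  have hs : Function.support κ ⊆ Function.support k := fun q hq h0 => hq (by simp [hκ, h0])
  have hκx : tsupport κ ⊆ (extChartAt (𝓡 n) x).source := (closure_mono hs).trans hkx
  have hK := isCompact_image_tsupport (n := n) hκx
  obtain ⟨c, B, -, -, hB, hcB⟩ := exists_bounds_of_isCompact g hK (image_tsupport_subset_target hκx)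
  have hB0 : 0 < B := by linarith
  obtain ⟨ι, hι, col, hcol⟩ := exists_finite_coloring_h1Ball (μ := volume) hK hC'
    (ε := ENNReal.ofReal (δ / B)) (by simpa using div_pos hδ hB0)
  refine ⟨ι, hι, fun u => col (chartPush x fun p => κ p * u p),
    fun u hu v hv h1 h2 h3 h4 h5 => ?_⟩
  have h6 := hcol _ (hmem u hu.1 h1 h2) _ (hmem v hv.1 h3 h4) h5
  have hcont : Continuous fun p => κ p * (u p - v p) :=
    (Complex.continuous_ofReal.comp hk.continuous).mul (hu.1.continuous.sub hv.1.continuous)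
  have h0 : ∀ p, p ∉ tsupport κ → κ p = 0 := fun p hp => image_eq_zero_of_notMem_tsupport hp
  calc ∫⁻ p, ‖κ p * (u p - v p)‖ₑ ^ 2 ∂riemannianVolume g
      = ∫⁻ p in (extChartAt (𝓡 n) x).source, ‖κ p * (u p - v p)‖ₑ ^ 2 ∂riemannianVolume g := by
        refine (setLIntegral_eq_of_support_subset (Function.support_subset_iff'.2
          fun p hp => ?_)).symm
        simp [h0 p fun h => hp (hκx h)]
    _ = ∫⁻ y in (extChartAt (𝓡 n) x).target, ENNReal.ofReal (volumeDensity g x y) *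
          ‖κ ((extChartAt (𝓡 n) x).symm y) * (u ((extChartAt (𝓡 n) x).symm y) -
            v ((extChartAt (𝓡 n) x).symm y))‖ₑ ^ 2 :=
        setLIntegral_riemannianVolume g x (hcont.enorm.measurable.pow_const 2)
    _ ≤ ∫⁻ y in (extChartAt (𝓡 n) x).target, ENNReal.ofReal B *
          ‖chartPush x (fun p => κ p * u p) y - chartPush x (fun p => κ p * v p) y‖ₑ ^ 2 := by
        refine setLIntegral_mono' (measurableSet_extChartAt_target x) fun y hy => ?_
        rw [chartPush_apply hy, chartPush_apply hy, ← mul_sub]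
        by_cases hyK : y ∈ extChartAt (𝓡 n) x '' tsupport κ
        · gcongr
          exact (hcB y hyK).2.1
        · have : κ ((extChartAt (𝓡 n) x).symm y) = 0 :=
            h0 _ fun h => hyK ⟨_, h, (extChartAt (𝓡 n) x).right_inv hy⟩
          rw [this, zero_mul]
          simp
    _ ≤ ENNReal.ofReal B * ∫⁻ y, ‖chartPush x (fun p => κ p * u p) y -
          chartPush x (fun p => κ p * v p) y‖ₑ ^ 2 := by
        rw [lintegral_const_mul' _ _ ENNReal.ofReal_ne_top]
        exact mul_le_mul_right (setLIntegral_le_lintegral _ _) _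
    _ ≤ ENNReal.ofReal B * ENNReal.ofReal (δ / B) := by gcongr
    _ = ENNReal.ofReal δ := by
        rw [← ENNReal.ofReal_mul hB0.le, mul_div_cancel₀ _ hB0.ne']

/-- Rellich's theorem on a compact manifold. -/
theorem isFormCompactMultiplier_const [T2Space M] (g : SmoothMetric n M) (b : ℝ) :
    IsFormCompactMultiplier (riemannianVolume g) (manifoldTestFunctions n M)
      (fun u => ∫ p, gradNormSq g u p ∂riemannianVolume g) fun _ => b := by
  obtain ⟨t, ρ, hρ, hρs, hρ1⟩ := exists_finite_smooth_partition n M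
  have hb : ∀ x, ContMDiff (𝓡 n) 𝓘(ℝ, ℝ) ∞ fun p => b * ρ x p := fun x =>
    (contDiff_const.mul contDiff_id : ContDiff ℝ ∞ fun s : ℝ => b * s).contMDiff.comp (hρ x)
  have h := IsFormCompactMultiplier.sum (μ := riemannianVolume g)
    (D := manifoldTestFunctions n M)
    (energy := fun u => ∫ p, gradNormSq g u p ∂riemannianVolume g)
    (fun u hu => hu.1.continuous) t (k := fun x p => b * ρ x p) (fun x => (hb x).continuous)
    fun x => isFormCompactMultiplier_of_tsupport_subset g (hb x)
      ((tsupport_mul_subset_right (f := fun _ => b) (g := ρ x)).trans (hρs x))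
  simpa only [← Finset.mul_sum, hρ1, mul_one] using h

theorem riemannianSchrodinger_perturbed [T2Space M] (g : SmoothMetric n M) (h : ℝ) (hh : 0 < h)
    (ε : ℝ) {V W : M → ℝ} (hV : Continuous V) (hW : Continuous W)
    (hb : ∃ C : ℝ, ∀ x, |W x| ≤ C) :
    (perturbedOperator (riemannianVolume g) (riemannianSchrodinger g h V) hW hb ε).IsClosed ∧
    HasDiscreteSpectrumBelow
      (perturbedOperator (riemannianVolume g) (riemannianSchrodinger g h V) hW hb ε) ⊤ := by
  have hmain := isClosed_and_hasDiscreteSpectrumBelow_perturbedOperator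
    (isDirichletLaplacian_riemannian g) hV hW hb h ε hh ⊤ fun β _ => by
      obtain ⟨m, hm⟩ := isCompact_univ.bddBelow_image hV.continuousOn
      exact ⟨fun _ => β - m, continuous_const, ⟨|β - m|, fun _ => le_rfl⟩,
        fun p => by linarith [hm ⟨p, trivial, rfl⟩], isFormCompactMultiplier_const g _⟩
  exact ⟨hmain.1 bot_lt_top, hmain.2⟩

end FormCompact

theorem propositionA1 (n : ℕ) (h : ℝ) (hh : 0 < h) (ε : ℝ) :
    (∀ (V W : EuclideanSpace ℝ (Fin n) → ℝ), ContDiff ℝ ∞ V → ∀ (hW : ContDiff ℝ ∞ W)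
      (hb : ∃ C : ℝ, ∀ x, |W x| ≤ C) (α : EReal),
      α = liminf (fun x => (V x : EReal)) (cocompact (EuclideanSpace ℝ (Fin n))) →
      (⊥ < α →
        (perturbedOperator volume (euclideanSchrodinger n h V) hW.continuous hb ε).IsClosed) ∧
      HasDiscreteSpectrumBelow
        (perturbedOperator volume (euclideanSchrodinger n h V) hW.continuous hb ε) α) ∧
    (∀ (M : Type*) [TopologicalSpace M] [T2Space M] [CompactSpace M]
      [ChartedSpace (EuclideanSpace ℝ (Fin n)) M] [IsManifold (𝓡 n) ∞ M]
      [MeasurableSpace M] [BorelSpace M] (g : SmoothMetric n M) (V W : M → ℝ),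
      ContMDiff (𝓡 n) 𝓘(ℝ, ℝ) ∞ V → ∀ (hW : ContMDiff (𝓡 n) 𝓘(ℝ, ℝ) ∞ W)
      (hb : ∃ C : ℝ, ∀ x, |W x| ≤ C),
      (perturbedOperator (riemannianVolume g) (riemannianSchrodinger g h V)
        hW.continuous hb ε).IsClosed ∧
      HasDiscreteSpectrumBelow (perturbedOperator (riemannianVolume g)
        (riemannianSchrodinger g h V) hW.continuous hb ε) ⊤) := by
  refine ⟨fun V W hV hW hb α hα => ?_, fun M _ _ _ _ _ _ _ g V W hV hW hb => ?_⟩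
  · subst hα
    exact euclideanSchrodinger_perturbed h hh ε V W hV hW.continuous hb
  · exact riemannianSchrodinger_perturbed g h hh ε hV.continuous hW.continuous hb
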